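/- **Theorem 4 (general masses).** Consider three bodies with arbitrary masses $m_1,m_2,m_3>0$ in $\mathbb R^4$ moving under Newtonian attraction, $m_i\ddot r_i=-\nabla_{r_i}U$, $U=-\sum_{i<j}m_im_j/\|r_i-r_j\|$. Put $M=m_1+m_2+m_3$, $\nu_1=\frac{m_2m_3}{m_2+m_3}$, $\nu_2=\frac{m_1(m_2+m_3)}{M}$, $a_i=\frac{m_i}{m_2+m_3}$, $\kappa=\frac{M}{m_1^2(m_2+m_3)^2}$. For $\mu_1>\mu_2>0$ let, on the 8-dimensional space of $(q,p)\in\mathbb R^4\times\mathbb R^4$ near points with $A\neq0$, $|L_3|<\mu_1-\mu_2$, $$H=\tfrac1{2\nu_1}\bigl(p_1^2+p_2^2+f(q_3,q_4)\bigr)+\tfrac1{2\nu_2}\bigl(p_3^2+p_4^2+f(q_1,q_2)\bigr)+V(q_1^2+q_2^2,\;q_3^2+q_4^2,\;q_1q_3+q_2q_4),$$ $$f(x,y)=\tfrac1{16A^2}\bigl((L_d+L_s)^2x^2+(L_d-L_s)^2y^2\bigr),\quad A=\tfrac12(q_1q_4-q_2q_3),\quad L_3=q_1p_2-q_2p_1+q_3p_4-q_4p_3,$$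 $$L_d=\sqrt{(\mu_1-\mu_2)^2-L_3^2},\qquad L_s=\sqrt{(\mu_1+\mu_2)^2-L_3^2},$$ $$V(s_1,s_2,s_3)=-\frac{m_2m_3}{\sqrt{s_1}}-\frac{m_1m_3}{\sqrt{a_2^2s_1+2a_2s_3+s_2}}-\frac{m_1m_2}{\sqrt{a_3^2s_1-2a_3s_3+s_2}},$$ be the reduced Hamiltonian for angular momentum $\sum m_i\,r_i\wedge\dot r_i$ with eigenvalues $\pm i\mu_1,\pm i\mu_2$. A point $(q,p)$ describes, up to rotation, the state with centre of mass at rest at the origin, Jacobi vectors $r_2-r_3=(q_1,q_2,0,0)$, $r_1-\frac{m_2r_2+m_3r_3}{m_2+m_3}=(q_3,q_4,0,0)$, and conjugate momenta $(p_1,p_2,q_3B,-q_4C)$, $(p_3,p_4,-q_1B,q_2C)$, where $B=-\frac{L_s+L_d}{4A}$, $C=-\frac{L_s-L_d}{4A}$. Write $\mu=\mu_2/\mu_1$ and $u=\mu\big/\bigl(m_2m_3\sqrt{\kappa/(m_2+m_3)}\bigr)$. (i) There are functions $Q_1,\dots,Q_4$ of $u$, given by convergent power series near $u=0$, with $$Q_1=u^2-\tfrac{m_1}{m_2+m_3}u^8+O(u^{12}),\qquad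 Q_4=1+\tfrac{3m_2m_3}{2(m_2+m_3)^2}u^4+O(u^8),$$ $$Q_2=\tfrac{3m_1(m_2-m_3)}{2(m_2+m_3)^2}u^{10}\Bigl(1-\tfrac{5m_2^2+24m_2m_3+5m_3^2}{4(m_2+m_3)^2}u^4\Bigr)+O(u^{16}),$$ $$Q_3=-\tfrac{3Mm_2m_3(m_2-m_3)}{2(m_2+m_3)^4}u^{12}\Bigl(1-\tfrac{5(m_2^2+6m_2m_3+m_3^2)}{4(m_2+m_3)^2}u^4\Bigr)+O(u^{18}),$$ such that for all sufficiently small $\mu>0$ (depending on the masses only) and all $\mu_1>0$ the point $q=\kappa\mu_1^2Q(u)$, $p=0$ is a critical point of $H$ with $\mu_2=\mu\mu_1$. (ii) For every such family, for all sufficiently small $\mu>0$ and all $\mu_1>0$: the critical point is a strict local minimum of $H$; the state that it describes has angular momentum with eigenvalues $\pm i\mu_1$, $\pm i\mu_2$ and is a relative equilibrium of the 3-body problem in $\mathbb R^4$ (its orbit is its orbit under a one-parameter group of rotations); this relative equilibrium is Lyapunov stable in the 24-dimensional phase space: nearby initial states have solutions for all times, which remain close to its orbit under the symmetry group of rotations,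 translations and boosts; and there is a ball around this state in the 24-dimensional phase space such that all orbits starting in it are bounded relative to their centre of mass. (iii) For every such family and fixed $\mu_1>0$, as $\mu\to0^+$ the configuration converges to a collision of $m_2$ and $m_3$, with $m_1$ at a positive distance. The same holds for every permutation of the masses; so each of the three pairs of bodies gives such a family of Lyapunov-stable relative equilibria of the same 3-body problem, with a collision of this pair in the limit. -/

import Mathlib

open Filter Topology Asymptotics

noncomputable section

namespace ThreeBody

/-! ### The Newtonian 3-body problem in four-dimensional Euclidean space -/

/-- Four-dimensional Euclidean space. -/
abbrev E4 := EuclideanSpace ℝ (Fin 4)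

/-- The 24-dimensional phase space: the positions and the velocities of three bodies. -/
abbrev State := (Fin 3 → E4) × (Fin 3 → E4)

/-- The gravitational acceleration of body `i` (with gravitational constant `1`). -/
def accel (m : Fin 3 → ℝ) (r : Fin 3 → E4) (i : Fin 3) : E4 :=
  ∑ j ∈ Finset.univ.erase i, (m j / ‖r j - r i‖ ^ 3) • (r j - r i)

/-- `z` is a collision-free solution of Newton's equations at all times in `s`
(used for open intervals and for the whole line). -/
def IsSolutionOn (m : Fin 3 → ℝ) (z : ℝ → State) (s : Set ℝ) : Prop :=
  ∀ t ∈ s, Function.Injective (z t).1 ∧ HasDerivAt z ((z t).2, accel m (z t).1) t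

/-- Centre of mass (applied to velocities: the velocity of the centre of mass). -/
def com (m : Fin 3 → ℝ) (r : Fin 3 → E4) : E4 :=
  (∑ i, m i)⁻¹ • ∑ i, m i • r i

/-- The state seen in the frame of the centre of mass. -/
def centred (m : Fin 3 → ℝ) (z : State) : State :=
  (fun i => z.1 i - com m z.1, fun i => z.2 i - com m z.2)

/-- A linear map of space acting diagonally on positions and velocities. -/
def rotate (g : Matrix (Fin 4) (Fin 4) ℝ) (z : State) : State :=
  (fun i => Matrix.toEuclideanLin g (z.1 i), fun i => Matrix.toEuclideanLin g (z.2 i))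

/-- The total angular momentum `∑ mᵢ rᵢ ∧ vᵢ`, where `x ∧ y = x yᵗ - y xᵗ`. -/
def angularMomentum (m : Fin 3 → ℝ) (z : State) : Matrix (Fin 4) (Fin 4) ℝ :=
  Matrix.of fun a b => ∑ i, m i * (z.1 i a * z.2 i b - z.2 i a * z.1 i b)

/-- `z₀` is a relative equilibrium: its orbit under Newton's equations is its orbit under a
one-parameter group of rotations. -/
def IsRelativeEquilibrium (m : Fin 3 → ℝ) (z₀ : State) : Prop :=
  ∃ ξ : Matrix (Fin 4) (Fin 4) ℝ, ξ.transpose = -ξ ∧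
    IsSolutionOn m (fun t : ℝ => rotate (NormedSpace.exp (t • ξ)) z₀) Set.univ

/-- Lyapunov stability of a relative equilibrium: every initial state close to `z₀` has a
solution that exists for all times, and every solution with such an initial state remains
close to the orbit of `z₀` under the symmetry group, that is, under rotations and, since
the state is seen in the frame of the centre of mass, translations and boosts. -/
def IsLyapunovStable (m : Fin 3 → ℝ) (z₀ : State) : Prop :=
  ∀ ε : ℝ, 0 < ε → ∃ δ : ℝ, 0 < δ ∧ ∀ w : State, dist w z₀ < δ →
    (∃ z : ℝ → State, z 0 = w ∧ IsSolutionOn m z Set.univ) ∧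
    ∀ (z : ℝ → State) (a b : ℝ), a < 0 → 0 < b → z 0 = w → IsSolutionOn m z (Set.Ioo a b) →
      ∀ t ∈ Set.Ioo a b, ∃ g ∈ Matrix.specialOrthogonalGroup (Fin 4) ℝ,
        dist (centred m (z t)) (rotate g (centred m z₀)) < ε

/-- There is a ball around `z₀` in the full phase space such that all orbits starting in it
are bounded (uniformly), in the frame of the centre of mass. -/
def HasBallOfBoundedOrbits (m : Fin 3 → ℝ) (z₀ : State) : Prop :=
  ∃ ρ : ℝ, 0 < ρ ∧ ∃ C : ℝ, ∀ (z : ℝ → State) (a b : ℝ), a < 0 → 0 < b → dist (z 0) z₀ < ρ →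
    IsSolutionOn m z (Set.Ioo a b) → ∀ t ∈ Set.Ioo a b, ‖centred m (z t)‖ ≤ C

/-! ### The reduced Hamiltonian

The masses `m₁, m₂, m₃` are `m 0, m 1, m 2`, and `q₁, …, q₄`, `p₁, …, p₄` are
`q 0, …, q 3`, `p 0, …, p 3`. -/

/-- Reduced mass of the pair `m₂, m₃`. -/
def nu₁ (m : Fin 3 → ℝ) : ℝ := m 1 * m 2 / (m 1 + m 2)

/-- Reduced mass of `m₁` and the pair `m₂, m₃`. -/
def nu₂ (m : Fin 3 → ℝ) : ℝ := m 0 * (m 1 + m 2) / (m 0 + m 1 + m 2)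

/-- The Newtonian potential as a function of `s₁ = ‖x₁‖²`, `s₂ = ‖x₂‖²`, `s₃ = x₁ ⬝ x₂`
where `x₁ = r₂ - r₃` and `x₂ = r₁ - (m₂ r₂ + m₃ r₃) / (m₂ + m₃)` are the Jacobi vectors. -/
def potential (m : Fin 3 → ℝ) (s₁ s₂ s₃ : ℝ) : ℝ :=
  let a₂ : ℝ := m 1 / (m 1 + m 2);
  let a₃ : ℝ := m 2 / (m 1 + m 2);
  -(m 1 * m 2 / √s₁ + m 0 * m 2 / √(a₂ ^ 2 * s₁ + 2 * a₂ * s₃ + s₂) +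
    m 0 * m 1 / √(a₃ ^ 2 * s₁ - 2 * a₃ * s₃ + s₂))

/-- Oriented area of the triangle spanned by `(q₁, q₂)` and `(q₃, q₄)`. -/
def area (q : Fin 4 → ℝ) : ℝ := (q 0 * q 3 - q 1 * q 2) / 2

/-- The angular momentum in the plane of the triangle. -/
def L₃ (q p : Fin 4 → ℝ) : ℝ := q 0 * p 1 - q 1 * p 0 + q 2 * p 3 - q 3 * p 2

/-- `L_d`, with `L_d² = (μ₁ - μ₂)² - L₃²`. -/
def Ld (μ₁ μ₂ l : ℝ) : ℝ := √((μ₁ - μ₂) ^ 2 - l ^ 2)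

/-- `L_s`, with `L_s² = (μ₁ + μ₂)² - L₃²`. -/
def Ls (μ₁ μ₂ l : ℝ) : ℝ := √((μ₁ + μ₂) ^ 2 - l ^ 2)

/-- The function `f(x, y, L₃)`, for a triangle of oriented area `A`. -/
def fRed (μ₁ μ₂ A l x y : ℝ) : ℝ :=
  1 / (16 * A ^ 2) *
    ((Ld μ₁ μ₂ l + Ls μ₁ μ₂ l) ^ 2 * x ^ 2 + (Ld μ₁ μ₂ l - Ls μ₁ μ₂ l) ^ 2 * y ^ 2)

/-- The fully reduced Hamiltonian on the 8-dimensional reduced phase space, in the local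
coordinates `(q, p)` (where `A ≠ 0` and `|L₃| < μ₁ - μ₂`), for angular momentum with
eigenvalues `± i μ₁`, `± i μ₂`. -/
def reducedHamiltonian (m : Fin 3 → ℝ) (μ₁ μ₂ : ℝ) (z : (Fin 4 → ℝ) × (Fin 4 → ℝ)) : ℝ :=
  let q := z.1
  let p := z.2
  1 / (2 * nu₁ m) *
      (p 0 ^ 2 + p 1 ^ 2 + fRed μ₁ μ₂ (area q) (L₃ q p) (q 2) (q 3)) +
    1 / (2 * nu₂ m) *
      (p 2 ^ 2 + p 3 ^ 2 + fRed μ₁ μ₂ (area q) (L₃ q p) (q 0) (q 1)) +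
    potential m (q 0 ^ 2 + q 1 ^ 2) (q 2 ^ 2 + q 3 ^ 2) (q 0 * q 2 + q 1 * q 3)

/-! ### From reduced coordinates back to the 3-body problem -/

/-- The three vectors with vanishing mass-weighted sum and given Jacobi vectors. -/
def fromJacobi (m : Fin 3 → ℝ) (x₁ x₂ : E4) : Fin 3 → E4 :=
  ![((m 1 + m 2) / (m 0 + m 1 + m 2)) • x₂,
    -(m 0 / (m 0 + m 1 + m 2)) • x₂ + (m 2 / (m 1 + m 2)) • x₁,
    -(m 0 / (m 0 + m 1 + m 2)) • x₂ - (m 1 / (m 1 + m 2)) • x₁]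

/-- The state, with centre of mass at rest at the origin, described by the point `(q, p)` of
the reduced phase space, in the body frame (i.e. up to a rotation of space): the Jacobi
vectors are `(q₁, q₂, 0, 0)`, `(q₃, q₄, 0, 0)`, and the conjugate momenta are
`(p₁, p₂, α₁, α₂)`, `(p₃, p₄, α₃, α₄)`, with `αᵢ` such that the angular momentum has
eigenvalues `± i μ₁`, `± i μ₂`. -/
def liftState (m : Fin 3 → ℝ) (μ₁ μ₂ : ℝ) (z : (Fin 4 → ℝ) × (Fin 4 → ℝ)) : State :=
  let q := z.1
  let p := z.2
  let B := -(Ls μ₁ μ₂ (L₃ q p) + Ld μ₁ μ₂ (L₃ q p)) / (4 * area q)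
  let C := -(Ls μ₁ μ₂ (L₃ q p) - Ld μ₁ μ₂ (L₃ q p)) / (4 * area q)
  let x₁ : E4 := !₂[q 0, q 1, 0, 0]
  let x₂ : E4 := !₂[q 2, q 3, 0, 0]
  let y₁ : E4 := !₂[p 0, p 1, q 2 * B, -(q 3 * C)]
  let y₂ : E4 := !₂[p 2, p 3, -(q 0 * B), q 1 * C]
  (fromJacobi m x₁ x₂, fromJacobi m ((nu₁ m)⁻¹ • y₁) ((nu₂ m)⁻¹ • y₂))

/-- Relabel the bodies: body `σ k` of the new state is body `k` of the old one. -/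
def relabel (σ : Equiv.Perm (Fin 3)) (z : State) : State :=
  (z.1 ∘ σ.symm, z.2 ∘ σ.symm)

/-! ### The family of critical points -/

/-- `κ = M / (m₁² (m₂ + m₃)²)`. -/
def kappa (m : Fin 3 → ℝ) : ℝ := (m 0 + m 1 + m 2) / (m 0 ^ 2 * (m 1 + m 2) ^ 2)

/-- The expansion parameter `u = μ / (m₂ m₃ √(κ / (m₂ + m₃)))`. -/
def uParam (m : Fin 3 → ℝ) (μ : ℝ) : ℝ := μ / (m 1 * m 2 * √(kappa m / (m 1 + m 2)))

/-- The point `q = κ μ₁² Q(u)`, `p = 0` of the reduced phase space. -/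
def familyPoint (m : Fin 3 → ℝ) (Q : Fin 4 → ℝ → ℝ) (μ₁ μ : ℝ) :
    (Fin 4 → ℝ) × (Fin 4 → ℝ) :=
  (fun i => kappa m * μ₁ ^ 2 * Q i (uParam m μ), 0)

/-- The state of the 3-body problem with masses `m` described by that point, when body `σ 0`
plays the role of the single mass and `σ 1`, `σ 2` play the role of the close pair (all
reduced quantities are then those for the masses `m ∘ σ`). -/
def familyState (m : Fin 3 → ℝ) (σ : Equiv.Perm (Fin 3)) (Q : Fin 4 → ℝ → ℝ) (μ₁ μ : ℝ) :
    State :=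
  relabel σ (liftState (m ∘ σ) μ₁ (μ * μ₁) (familyPoint (m ∘ σ) Q μ₁ μ))

/-- The functions `Qᵢ`, given near `0` by convergent power series with the stated first terms,
describe critical points `q = κ μ₁² Q(u)`, `p = 0` of the reduced Hamiltonian for all small
`μ = μ₂ / μ₁ > 0`. -/
structure IsCriticalFamily (m : Fin 3 → ℝ) (Q : Fin 4 → ℝ → ℝ) : Prop where
  analytic : ∀ i, AnalyticAt ℝ (Q i) 0
  expansion₁ : (fun u : ℝ => Q 0 u - (u ^ 2 - m 0 / (m 1 + m 2) * u ^ 8))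
    =O[𝓝 0] fun u => u ^ 12
  expansion₂ : (fun u : ℝ => Q 1 u -
      3 * u ^ 10 * m 0 * (m 1 - m 2) / (2 * (m 1 + m 2) ^ 2) *
        (1 - u ^ 4 * (5 * m 1 ^ 2 + 24 * m 2 * m 1 + 5 * m 2 ^ 2) / (4 * (m 1 + m 2) ^ 2)))
    =O[𝓝 0] fun u => u ^ 16
  expansion₃ : (fun u : ℝ => Q 2 u -
      -(3 * u ^ 12 * (m 0 + m 1 + m 2) * m 1 * m 2 * (m 1 - m 2) / (2 * (m 1 + m 2) ^ 4)) *
        (1 - 5 * u ^ 4 * (m 1 ^ 2 + 6 * m 2 * m 1 + m 2 ^ 2) / (4 * (m 1 + m 2) ^ 2)))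
    =O[𝓝 0] fun u => u ^ 18
  expansion₄ : (fun u : ℝ => Q 3 u -
      (1 + 3 * u ^ 4 * m 1 * m 2 / (2 * (m 1 + m 2) ^ 2)))
    =O[𝓝 0] fun u => u ^ 8
  critical : ∀ᶠ μ : ℝ in 𝓝[>] 0, ∀ μ₁ : ℝ, 0 < μ₁ →
    HasFDerivAt (reducedHamiltonian m μ₁ (μ * μ₁))
      (0 : (Fin 4 → ℝ) × (Fin 4 → ℝ) →L[ℝ] ℝ) (familyPoint m Q μ₁ μ)

end ThreeBody

end

/-! Existence. `L₃` vanishes at p = 0 and enters H only through its square and through `Ld`, `Ls`,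
so the critical points with p = 0 are those of the effective potential `kinNum` / (2 `jac`²) + V in
q alone. Under a simultaneous rotation of both Jacobi vectors only `kinNum` changes
(`effGrad_rotation`); this forces q₃q₄/ν₁ + q₁q₂/ν₂ = 0 and eliminates q₃. In units of κμ₁² put q₁ =
vξ, q₂ = vη, q₄ = Y with v = u². Divided by suitable powers of v, the remaining three equations are
analytic up to v = 0, where they decouple into a Kepler problem for the close pair and one for the
outer body. There (ξ, η, Y) = (1, 0, 1) is a nondegenerate solution, and the analytic implicit
function theorem continues it (`exists_analytic_solution`). The expansions come from feeding the
known orders of ξ - 1, η, Y - 1 back into the equations (`solution_expansions`).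

Strict minimum. In coordinates adapted to the family the effective potential is n/u² · F + G, where
F is the energy scale of the pair and G that of the outer body. In the limit F has Hessian the
identity in the three inner variables, and G depends on the outer variable only, convexly; so the
critical point is a strict minimum for small u (`exists_nhds_strict_min`). For p ≠ 0 the kinetic
energy adds a positive term, and the change of `Ld`, `Ls` with `L₃` does not lower H: this needs
μ₁²a ≤ μ₂²b for the two coefficients of `kinNum`, which holds near the family (`four_mul_le_Ld_Ls`).

Stability. Energy, tr(J Jᵗ) and det J, with J the angular momentum, are conserved and invariant
under rotations. Near the equilibrium z₀ every centred state can be rotated into a normal form: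
planar configuration, antidiagonal mixed block of J. When tr(J Jᵗ) and det J have the same values as
at z₀, this normal form is the lift of a point of the reduced phase space whose value of H is the
energy. The strict minimum then shows that the three invariants determine the state up to rotation
(`isRigid_liftState`). By compactness they differ by at least some c > 0 from their values at z₀ on
the boundary of a thin tube around the rotation orbit of z₀, so that orbits starting close to z₀
cannot leave the tube (`infDist_lt_of_deviation_lt`). The perturbed state may have a different
angular momentum, and no family of minima for neighbouring values is needed. -/

noncomputable section

namespace ThreeBody

/-! ### The equations for the critical points -/

/-- The function `x ↦ x ^ (-3/2)`. -/
def invCube (x : ℝ) : ℝ := 1 / √x ^ 3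

lemma contDiffAt_invCube {n : WithTop ℕ∞} {x : ℝ} (hx : 0 < x) : ContDiffAt ℝ n invCube x := by
  unfold invCube
  have : √x ^ 3 ≠ 0 := by positivity
  have h : ContDiffAt ℝ n (fun y : ℝ => √y) x := Real.contDiffAt_sqrt hx.ne'
  fun_prop (disch := assumption)

lemma invCube_sq {y : ℝ} (hy : 0 < y) : invCube (y ^ 2) = 1 / y ^ 3 := by
  rw [invCube, Real.sqrt_sq hy.le]

lemma hasDerivAt_invCube {x : ℝ} (hx : 0 < x) :
    HasDerivAt invCube (-(3 / 2) / √x ^ 5) x := by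
  have h := ((Real.hasDerivAt_sqrt hx.ne').pow 3).inv (by positivity : √x ^ 3 ≠ 0)
  have e : invCube = (fun y : ℝ => √y ^ 3)⁻¹ := by
    ext y; simp [invCube]
  rw [e]
  have : 0 < √x := by positivity
  refine h.congr_deriv ?_
  simp only [Pi.pow_apply]
  push_cast
  field_simp

/-- Ratio of the reduced masses. -/
def massRatio (m : Fin 3 → ℝ) : ℝ := nu₁ m / nu₂ m

/-- Squared distance of the bodies `0` and `2`, in terms of the Jacobi invariants. -/
def distSq₂ (m : Fin 3 → ℝ) (s₁ s₂ s₃ : ℝ) : ℝ :=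
  (m 1 / (m 1 + m 2)) ^ 2 * s₁ + 2 * (m 1 / (m 1 + m 2)) * s₃ + s₂

/-- Squared distance of the bodies `0` and `1`, in terms of the Jacobi invariants. -/
def distSq₃ (m : Fin 3 → ℝ) (s₁ s₂ s₃ : ℝ) : ℝ :=
  (m 2 / (m 1 + m 2)) ^ 2 * s₁ - 2 * (m 2 / (m 1 + m 2)) * s₃ + s₂

/-- Twice the derivative of the interaction of body `0` with the pair with respect to `s₁`. -/
def tidal₁ (m : Fin 3 → ℝ) (s₁ s₂ s₃ : ℝ) : ℝ :=
  m 0 * m 2 * (m 1 / (m 1 + m 2)) ^ 2 * invCube (distSq₂ m s₁ s₂ s₃) +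
    m 0 * m 1 * (m 2 / (m 1 + m 2)) ^ 2 * invCube (distSq₃ m s₁ s₂ s₃)

/-- Twice the derivative of the potential with respect to `s₂`. -/
def tidal₂ (m : Fin 3 → ℝ) (s₁ s₂ s₃ : ℝ) : ℝ :=
  m 0 * m 2 * invCube (distSq₂ m s₁ s₂ s₃) + m 0 * m 1 * invCube (distSq₃ m s₁ s₂ s₃)

/-- The derivative of the potential with respect to `s₃`. -/
def tidal₃ (m : Fin 3 → ℝ) (s₁ s₂ s₃ : ℝ) : ℝ :=
  m 0 * m 1 * m 2 / (m 1 + m 2) *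
    (invCube (distSq₂ m s₁ s₂ s₃) - invCube (distSq₃ m s₁ s₂ s₃))

/-- `s₁` in the rescaled variables `(v, ξ, η, Y)`. -/
def resc₁ (x : ℝ × ℝ × ℝ × ℝ) : ℝ := x.1 ^ 2 * (x.2.1 ^ 2 + x.2.2.1 ^ 2)

/-- `s₂` in the rescaled variables. -/
def resc₂ (m : Fin 3 → ℝ) (x : ℝ × ℝ × ℝ × ℝ) : ℝ :=
  x.2.2.2 ^ 2 + (massRatio m * x.1 ^ 2 * x.2.1 * x.2.2.1 / x.2.2.2) ^ 2

/-- `s₃` in the rescaled variables. -/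
def resc₃ (m : Fin 3 → ℝ) (x : ℝ × ℝ × ℝ × ℝ) : ℝ :=
  x.1 * x.2.2.1 * (x.2.2.2 - massRatio m * x.1 ^ 2 * x.2.1 ^ 2 / x.2.2.2)

/-- `Y² + λ v² η²`. -/
def areaFactor (m : Fin 3 → ℝ) (x : ℝ × ℝ × ℝ × ℝ) : ℝ :=
  x.2.2.2 ^ 2 + massRatio m * x.1 ^ 2 * x.2.2.1 ^ 2

/-- Rescaled first component of the gradient of the effective potential, in the variables
`(v, ξ, η, Y)`. -/
def eqn₁ (m : Fin 3 → ℝ) (x : ℝ × ℝ × ℝ × ℝ) : ℝ :=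
  -(x.2.2.2 ^ 4 / (x.2.1 ^ 4 * areaFactor m x ^ 2)) + invCube (x.2.1 ^ 2 + x.2.2.1 ^ 2) +
    x.1 ^ 3 * tidal₁ m (resc₁ x) (resc₂ m x) (resc₃ m x) / (m 1 * m 2) -
    massRatio m * x.1 ^ 4 * x.2.2.1 * tidal₃ m (resc₁ x) (resc₂ m x) (resc₃ m x) /
      (m 1 * m 2 * x.2.2.2)

/-- Rescaled second component of the gradient. -/
def eqn₂ (m : Fin 3 → ℝ) (x : ℝ × ℝ × ℝ × ℝ) : ℝ :=
  x.2.2.1 * (invCube (x.2.1 ^ 2 + x.2.2.1 ^ 2) +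
    x.1 ^ 3 * (tidal₁ m (resc₁ x) (resc₂ m x) (resc₃ m x) -
      m 0 * (m 1 + m 2) * massRatio m / areaFactor m x ^ 2) / (m 1 * m 2)) +
    x.1 ^ 2 * x.2.2.2 * tidal₃ m (resc₁ x) (resc₂ m x) (resc₃ m x) / (m 1 * m 2)

/-- Rescaled fourth component of the gradient. -/
def eqn₃ (m : Fin 3 → ℝ) (x : ℝ × ℝ × ℝ × ℝ) : ℝ :=
  -(m 0 * (m 1 + m 2) / areaFactor m x ^ 2) + tidal₂ m (resc₁ x) (resc₂ m x) (resc₃ m x) +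
    x.1 * x.2.2.1 * tidal₃ m (resc₁ x) (resc₂ m x) (resc₃ m x) / x.2.2.2

lemma contDiffAt_eqns {m : Fin 3 → ℝ} (hm : ∀ i, 0 < m i) {n : WithTop ℕ∞} :
    ContDiffAt ℝ n (fun x => (eqn₁ m x, eqn₂ m x, eqn₃ m x)) ((0, 1, 0, 1) : ℝ × ℝ × ℝ × ℝ) := by
  have h1 : ContDiffAt ℝ n resc₁ (0, 1, 0, 1) := by unfold resc₁; fun_prop
  have h2 : ContDiffAt ℝ n (resc₂ m) (0, 1, 0, 1) := by
    unfold resc₂; fun_prop (disch := norm_num)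
  have h3 : ContDiffAt ℝ n (resc₃ m) (0, 1, 0, 1) := by
    unfold resc₃; fun_prop (disch := norm_num)
  have h4 : ContDiffAt ℝ n (areaFactor m) (0, 1, 0, 1) := by unfold areaFactor; fun_prop
  have d2 : ContDiffAt ℝ n (fun x => invCube (distSq₂ m (resc₁ x) (resc₂ m x) (resc₃ m x)))
      (0, 1, 0, 1) := by
    refine ContDiffAt.comp (g := invCube) _ (contDiffAt_invCube ?_) ?_
    · norm_num [distSq₂, resc₁, resc₂, resc₃]
    · unfold distSq₂; fun_prop
  have d3 : ContDiffAt ℝ n (fun x => invCube (distSq₃ m (resc₁ x) (resc₂ m x) (resc₃ m x)))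
      (0, 1, 0, 1) := by
    refine ContDiffAt.comp (g := invCube) _ (contDiffAt_invCube ?_) ?_
    · norm_num [distSq₃, resc₁, resc₂, resc₃]
    · unfold distSq₃; fun_prop
  have d1 : ContDiffAt ℝ n (fun x : ℝ × ℝ × ℝ × ℝ => invCube (x.2.1 ^ 2 + x.2.2.1 ^ 2))
      (0, 1, 0, 1) := by
    refine ContDiffAt.comp (g := invCube) _ (contDiffAt_invCube ?_) ?_
    · norm_num
    · fun_prop
  have t1 : ContDiffAt ℝ n (fun x => tidal₁ m (resc₁ x) (resc₂ m x) (resc₃ m x)) (0, 1, 0, 1) := by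
    unfold tidal₁; fun_prop
  have t2 : ContDiffAt ℝ n (fun x => tidal₂ m (resc₁ x) (resc₂ m x) (resc₃ m x)) (0, 1, 0, 1) := by
    unfold tidal₂; fun_prop
  have t3 : ContDiffAt ℝ n (fun x => tidal₃ m (resc₁ x) (resc₂ m x) (resc₃ m x)) (0, 1, 0, 1) := by
    unfold tidal₃; fun_prop
  have p1 := hm 1
  have p2 := hm 2
  have e : areaFactor m (0, 1, 0, 1) = 1 := by norm_num [areaFactor]
  refine ContDiffAt.prodMk ?_ (ContDiffAt.prodMk ?_ ?_)
  · unfold eqn₁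
    fun_prop (disch := first | positivity | (simp [e]; try positivity))
  · unfold eqn₂
    fun_prop (disch := first | positivity | (simp [e]; try positivity))
  · unfold eqn₃
    fun_prop (disch := first | positivity | (simp [e]; try positivity))

/-- The linearization of the equations at `v = 0`. -/
def eqnsLin (k : ℝ) : (ℝ × ℝ × ℝ) →L[ℝ] (ℝ × ℝ × ℝ) :=
  (ContinuousLinearMap.fst ℝ ℝ (ℝ × ℝ)).prod
    (((ContinuousLinearMap.fst ℝ ℝ ℝ).comp (ContinuousLinearMap.snd ℝ ℝ (ℝ × ℝ))).prod
      (k • ((ContinuousLinearMap.snd ℝ ℝ ℝ).comp (ContinuousLinearMap.snd ℝ ℝ (ℝ × ℝ)))))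

lemma eqnsLin_isInvertible {k : ℝ} (hk : k ≠ 0) : (eqnsLin k).IsInvertible := by
  refine ContinuousLinearMap.IsInvertible.of_inverse (g := eqnsLin k⁻¹) ?_ ?_ <;>
  · ext <;> simp [eqnsLin, hk]

/-- At v = 0 the tidal terms drop out: the inner variables satisfy the equations of an unperturbed
pair, and Y those of a body attracted by the total mass of the pair. -/
lemma eqns_zero (m : Fin 3 → ℝ) {ξ η Y : ℝ} (hY : 0 < Y) :
    (eqn₁ m (0, ξ, η, Y), eqn₂ m (0, ξ, η, Y), eqn₃ m (0, ξ, η, Y)) =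
      (-(1 / ξ ^ 4) + invCube (ξ ^ 2 + η ^ 2), η * invCube (ξ ^ 2 + η ^ 2),
        m 0 * (m 1 + m 2) * (-(1 / Y ^ 4) + 1 / Y ^ 3)) := by
  have := invCube_sq hY
  have h4 : Y ^ 4 ≠ 0 := by positivity
  refine Prod.ext ?_ (Prod.ext ?_ ?_)
  · simp [eqn₁, areaFactor, ← pow_mul]
    field_simp
  · simp [eqn₂]
  · simp [eqn₃, areaFactor, tidal₂, distSq₂, distSq₃, resc₁, resc₂, resc₃, this]
    ring

/-- The linearization is diagonal: -ξ⁻⁴ + ξ⁻³ has slope 4 - 3 = 1 at ξ = 1, and likewise for Y; ξ² +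
η² is stationary in η at η = 0, so only the factor η in front contributes there. -/
lemma hasFDerivAt_eqns_zero (m : Fin 3 → ℝ) :
    HasFDerivAt (fun x : ℝ × ℝ × ℝ => (eqn₁ m (0, x), eqn₂ m (0, x), eqn₃ m (0, x)))
      (eqnsLin (m 0 * (m 1 + m 2))) (1, 0, 1) := by
  have hev : (fun x : ℝ × ℝ × ℝ => (eqn₁ m (0, x), eqn₂ m (0, x), eqn₃ m (0, x))) =ᶠ[𝓝 (1, 0, 1)]
      fun x => (-(x.1 ^ 4)⁻¹ + invCube (x.1 ^ 2 + x.2.1 ^ 2),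
        x.2.1 * invCube (x.1 ^ 2 + x.2.1 ^ 2),
        m 0 * (m 1 + m 2) * (-(x.2.2 ^ 4)⁻¹ + (x.2.2 ^ 3)⁻¹)) := by
    have : ∀ᶠ x : ℝ × ℝ × ℝ in 𝓝 (1, 0, 1), 0 < x.2.2 := by
      have : ContinuousAt (fun x : ℝ × ℝ × ℝ => x.2.2) (1, 0, 1) := by fun_prop
      exact this.eventually (lt_mem_nhds (by norm_num))
    filter_upwards [this] with x hx
    obtain ⟨ξ, η, Y⟩ := x
    simpa using eqns_zero m hx
  refine HasFDerivAt.congr_of_eventuallyEq ?_ hev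
  have f1 : HasFDerivAt (fun x : ℝ × ℝ × ℝ => x.1) (ContinuousLinearMap.fst ℝ ℝ (ℝ × ℝ))
      (1, 0, 1) := (ContinuousLinearMap.fst ℝ ℝ (ℝ × ℝ)).hasFDerivAt
  have f2 : HasFDerivAt (fun x : ℝ × ℝ × ℝ => x.2.1) ((ContinuousLinearMap.fst ℝ ℝ ℝ).comp
      (ContinuousLinearMap.snd ℝ ℝ (ℝ × ℝ))) (1, 0, 1) :=
    ((ContinuousLinearMap.fst ℝ ℝ ℝ).comp (ContinuousLinearMap.snd ℝ ℝ (ℝ × ℝ))).hasFDerivAt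
  have f3 : HasFDerivAt (fun x : ℝ × ℝ × ℝ => x.2.2) ((ContinuousLinearMap.snd ℝ ℝ ℝ).comp
      (ContinuousLinearMap.snd ℝ ℝ (ℝ × ℝ))) (1, 0, 1) :=
    ((ContinuousLinearMap.snd ℝ ℝ ℝ).comp (ContinuousLinearMap.snd ℝ ℝ (ℝ × ℝ))).hasFDerivAt
  have hI : HasFDerivAt (fun x : ℝ × ℝ × ℝ => invCube (x.1 ^ 2 + x.2.1 ^ 2)) _ (1, 0, 1) :=
    HasDerivAt.comp_hasFDerivAt (h₂ := invCube) (1, 0, 1)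
      (hasDerivAt_invCube (by norm_num)) ((f1.pow 2).add (f2.pow 2))
  have i4 : ∀ y : ℝ, y = 1 → HasDerivAt (fun y : ℝ => (y ^ 4)⁻¹) (-4) y := by
    rintro y rfl
    exact ((hasDerivAt_pow 4 (1 : ℝ)).inv (by norm_num)).congr_deriv (by norm_num)
  have i3 : ∀ y : ℝ, y = 1 → HasDerivAt (fun y : ℝ => (y ^ 3)⁻¹) (-3) y := by
    rintro y rfl
    exact ((hasDerivAt_pow 3 (1 : ℝ)).inv (by norm_num)).congr_deriv (by norm_num)
  have g1 := HasDerivAt.comp_hasFDerivAt (h₂ := fun y : ℝ => (y ^ 4)⁻¹) ((1, 0, 1) : ℝ × ℝ × ℝ) (i4 _ rfl) f1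
  have g4 := HasDerivAt.comp_hasFDerivAt (h₂ := fun y : ℝ => (y ^ 4)⁻¹) ((1, 0, 1) : ℝ × ℝ × ℝ) (i4 _ rfl) f3
  have g3 := HasDerivAt.comp_hasFDerivAt (h₂ := fun y : ℝ => (y ^ 3)⁻¹) ((1, 0, 1) : ℝ × ℝ × ℝ) (i3 _ rfl) f3
  have key := (g1.neg.add hI).prodMk ((f2.mul hI).prodMk ((g4.neg.add g3).const_mul
    (m 0 * (m 1 + m 2))))
  refine key.congr_fderiv ?_
  have i1 : invCube 1 = 1 := by simp [invCube]
  ext <;> norm_num [eqnsLin, i1]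
  ring

/-- The solution of the rescaled equations. -/
theorem exists_analytic_solution {m : Fin 3 → ℝ} (hm : ∀ i, 0 < m i) :
    ∃ ψ : ℝ → ℝ × ℝ × ℝ, AnalyticAt ℝ ψ 0 ∧ ψ 0 = (1, 0, 1) ∧
      ∀ᶠ v in 𝓝 (0 : ℝ), eqn₁ m (v, ψ v) = 0 ∧ eqn₂ m (v, ψ v) = 0 ∧ eqn₃ m (v, ψ v) = 0 := by
  have p0 := hm 0
  have p1 := hm 1
  have p2 := hm 2
  set f : ℝ × ℝ × ℝ × ℝ → ℝ × ℝ × ℝ := fun x => (eqn₁ m x, eqn₂ m x, eqn₃ m x) with hf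
  -- In `WithTop ℕ∞` the top element means analytic, so the implicit function is analytic as well.
  have cd : ContDiffAt ℝ ⊤ f ((0, 1, 0, 1) : ℝ × ℝ × ℝ × ℝ) := contDiffAt_eqns hm
  have hd : fderiv ℝ f (0, 1, 0, 1) ∘L .inr ℝ ℝ (ℝ × ℝ × ℝ) = eqnsLin (m 0 * (m 1 + m 2)) := by
    have h1 : HasFDerivAt f (fderiv ℝ f (0, 1, 0, 1)) ((0 : ℝ), ((1, 0, 1) : ℝ × ℝ × ℝ)) :=
      (cd.differentiableAt (by simp)).hasFDerivAt
    have h2 := h1.comp (1, 0, 1) (hasFDerivAt_prodMk_right (𝕜 := ℝ) (0 : ℝ) ((1, 0, 1) : ℝ × ℝ × ℝ))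
    exact h2.unique (hasFDerivAt_eqns_zero m)
  have inv : (fderiv ℝ f (0, 1, 0, 1) ∘L .inr ℝ ℝ (ℝ × ℝ × ℝ)).IsInvertible := by
    rw [hd]; exact eqnsLin_isInvertible (by positivity)
  have z : f (0, 1, 0, 1) = 0 := by
    have := eqns_zero m (ξ := 1) (η := 0) (Y := 1) one_pos
    simp only [hf, this]
    norm_num [invCube]
  refine ⟨cd.implicitFunction (by simp) inv, ?_, cd.implicitFunction_apply_self (by simp) inv, ?_⟩
  · exact (cd.contDiffAt_implicitFunction (by simp) inv).analyticAt
  · filter_upwards [cd.eventually_apply_implicitFunction (by simp) inv] with v hv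
    rw [z] at hv
    simpa [hf, Prod.ext_iff] using hv

/-! ### Expansions -/

/-- `f` and `g` are continuous at `0` and agree there to order `k`. -/
structure AgreesTo (k : ℕ) (f g : ℝ → ℝ) : Prop where
  left : ContinuousAt f 0
  right : ContinuousAt g 0
  isBigO : (fun v => f v - g v) =O[𝓝 0] fun v => v ^ k

namespace AgreesTo

variable {k j : ℕ} {f g h f₁ g₁ f₂ g₂ : ℝ → ℝ}

lemma refl (hf : ContinuousAt f 0) : AgreesTo k f f :=
  ⟨hf, hf, by simpa using isBigO_zero _ _⟩

lemma symm (h : AgreesTo k f g) : AgreesTo k g f :=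
  ⟨h.right, h.left, by simpa using h.isBigO.neg_left⟩

lemma trans (h₁ : AgreesTo k f g) (h₂ : AgreesTo k g h) : AgreesTo k f h :=
  ⟨h₁.left, h₂.right, by simpa using h₁.isBigO.add h₂.isBigO⟩

lemma mono (h : AgreesTo k f g) (hj : j ≤ k) : AgreesTo j f g := by
  refine ⟨h.left, h.right, h.isBigO.trans ?_⟩
  obtain ⟨i, rfl⟩ := Nat.exists_eq_add_of_le hj
  have : (fun v : ℝ => v ^ i) =O[𝓝 0] fun _ => (1 : ℝ) := by
    have : ContinuousAt (fun v : ℝ => v ^ i) 0 := by fun_prop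
    exact this.isBigO_one ℝ
  simpa [pow_add] using (isBigO_refl (fun v : ℝ => v ^ j) (𝓝 0)).mul this

lemma congr_left (h : AgreesTo k f g) (e : f =ᶠ[𝓝 0] f₁) : AgreesTo k f₁ g :=
  ⟨h.left.congr e, h.right, h.isBigO.congr' (e.sub (EventuallyEq.refl _ _)) (EventuallyEq.refl _ _)⟩

lemma congr_right (h : AgreesTo k f g) (e : g =ᶠ[𝓝 0] g₁) : AgreesTo k f g₁ :=
  (h.symm.congr_left e).symm

lemma add (h₁ : AgreesTo k f₁ g₁) (h₂ : AgreesTo k f₂ g₂) :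
    AgreesTo k (fun v => f₁ v + f₂ v) (fun v => g₁ v + g₂ v) :=
  ⟨h₁.left.add h₂.left, h₁.right.add h₂.right,
    (h₁.isBigO.add h₂.isBigO).congr_left fun v => by ring⟩

lemma mul (h₁ : AgreesTo k f₁ g₁) (h₂ : AgreesTo k f₂ g₂) :
    AgreesTo k (fun v => f₁ v * f₂ v) (fun v => g₁ v * g₂ v) := by
  refine ⟨h₁.left.mul h₂.left, h₁.right.mul h₂.right, ?_⟩
  have e₁ := h₁.isBigO.mul (h₂.left.isBigO_one ℝ)
  have e₂ := (h₁.right.isBigO_one ℝ).mul h₂.isBigO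
  simp only [mul_one, one_mul] at e₁ e₂
  exact (e₁.add e₂).congr_left fun v => by ring

lemma const (c : ℝ) : AgreesTo k (fun _ => c) (fun _ => c) := refl continuousAt_const

lemma const_mul (c : ℝ) (h : AgreesTo k f g) : AgreesTo k (fun v => c * f v) (fun v => c * g v) :=
  (const c).mul h

lemma neg (h : AgreesTo k f g) : AgreesTo k (fun v => -f v) (fun v => -g v) := by
  simpa using h.const_mul (-1)

lemma sub (h₁ : AgreesTo k f₁ g₁) (h₂ : AgreesTo k f₂ g₂) :
    AgreesTo k (fun v => f₁ v - f₂ v) (fun v => g₁ v - g₂ v) := by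
  simpa [sub_eq_add_neg] using h₁.add h₂.neg

lemma pow (h : AgreesTo k f g) (i : ℕ) : AgreesTo k (fun v => f v ^ i) (fun v => g v ^ i) := by
  induction i with
  | zero => simpa using const 1
  | succ i ih => simpa [pow_succ] using ih.mul h

lemma pow_mul (h : AgreesTo k f g) (i : ℕ) :
    AgreesTo (i + k) (fun v => v ^ i * f v) (fun v => v ^ i * g v) := by
  have c : ContinuousAt (fun v : ℝ => v ^ i) 0 := by fun_prop
  refine ⟨c.mul h.left, c.mul h.right, ?_⟩
  have := (isBigO_refl (fun v : ℝ => v ^ i) (𝓝 0)).mul h.isBigO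
  simp only [← pow_add] at this
  exact this.congr_left fun v => by ring

lemma mul_zero_order (h₁ : AgreesTo j f fun _ => 0) (h₂ : AgreesTo k g fun _ => 0) :
    AgreesTo (j + k) (fun v => f v * g v) fun _ => 0 := by
  refine ⟨h₁.left.mul h₂.left, continuousAt_const, ?_⟩
  simpa [pow_add] using h₁.isBigO.mul h₂.isBigO

/-- A C¹ function is Lipschitz near f 0; the common value at 0 puts both functions into the same
neighbourhood. -/
lemma comp {φ : ℝ → ℝ} (h : AgreesTo k f g) (hk : f 0 = g 0) (hφ : ContDiffAt ℝ 1 φ (f 0)) :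
    AgreesTo k (fun v => φ (f v)) (fun v => φ (g v)) := by
  refine ⟨ContinuousAt.comp hφ.continuousAt h.left,
    ContinuousAt.comp (hk ▸ hφ.continuousAt) h.right, ?_⟩
  obtain ⟨K, t, ht, hL⟩ := hφ.exists_lipschitzOnWith
  refine IsBigO.trans (IsBigO.of_bound K ?_) h.isBigO
  filter_upwards [h.left ht, h.right (hk ▸ ht)] with v h₁ h₂
  exact hL.norm_sub_le h₁ h₂

lemma inv (h : AgreesTo k f g) (hk : f 0 = g 0) (h0 : f 0 ≠ 0) :
    AgreesTo k (fun v => (f v)⁻¹) (fun v => (g v)⁻¹) :=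
  h.comp hk (contDiffAt_inv ℝ h0)

lemma of_mul (hm : AgreesTo k (fun v => f v * h v) (fun v => g v * h v)) (hf : ContinuousAt f 0)
    (hg : ContinuousAt g 0) (hh : ContinuousAt h 0) (h0 : h 0 ≠ 0) : AgreesTo k f g := by
  have e : ∀ᶠ v in 𝓝 0, h v ≠ 0 := hh.eventually_ne h0
  have := hm.mul (refl (hh.inv₀ h0))
  refine ⟨hf, hg, this.isBigO.congr' ?_ (EventuallyEq.refl _ _)⟩
  filter_upwards [e] with v hv
  simp [hv]

lemma of_eq {r : ℝ → ℝ} (hg : ContinuousAt g 0) (hr : ContinuousAt r 0)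
    (e : ∀ v, f v = g v + v ^ k * r v) : AgreesTo k f g := by
  have c : ContinuousAt (fun v : ℝ => v ^ k) 0 := by fun_prop
  obtain rfl : f = fun v => g v + v ^ k * r v := funext e
  refine ⟨hg.add (c.mul hr), hg, ?_⟩
  simpa using (isBigO_refl (fun v : ℝ => v ^ k) (𝓝 0)).mul (hr.isBigO_one ℝ)

lemma of_differentiableAt (hf : DifferentiableAt ℝ f 0) : AgreesTo 1 f fun _ => f 0 :=
  ⟨hf.continuousAt, continuousAt_const, by simpa using hf.isBigO_sub⟩

end AgreesTo

/-- With s = (1 + x)^(3/2) and the Taylor polynomial p, multiplication by the conjugate gives 1/s -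
p = (1 - s²p²) / (s (1 + s p)). Since s² = (1 + x)³ is a polynomial, the numerator is x³ times an
explicit polynomial. -/
lemma invCube_one_add_expansion :
    (fun x : ℝ => invCube (1 + x) - (1 - 3 / 2 * x + 15 / 8 * x ^ 2)) =O[𝓝 0] fun x => x ^ 3 := by
  have hs : ContinuousAt (fun x : ℝ => √(1 + x)) 0 := by fun_prop
  have key : (fun x : ℝ => invCube (1 + x) - (1 - 3 / 2 * x + 15 / 8 * x ^ 2)) =ᶠ[𝓝 0]
      fun x => x ^ 3 * (-(280 + 105 * x - 21 * x ^ 2 + 315 * x ^ 3 + 225 * x ^ 4) / 64 /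
        (√(1 + x) ^ 3 * (1 + √(1 + x) ^ 3 * (1 - 3 / 2 * x + 15 / 8 * x ^ 2)))) := by
    have e : ∀ᶠ x : ℝ in 𝓝 0, -1 / 2 < x ∧ x < 1 / 4 :=
      Ioo_mem_nhds (by norm_num) (by norm_num)
    filter_upwards [e] with x hx
    have hp : 0 < √(1 + x) := by apply Real.sqrt_pos.2; linarith
    have hq : √(1 + x) ^ 2 = 1 + x := Real.sq_sqrt (by linarith)
    have hr : 0 < 1 - 3 / 2 * x + 15 / 8 * x ^ 2 := by nlinarith
    set s := √(1 + x) ^ 3 with hs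
    have h6 : s ^ 2 = (1 + x) ^ 3 := by rw [← hq, hs]; ring
    have hs0 : 0 < s := by positivity
    rw [invCube, ← hs]
    set p := 1 - 3 / 2 * x + 15 / 8 * x ^ 2 with hpdef
    have h7 : 1 - s ^ 2 * p ^ 2 =
        x ^ 3 * (-(280 + 105 * x - 21 * x ^ 2 + 315 * x ^ 3 + 225 * x ^ 4) / 64) := by
      rw [h6, hpdef]; ring
    rw [mul_div_assoc', ← h7]
    have : 0 < 1 + s * p := by positivity
    field_simp
    ring
  refine key.trans_isBigO ?_
  have c : ContinuousAt (fun x : ℝ => -(280 + 105 * x - 21 * x ^ 2 + 315 * x ^ 3 + 225 * x ^ 4) / 64 /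
        (√(1 + x) ^ 3 * (1 + √(1 + x) ^ 3 * (1 - 3 / 2 * x + 15 / 8 * x ^ 2)))) 0 := by
    refine ContinuousAt.div (by fun_prop) (by fun_prop) (by norm_num)
  simpa using (isBigO_refl (fun v : ℝ => v ^ 3) (𝓝 0)).mul (c.isBigO_one ℝ)

namespace AgreesTo

variable {k j : ℕ} {f g h f₁ g₁ f₂ g₂ : ℝ → ℝ}

lemma zero_mul (h : AgreesTo k f fun _ => 0) (hg : ContinuousAt g 0) :
    AgreesTo k (fun v => f v * g v) fun _ => 0 := by
  simpa using h.mul (refl hg)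

lemma pow_mul_zero (h : AgreesTo k f fun _ => 0) (i : ℕ) :
    AgreesTo (i + k) (fun v => v ^ i * f v) fun _ => 0 := by
  simpa using h.pow_mul i

lemma cast (h : AgreesTo k f g) (e₁ : ∀ v, f v = f₁ v) (e₂ : ∀ v, g v = g₁ v) :
    AgreesTo k f₁ g₁ := by
  obtain rfl := funext e₁
  obtain rfl := funext e₂
  exact h

/-- The remainder is cubic in f = O(v²), hence O(v⁶). -/
lemma invCube_one_add (h : AgreesTo 2 f fun _ => 0) (h0 : f 0 = 0) :
    AgreesTo 6 (fun v => invCube (1 + f v))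
      (fun v => 1 - 3 / 2 * f v + 15 / 8 * f v ^ 2) := by
  have cf := h.left
  have hc : ContinuousAt (fun v : ℝ => 1 + f v) 0 := by fun_prop
  refine ⟨ContinuousAt.comp (g := invCube)
    (contDiffAt_invCube (n := 1) (by simp [h0])).continuousAt hc, by fun_prop, ?_⟩
  have ht : Tendsto f (𝓝 0) (𝓝 0) := by simpa [ContinuousAt, h0] using cf
  refine (invCube_one_add_expansion.comp_tendsto ht).trans ?_
  have := h.isBigO.pow 3
  simp only [sub_zero, ← _root_.pow_mul] at this
  exact this

end AgreesTo

/-- Leading terms of the solution of the rescaled equations. -/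
theorem solution_expansions {m : Fin 3 → ℝ} (hm : ∀ i, 0 < m i) {ξ η Y : ℝ → ℝ}
    (dξ : DifferentiableAt ℝ ξ 0) (dη : DifferentiableAt ℝ η 0) (dY : DifferentiableAt ℝ Y 0)
    (ξ0 : ξ 0 = 1) (η0 : η 0 = 0) (Y0 : Y 0 = 1)
    (h₁ : ∀ᶠ v in 𝓝 (0 : ℝ), eqn₁ m (v, ξ v, η v, Y v) = 0)
    (h₂ : ∀ᶠ v in 𝓝 (0 : ℝ), eqn₂ m (v, ξ v, η v, Y v) = 0)
    (h₃ : ∀ᶠ v in 𝓝 (0 : ℝ), eqn₃ m (v, ξ v, η v, Y v) = 0) :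
    AgreesTo 5 ξ (fun v => 1 - m 0 / (m 1 + m 2) * v ^ 3) ∧
    AgreesTo 7 η (fun v => 3 / 2 * (m 0 * (m 1 - m 2) / (m 1 + m 2) ^ 2) * v ^ 4 *
      (1 - (5 * m 1 ^ 2 + 24 * m 2 * m 1 + 5 * m 2 ^ 2) / (4 * (m 1 + m 2) ^ 2) * v ^ 2)) ∧
    AgreesTo 4 Y (fun v => 1 + 3 / 2 * (m 1 * m 2 / (m 1 + m 2) ^ 2) * v ^ 2) := by
  have p0 := hm 0
  have p1 := hm 1
  have p2 := hm 2
  have cξ := dξ.continuousAt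
  have cη := dη.continuousAt
  have cY := dY.continuousAt
  have Yne : Y 0 ≠ 0 := by simp [Y0]
  have ξne : ξ 0 ≠ 0 := by simp [ξ0]
  have Ypos : ∀ᶠ v in 𝓝 (0 : ℝ), 0 < Y v := cY.eventually (lt_mem_nhds (by simp [Y0]))
  have ξpos : ∀ᶠ v in 𝓝 (0 : ℝ), 0 < ξ v := cξ.eventually (lt_mem_nhds (by simp [ξ0]))
  have aξ : AgreesTo 1 ξ fun _ => 1 := by simpa [ξ0] using AgreesTo.of_differentiableAt dξ
  have aη : AgreesTo 1 η fun _ => 0 := by simpa [η0] using AgreesTo.of_differentiableAt dη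
  have aY : AgreesTo 1 Y fun _ => 1 := by simpa [Y0] using AgreesTo.of_differentiableAt dY
  set l := massRatio m with hl
  set s₁ : ℝ → ℝ := fun v => resc₁ (v, ξ v, η v, Y v) with hs₁
  set s₂ : ℝ → ℝ := fun v => resc₂ m (v, ξ v, η v, Y v) with hs₂
  set s₃ : ℝ → ℝ := fun v => resc₃ m (v, ξ v, η v, Y v) with hs₃
  set P : ℝ → ℝ := fun v => areaFactor m (v, ξ v, η v, Y v) with hP
  set ρ : ℝ → ℝ := fun v => ξ v ^ 2 + η v ^ 2 with hρ
  -- The orders are relative to the order j of η, so that these estimates serve twice: with j = 1,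
  -- and with j = 4 once that order of η is known. The gain is only 1 because `s₃` contains the
  -- product v η.
  have S₁ : ∀ j, AgreesTo j η (fun _ => 0) → AgreesTo (1 + j) s₁ fun v => v ^ 2 * ξ v ^ 2 := by
    intro j h
    have e := ((h.zero_mul cη).pow_mul_zero 2).mono (show 1 + j ≤ 2 + j by omega)
    refine ((AgreesTo.refl (f := fun v => v ^ 2 * ξ v ^ 2) (by fun_prop)).add e).cast
      (fun v => ?_) fun v => ?_
    · simp only [hs₁, resc₁]; ring
    · ring
  have S₂ : ∀ j, AgreesTo j η (fun _ => 0) → AgreesTo (1 + j) s₂ fun v => Y v ^ 2 := by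
    intro j h
    have c : ContinuousAt (fun v => η v * (l * ξ v / Y v) ^ 2) 0 := by
      fun_prop (disch := assumption)
    have e := ((h.zero_mul c).pow_mul_zero 4).mono (show 1 + j ≤ 4 + j by omega)
    refine ((AgreesTo.refl (f := fun v => Y v ^ 2) (by fun_prop)).add e).cast
      (fun v => ?_) fun v => ?_
    · simp only [hs₂, resc₂]; ring
    · ring
  have S₃ : ∀ j, AgreesTo j η (fun _ => 0) → AgreesTo (1 + j) s₃ fun _ => 0 := by
    intro j h
    have c : ContinuousAt (fun v => Y v - l * v ^ 2 * ξ v ^ 2 / Y v) 0 := by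
      fun_prop (disch := assumption)
    refine ((h.zero_mul c).pow_mul_zero 1).cast (fun v => ?_) fun v => rfl
    simp only [hs₃, resc₃]; ring
  have SP : ∀ j, AgreesTo j η (fun _ => 0) → AgreesTo (1 + j) P fun v => Y v ^ 2 := by
    intro j h
    have e := (((h.zero_mul cη).const_mul l).cast (fun _ => rfl) (fun _ => mul_zero l)
      |>.pow_mul_zero 2).mono (show 1 + j ≤ 2 + j by omega)
    refine ((AgreesTo.refl (f := fun v => Y v ^ 2) (by fun_prop)).add e).cast
      (fun v => ?_) fun v => ?_
    · simp only [hP, areaFactor]; ring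
    · ring
  have cP : ContinuousAt P 0 := (SP 1 aη).left
  have P0 : P 0 = 1 := by simp [hP, areaFactor, η0, Y0]
  have Sρ : ∀ i j, AgreesTo i η (fun _ => 0) → AgreesTo j η (fun _ => 0) →
      AgreesTo (i + j) ρ fun v => ξ v ^ 2 := by
    intro i j h h'
    refine ((AgreesTo.refl (f := fun v => ξ v ^ 2) (by fun_prop)).add
      (h.mul_zero_order h')).cast (fun v => ?_) fun v => ?_
    · simp only [hρ]; ring
    · ring
  set α₂ := m 1 / (m 1 + m 2) with hα₂
  set α₃ := m 2 / (m 1 + m 2) with hα₃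
  set R₂ : ℝ → ℝ := fun v => distSq₂ m (s₁ v) (s₂ v) (s₃ v) with hR₂
  set R₃ : ℝ → ℝ := fun v => distSq₃ m (s₁ v) (s₂ v) (s₃ v) with hR₃
  have A₂ : ∀ j, AgreesTo j η (fun _ => 0) →
      AgreesTo (1 + j) R₂ fun v => Y v ^ 2 + α₂ ^ 2 * (v ^ 2 * ξ v ^ 2) := by
    intro j h
    refine ((((S₁ j h).const_mul (α₂ ^ 2)).add ((S₃ j h).const_mul (2 * α₂))).add (S₂ j h)).cast
      (fun v => rfl) fun v => by ring
  have A₃ : ∀ j, AgreesTo j η (fun _ => 0) →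
      AgreesTo (1 + j) R₃ fun v => Y v ^ 2 + α₃ ^ 2 * (v ^ 2 * ξ v ^ 2) := by
    intro j h
    refine ((((S₁ j h).const_mul (α₃ ^ 2)).sub ((S₃ j h).const_mul (2 * α₃))).add (S₂ j h)).cast
      (fun v => rfl) fun v => by ring
  have R₂0 : R₂ 0 = 1 := by simp [hR₂, hs₁, hs₂, hs₃, distSq₂, resc₁, resc₂, resc₃, Y0]
  have R₃0 : R₃ 0 = 1 := by simp [hR₃, hs₁, hs₂, hs₃, distSq₃, resc₁, resc₂, resc₃, Y0]
  set t₁ : ℝ → ℝ := fun v => tidal₁ m (s₁ v) (s₂ v) (s₃ v) with ht₁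
  set t₂ : ℝ → ℝ := fun v => tidal₂ m (s₁ v) (s₂ v) (s₃ v) with ht₂
  set t₃ : ℝ → ℝ := fun v => tidal₃ m (s₁ v) (s₂ v) (s₃ v) with ht₃
  have cI : ContDiffAt ℝ 1 invCube 1 := contDiffAt_invCube one_pos
  have I₂ : ∀ {k g}, AgreesTo k R₂ g → g 0 = 1 →
      AgreesTo k (fun v => invCube (R₂ v)) fun v => invCube (g v) :=
    fun h h0 => h.comp (by rw [R₂0, h0]) (by rwa [R₂0])
  have I₃ : ∀ {k g}, AgreesTo k R₃ g → g 0 = 1 →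
      AgreesTo k (fun v => invCube (R₃ v)) fun v => invCube (g v) :=
    fun h h0 => h.comp (by rw [R₃0, h0]) (by rwa [R₃0])
  have invY : (fun v => invCube (Y v ^ 2)) =ᶠ[𝓝 0] fun v => (Y v ^ 3)⁻¹ := by
    filter_upwards [Ypos] with v hv
    rw [invCube_sq hv, one_div]
  have drop : ∀ c : ℝ, AgreesTo 2 (fun v => Y v ^ 2 + c * (v ^ 2 * ξ v ^ 2)) fun v => Y v ^ 2 := by
    intro c
    exact AgreesTo.of_eq (r := fun v => c * ξ v ^ 2) (by fun_prop) (by fun_prop) fun v => by ring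
  have B₂ : AgreesTo 2 (fun v => invCube (R₂ v)) fun v => (Y v ^ 3)⁻¹ :=
    (I₂ ((A₂ 1 aη).trans (drop _)) (by simp [Y0])).congr_right invY
  have B₃ : AgreesTo 2 (fun v => invCube (R₃ v)) fun v => (Y v ^ 3)⁻¹ :=
    (I₃ ((A₃ 1 aη).trans (drop _)) (by simp [Y0])).congr_right invY
  -- Both distances between the outer body and the pair equal Y up to order 2, so the difference in
  -- `tidal₃` loses its leading term.
  have T₃ : AgreesTo 2 t₃ fun _ => 0 :=
    ((B₂.sub B₃).const_mul (m 0 * m 1 * m 2 / (m 1 + m 2))).cast (fun v => rfl) fun v => by ring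
  have T₂ : AgreesTo 2 t₂ fun v => m 0 * (m 1 + m 2) * (Y v ^ 3)⁻¹ :=
    ((B₂.const_mul (m 0 * m 2)).add (B₃.const_mul (m 0 * m 1))).cast (fun v => rfl)
      fun v => by ring
  have T₁ : AgreesTo 2 t₁ fun v => m 0 * m 1 * m 2 / (m 1 + m 2) * (Y v ^ 3)⁻¹ := by
    refine ((B₂.const_mul (m 0 * m 2 * α₂ ^ 2)).add (B₃.const_mul (m 0 * m 1 * α₃ ^ 2))).cast
      (fun v => rfl) fun v => ?_
    simp only [hα₂, hα₃]; field_simp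
  -- order of `η`
  set w : ℝ → ℝ := fun v => invCube (ρ v) + v ^ 3 * (t₁ v - m 0 * (m 1 + m 2) * l / P v ^ 2) /
    (m 1 * m 2) with hw
  have cρ : ContinuousAt (fun v => invCube (ρ v)) 0 := by
    refine ContinuousAt.comp (g := invCube) ?_ (by fun_prop)
    simp only [hρ, ξ0, η0]
    norm_num
    exact cI.continuousAt
  have ct₁ := T₁.left
  have ct₂ := T₂.left
  have ct₃ := T₃.left
  have Pne : P 0 ^ 2 ≠ 0 := by simp [P0]
  have mne : m 1 * m 2 ≠ 0 := by positivity
  have cw : ContinuousAt w 0 := by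
    simp only [hw]; fun_prop (disch := assumption)
  have w0 : w 0 = 1 := by simp [hw, hρ, ξ0, η0, invCube]
  have eη : (fun v => -(v ^ 2 * (Y v * t₃ v / (m 1 * m 2)))) =ᶠ[𝓝 0] fun v => η v * w v := by
    filter_upwards [h₂] with v hv
    have : η v * w v + v ^ 2 * Y v * t₃ v / (m 1 * m 2) = 0 := hv
    linear_combination -this
  -- The second equation reads η w = -v² Y t₃ / (m 1 * m 2) with w 0 = 1: two orders come from v²
  -- and two from t₃.
  have aη4 : AgreesTo 4 η fun _ => 0 := by
    have e : AgreesTo 2 (fun v => -(Y v * t₃ v / (m 1 * m 2))) fun _ => 0 := by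
      have c : ContinuousAt (fun v => -(Y v / (m 1 * m 2))) 0 := by fun_prop
      exact (T₃.zero_mul c).cast (fun v => by ring) fun v => rfl
    have e' := ((e.pow_mul_zero 2).cast (f₁ := fun v => -(v ^ 2 * (Y v * t₃ v / (m 1 * m 2))))
      (fun v => by ring) fun v => rfl).congr_left eη
    exact (e'.cast (g₁ := fun v => 0 * w v) (fun v => rfl) fun v => by ring).of_mul cη
      (by fun_prop) cw (by simp [w0])
  -- order of `Y - 1`
  have P4 : AgreesTo 5 (fun v => (P v ^ 2)⁻¹) fun v => (Y v ^ 4)⁻¹ :=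
    (((SP 4 aη4).pow 2).inv (by simp [P0, Y0]) Pne).cast (fun v => rfl) fun v => by
      rw [← pow_mul]
  have eY : AgreesTo 5 t₂ fun v => m 0 * (m 1 + m 2) * (Y v ^ 4)⁻¹ := by
    have c : ContinuousAt (fun v => v * t₃ v / Y v) 0 := by fun_prop (disch := assumption)
    have e := (T₃.zero_mul (g := fun v => η v / Y v) (by fun_prop (disch := assumption)))
    have e1 : AgreesTo 5 (fun v => v ^ 1 * (η v * (t₃ v / Y v))) fun _ => 0 :=
      (aη4.zero_mul (by fun_prop (disch := assumption))).pow_mul_zero 1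
    have e2 := (P4.const_mul (m 0 * (m 1 + m 2))).sub e1
    refine (e2.congr_left ?_).cast (fun v => rfl) fun v => sub_zero _
    filter_upwards [h₃] with v hv
    have : -(m 0 * (m 1 + m 2) / P v ^ 2) + t₂ v + v * η v * t₃ v / Y v = 0 := hv
    linear_combination -this
  have kne : m 0 * (m 1 + m 2) ≠ 0 := by positivity
  -- `T₂` and `eY` give Y⁻³ = Y⁻⁴ up to order 2; multiplication by Y⁴ leaves Y = 1.
  have aY2 : AgreesTo 2 Y fun _ => 1 := by
    have e := (((T₂.symm.trans (eY.mono (by norm_num))).const_mul (m 0 * (m 1 + m 2))⁻¹).mul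
      (AgreesTo.refl (f := fun v => Y v ^ 4) (by fun_prop)))
    refine (e.congr_left ?_).congr_right ?_
    · filter_upwards [Ypos] with v hv
      field_simp
    · filter_upwards [Ypos] with v hv
      field_simp
  -- order of `ξ - 1`
  have invξ : (fun v => invCube (ξ v ^ 2)) =ᶠ[𝓝 0] fun v => (ξ v ^ 3)⁻¹ := by
    filter_upwards [ξpos] with v hv
    rw [invCube_sq hv, one_div]
  have Iρ : AgreesTo 8 (fun v => invCube (ρ v)) fun v => (ξ v ^ 3)⁻¹ :=
    ((Sρ 4 4 aη4 aη4).comp (by simp [hρ, η0]) (by simpa [hρ, η0, ξ0] using cI)).congr_right invξ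
  have X₀ : AgreesTo 5 (fun v => (ξ v ^ 3)⁻¹ + v ^ 3 * (t₁ v / (m 1 * m 2)))
      fun v => (ξ v ^ 4)⁻¹ := by
    have e1 : AgreesTo 5 (fun v => v ^ 4 * (η v * (l * t₃ v / (m 1 * m 2 * Y v)))) fun _ => 0 :=
      ((aη4.zero_mul (by fun_prop (disch := simp [*]))).pow_mul_zero 4).mono (by norm_num)
    have c1 : ContinuousAt (fun v => Y v ^ 4 * (ξ v ^ 4)⁻¹) 0 := by
      fun_prop (disch := simp [*])
    have e2 : AgreesTo 5 (fun v => Y v ^ 4 * (ξ v ^ 4)⁻¹ * (P v ^ 2)⁻¹) fun v => (ξ v ^ 4)⁻¹ := by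
      refine ((AgreesTo.refl c1).mul P4).congr_right ?_
      filter_upwards [Ypos] with v hv
      field_simp
    have c2 : ContinuousAt (fun v => v ^ 3 * (t₁ v / (m 1 * m 2))) 0 := by fun_prop
    have e3 := ((e1.add e2).sub (Iρ.mono (show 5 ≤ 8 by norm_num))).sub (AgreesTo.refl c2)
    have z : AgreesTo 5 (fun _ => (0 : ℝ)) fun v =>
        (ξ v ^ 4)⁻¹ - (ξ v ^ 3)⁻¹ - v ^ 3 * (t₁ v / (m 1 * m 2)) := by
      refine (e3.congr_left ?_).cast (fun v => rfl) fun v => by ring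
      filter_upwards [h₁] with v hv
      have : -(Y v ^ 4 / (ξ v ^ 4 * P v ^ 2)) + invCube (ρ v) + v ^ 3 * t₁ v / (m 1 * m 2) -
        l * v ^ 4 * η v * t₃ v / (m 1 * m 2 * Y v) = 0 := hv
      rw [div_mul_eq_div_div] at this
      linear_combination -this
    have c3 : ContinuousAt (fun v => (ξ v ^ 3)⁻¹ + v ^ 3 * (t₁ v / (m 1 * m 2))) 0 := by
      fun_prop (disch := simp [*])
    exact (z.add (AgreesTo.refl c3)).cast (fun v => by ring) fun v => by ring
  have aξ3 : AgreesTo 3 ξ fun _ => 1 := by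
    have e1 : AgreesTo 3 (fun v => (ξ v ^ 3)⁻¹ + v ^ 3 * (t₁ v / (m 1 * m 2)))
        fun v => (ξ v ^ 3)⁻¹ :=
      AgreesTo.of_eq (by fun_prop (disch := simp [*])) (by fun_prop) fun v => rfl
    have e2 := (e1.symm.trans (X₀.mono (by norm_num))).mul
      (AgreesTo.refl (f := fun v => ξ v ^ 4) (by fun_prop))
    refine (e2.congr_left ?_).congr_right ?_ <;>
    · filter_upwards [ξpos] with v hv
      field_simp
  -- Multiplied by ξ⁴, `X₀` reads ξ + v³ ξ⁴ t₁ / (m 1 * m 2) = 1 up to order 5. Because of the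
  -- factor v³, the other factors are needed only up to order 2.
  have aξ5 : AgreesTo 5 ξ fun v => 1 - m 0 / (m 1 + m 2) * v ^ 3 := by
    have e1 : AgreesTo 2 (fun v => t₁ v / (m 1 * m 2)) fun _ => m 0 / (m 1 + m 2) := by
      have := (T₁.trans (((aY2.pow 3).inv (by simp [Y0]) (by simp [Y0])).const_mul
        (m 0 * m 1 * m 2 / (m 1 + m 2)))).const_mul (m 1 * m 2)⁻¹
      refine this.cast (fun v => by ring) fun v => ?_
      field_simp
    have e2 : AgreesTo 5 (fun v => v ^ 3 * (t₁ v / (m 1 * m 2) * ξ v ^ 4))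
        fun v => v ^ 3 * (m 0 / (m 1 + m 2)) :=
      ((e1.mul ((aξ3.pow 4).mono (by norm_num))).cast (fun v => rfl) fun v => by ring).pow_mul 3
    have e3 := (X₀.mul (AgreesTo.refl (f := fun v => ξ v ^ 4) (by fun_prop))).sub e2
    refine (e3.congr_left ?_).congr_right ?_
    · filter_upwards [ξpos] with v hv
      field_simp
      ring
    · filter_upwards [ξpos] with v hv
      field_simp
  -- second order terms of the tidal forces
  set u : ℝ → ℝ := fun v => v ^ 2 * (Y v ^ 2)⁻¹ with hu
  have au : AgreesTo 2 u fun _ => 0 :=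
    AgreesTo.of_eq (r := fun v => (Y v ^ 2)⁻¹) (by fun_prop) (by fun_prop (disch := simp [*]))
      fun v => by simp [hu]
  have cu := au.left
  have expand : ∀ α : ℝ, AgreesTo 5 (fun v => invCube (Y v ^ 2 + α ^ 2 * (v ^ 2 * ξ v ^ 2)))
      fun v => (Y v ^ 3)⁻¹ * (1 - 3 / 2 * (α ^ 2 * u v) + 15 / 8 * (α ^ 2 * u v) ^ 2) := by
    intro α
    have e1 : AgreesTo 5 (fun v => Y v ^ 2 + α ^ 2 * (v ^ 2 * ξ v ^ 2))
        fun v => Y v ^ 2 + α ^ 2 * (v ^ 2 * 1 ^ 2) :=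
      (AgreesTo.refl (by fun_prop)).add (((aξ3.pow 2).pow_mul 2).const_mul _)
    have e2 := e1.comp (φ := invCube) (by simp) (by simpa [Y0] using cI)
    have e3 : AgreesTo 2 (fun v => α ^ 2 * u v) fun _ => 0 :=
      (au.const_mul (α ^ 2)).cast (fun _ => rfl) fun _ => mul_zero _
    have e4 := (AgreesTo.refl (f := fun v => (Y v ^ 3)⁻¹)
      (by fun_prop (disch := simp [*]))).mul ((e3.invCube_one_add (by simp [hu])).mono
        (show 5 ≤ 6 by norm_num))
    refine (e2.congr_right ?_).trans e4
    filter_upwards [Ypos] with v hv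
    have hsq : Y v ^ 2 + α ^ 2 * (v ^ 2 * 1 ^ 2) = Y v ^ 2 * (1 + α ^ 2 * u v) := by
      simp only [hu]; field_simp
    rw [hsq, invCube, invCube, Real.sqrt_mul (by positivity), Real.sqrt_sq hv.le, mul_pow]
    rw [one_div, mul_inv, one_div]
  have C₂ := (I₂ (A₂ 4 aη4) (by simp [Y0])).trans (expand α₂)
  have C₃ := (I₃ (A₃ 4 aη4) (by simp [Y0])).trans (expand α₃)
  have au4 : AgreesTo 4 u fun v => v ^ 2 :=
    ((((aY2.pow 2).inv (by simp [Y0]) (by simp [Y0])).pow_mul 2)).cast (fun v => rfl)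
      fun v => by simp
  have uu : AgreesTo 4 (fun v => u v ^ 2) fun _ => 0 :=
    AgreesTo.of_eq (r := fun v => (Y v ^ 4)⁻¹) (by fun_prop) (by fun_prop (disch := simp [*]))
      fun v => by simp only [hu]; ring
  -- The constant is 3/2 times the mean of α₂² and α₃² with weights m 2 and m 1, the quadrupole term
  -- in the attraction of the outer body.
  set y := 3 / 2 * (m 1 * m 2 / (m 1 + m 2) ^ 2) with hy
  have aY4 : AgreesTo 4 Y fun v => 1 + y * v ^ 2 := by
    have e1 : ∀ α : ℝ, AgreesTo 4 (fun v => 1 - 3 / 2 * (α ^ 2 * u v) + 15 / 8 * (α ^ 2 * u v) ^ 2)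
        fun v => 1 - 3 / 2 * α ^ 2 * v ^ 2 := by
      intro α
      refine (((AgreesTo.const 1).sub (au4.const_mul (3 / 2 * α ^ 2))).add
        (uu.const_mul (15 / 8 * α ^ 4))).cast (fun v => by ring) fun v => by ring
    have cY3 : ContinuousAt (fun v => (Y v ^ 3)⁻¹) 0 := by fun_prop (disch := simp [*])
    have e2 := ((C₂.mono (show 4 ≤ 5 by norm_num)).trans
      ((AgreesTo.refl cY3).mul (e1 α₂))).const_mul (m 0 * m 2)
    have e3 := ((C₃.mono (show 4 ≤ 5 by norm_num)).trans
      ((AgreesTo.refl cY3).mul (e1 α₃))).const_mul (m 0 * m 1)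
    have e4 := ((eY.mono (show 4 ≤ 5 by norm_num)).symm.trans (e2.add e3)).mul
      (AgreesTo.refl (f := fun v => Y v ^ 4) (by fun_prop))
    have e5 : AgreesTo 4 (fun v => v ^ 2 * Y v) fun v => v ^ 2 * 1 := aY2.pow_mul 2
    have e6 : AgreesTo 4 (fun _ => m 0 * (m 1 + m 2)) fun v =>
        m 0 * (m 1 + m 2) * Y v - m 0 * (m 1 + m 2) * y * (v ^ 2 * Y v) := by
      refine (e4.congr_left ?_).congr_right ?_
      · filter_upwards [Ypos] with v hv
        field_simp
      · filter_upwards [Ypos] with v hv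
        simp only [hα₂, hα₃, hy]
        field_simp
        ring
    have e7 := (e6.symm.const_mul (m 0 * (m 1 + m 2))⁻¹).add (e5.const_mul y)
    refine e7.cast (fun v => ?_) fun v => ?_
    · field_simp
      ring
    · field_simp
  refine ⟨aξ5, ?_, aY4⟩
  have aw : AgreesTo 3 (fun v => w v - 1) fun _ => 0 := by
    have e1 : AgreesTo 3 (fun v => (ξ v ^ 3)⁻¹) fun _ => 1 :=
      ((aξ3.pow 3).inv (by simp [ξ0]) (by simp [ξ0])).cast (fun v => rfl) fun v => by simp
    have c : ContinuousAt (fun v => (t₁ v - m 0 * (m 1 + m 2) * l / P v ^ 2) / (m 1 * m 2)) 0 := by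
      fun_prop (disch := assumption)
    have e2 : AgreesTo 3 (fun v => v ^ 3 *
        ((t₁ v - m 0 * (m 1 + m 2) * l / P v ^ 2) / (m 1 * m 2))) fun _ => 0 :=
      AgreesTo.of_eq (by fun_prop) c fun v => by ring
    exact ((((Iρ.mono (show 3 ≤ 8 by norm_num)).trans e1).add e2).sub (AgreesTo.const 1)).cast
      (fun v => by simp only [hw]; ring) fun v => by ring
  -- Here η (w - 1) has order 4 + 3, so w may be replaced by 1.
  have E₀ : AgreesTo 7 η fun v => -(v ^ 2 * (Y v * t₃ v / (m 1 * m 2))) := by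
    have c : ContinuousAt (fun v => -(v ^ 2 * (Y v * t₃ v / (m 1 * m 2)))) 0 := by fun_prop
    have e1 := (AgreesTo.refl (k := 7) c).congr_left eη
    exact (e1.sub (aη4.mul_zero_order aw)).cast (fun v => by ring) fun v => by ring
  have YY : AgreesTo 4 (fun v => (Y v ^ 2)⁻¹) fun v => 1 - 2 * y * v ^ 2 := by
    refine ((aY4.pow 2).inv (by simp [Y0]) (by simp [Y0])).trans ?_
    have c : ContinuousAt (fun v : ℝ => ((1 + y * v ^ 2) ^ 2)⁻¹) 0 := by
      fun_prop (disch := simp)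
    refine (AgreesTo.of_eq (f := fun v => 1 - 2 * y * v ^ 2)
      (g := fun v => ((1 + y * v ^ 2) ^ 2)⁻¹)
      (r := fun v => (-3 * y ^ 2 - 2 * y ^ 3 * v ^ 2) * ((1 + y * v ^ 2) ^ 2)⁻¹) c
      (by fun_prop (disch := simp)) fun v => ?_).symm
    have : 1 + y * v ^ 2 ≠ 0 := by simp only [hy]; positivity
    field_simp
    ring
  have U6 : AgreesTo 6 u fun v => v ^ 2 * (1 - 2 * y * v ^ 2) := YY.pow_mul 2
  have UU6 : AgreesTo 6 (fun v => u v ^ 2) fun v => v ^ 4 := by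
    have := (((aY2.pow 4).inv (by simp [Y0]) (by simp [Y0])).pow_mul 4)
    exact this.cast (fun v => by simp only [hu]; ring) fun v => by simp
  have br : AgreesTo 5 (fun v => -(3 / 2) * (α₂ ^ 2 - α₃ ^ 2) * u v +
      15 / 8 * (α₂ ^ 4 - α₃ ^ 4) * u v ^ 2)
      fun v => -(3 / 2) * (α₂ ^ 2 - α₃ ^ 2) * (v ^ 2 * (1 - 2 * y * v ^ 2)) +
      15 / 8 * (α₂ ^ 4 - α₃ ^ 4) * v ^ 4 :=
    ((U6.const_mul _).add (UU6.const_mul _)).mono (by norm_num)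
  have E₁ : AgreesTo 5 (fun v => -(Y v * t₃ v / (m 1 * m 2)))
      fun v => -(m 0 / (m 1 + m 2)) * ((Y v ^ 2)⁻¹ * (-(3 / 2) * (α₂ ^ 2 - α₃ ^ 2) * u v +
      15 / 8 * (α₂ ^ 4 - α₃ ^ 4) * u v ^ 2)) := by
    have e1 := ((C₂.sub C₃).const_mul (-(m 0 / (m 1 + m 2)))).mul (AgreesTo.refl cY)
    refine (e1.cast (f₁ := fun v => -(Y v * t₃ v / (m 1 * m 2))) (fun v => ?_)
      fun v => rfl).congr_right ?_
    · simp only [ht₃, tidal₃, hR₂, hR₃]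
      field_simp
    · filter_upwards [Ypos] with v hv
      field_simp
      ring
  have c : ContinuousAt (fun v => (Y v ^ 2)⁻¹) 0 := by fun_prop (disch := simp [*])
  have e1 : AgreesTo 2 (fun v => -(3 / 2) * (α₂ ^ 2 - α₃ ^ 2) * u v +
    15 / 8 * (α₂ ^ 4 - α₃ ^ 4) * u v ^ 2) fun _ => 0 := by
    refine ((au.const_mul (-(3 / 2) * (α₂ ^ 2 - α₃ ^ 2))).add
      ((uu.mono (show 2 ≤ 4 by norm_num)).const_mul (15 / 8 * (α₂ ^ 4 - α₃ ^ 4)))).cast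
      (fun v => rfl) fun v => by ring
  have e2 : AgreesTo 4 (fun v => (Y v ^ 2)⁻¹ - (1 - 2 * y * v ^ 2)) fun _ => 0 :=
    (YY.sub (AgreesTo.refl YY.right)).cast (fun v => rfl) fun v => by ring
  have e3 := ((e2.mul_zero_order e1).mono (show 5 ≤ 4 + 2 by norm_num)).add
    ((AgreesTo.refl YY.right).mul br)
  have e4 := (E₁.trans ((e3.const_mul (-(m 0 / (m 1 + m 2)))).cast (fun v => by ring)
    fun v => rfl)).pow_mul 2
  have E₂ := E₀.trans (e4.cast (fun v => by ring) fun v => rfl)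
  refine E₂.trans ?_
  -- The product of the two truncated factors has one term beyond the claimed polynomial, of order
  -- v⁸; r is this term divided by v⁷.
  refine AgreesTo.of_eq (r := fun v => v * (m 0 / (m 1 + m 2) * (2 * y *
    (15 / 8 * (α₂ ^ 4 - α₃ ^ 4) + 3 * y * (α₂ ^ 2 - α₃ ^ 2))))) (by fun_prop) (by fun_prop)
    fun v => ?_
  simp only [hα₂, hα₃, hy]
  field_simp
  ring

/-! ### The gradient of the reduced Hamiltonian at `p = 0` -/

lemma nu₁_pos {m : Fin 3 → ℝ} (hm : ∀ i, 0 < m i) : 0 < nu₁ m := by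
  have := hm 1
  have := hm 2
  unfold nu₁; positivity

lemma nu₂_pos {m : Fin 3 → ℝ} (hm : ∀ i, 0 < m i) : 0 < nu₂ m := by
  have := hm 0
  have := hm 1
  have := hm 2
  unfold nu₂; positivity

/-- `‖x₁‖²`. -/
def inv₁ (q : Fin 4 → ℝ) : ℝ := q 0 ^ 2 + q 1 ^ 2

/-- `‖x₂‖²`. -/
def inv₂ (q : Fin 4 → ℝ) : ℝ := q 2 ^ 2 + q 3 ^ 2

/-- `x₁ ⬝ x₂`. -/
def inv₃ (q : Fin 4 → ℝ) : ℝ := q 0 * q 2 + q 1 * q 3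

/-- The determinant of the two Jacobi vectors. -/
def jac (q : Fin 4 → ℝ) : ℝ := q 0 * q 3 - q 1 * q 2

lemma inv₁_pos {q : Fin 4 → ℝ} (hq : jac q ≠ 0) : 0 < inv₁ q := by
  rcases (show 0 ≤ inv₁ q by unfold inv₁; positivity).lt_or_eq with h | h
  · exact h
  · exfalso
    unfold inv₁ at h
    have h0 : q 0 = 0 := by nlinarith [sq_nonneg (q 0), sq_nonneg (q 1)]
    have h1 : q 1 = 0 := by nlinarith [sq_nonneg (q 0), sq_nonneg (q 1)]
    exact hq (by simp [jac, h0, h1])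

lemma sq_add_sq_pos_of_det {a b x y : ℝ} (h : a * y - b * x ≠ 0) : 0 < x ^ 2 + y ^ 2 := by
  by_contra hn
  have hx : x = 0 := by nlinarith [sq_nonneg x, sq_nonneg y]
  have hy : y = 0 := by nlinarith [sq_nonneg x, sq_nonneg y]
  exact h (by simp [hx, hy])

lemma distSq₂_pos (m : Fin 3 → ℝ) {q : Fin 4 → ℝ} (hq : jac q ≠ 0) :
    0 < distSq₂ m (inv₁ q) (inv₂ q) (inv₃ q) := by
  set a := m 1 / (m 1 + m 2) with ha
  have : distSq₂ m (inv₁ q) (inv₂ q) (inv₃ q) = (a * q 0 + q 2) ^ 2 + (a * q 1 + q 3) ^ 2 := by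
    unfold distSq₂ inv₁ inv₂ inv₃; rw [← ha]; ring
  rw [this]
  refine sq_add_sq_pos_of_det (a := q 0) (b := q 1) ?_
  convert hq using 1
  unfold jac; ring

lemma distSq₃_pos (m : Fin 3 → ℝ) {q : Fin 4 → ℝ} (hq : jac q ≠ 0) :
    0 < distSq₃ m (inv₁ q) (inv₂ q) (inv₃ q) := by
  set a := m 2 / (m 1 + m 2) with ha
  have : distSq₃ m (inv₁ q) (inv₂ q) (inv₃ q) = (q 2 - a * q 0) ^ 2 + (q 3 - a * q 1) ^ 2 := by
    unfold distSq₃ inv₁ inv₂ inv₃; rw [← ha]; ring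
  rw [this]
  refine sq_add_sq_pos_of_det (a := q 0) (b := q 1) ?_
  convert hq using 1
  unfold jac; ring

/-- The numerator of twice the kinetic energy at `p = 0`. -/
def kinNum (m : Fin 3 → ℝ) (μ₁ μ₂ : ℝ) (q : Fin 4 → ℝ) : ℝ :=
  μ₁ ^ 2 * (q 2 ^ 2 / nu₁ m + q 0 ^ 2 / nu₂ m) + μ₂ ^ 2 * (q 3 ^ 2 / nu₁ m + q 1 ^ 2 / nu₂ m)

/-- Twice the derivative of the potential with respect to `s₁`, at `q`. -/
def force₁ (m : Fin 3 → ℝ) (q : Fin 4 → ℝ) : ℝ :=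
  m 1 * m 2 * invCube (inv₁ q) + tidal₁ m (inv₁ q) (inv₂ q) (inv₃ q)

/-- Twice the derivative of the potential with respect to `s₂`, at `q`. -/
def force₂ (m : Fin 3 → ℝ) (q : Fin 4 → ℝ) : ℝ := tidal₂ m (inv₁ q) (inv₂ q) (inv₃ q)

/-- The derivative of the potential with respect to `s₃`, at `q`. -/
def force₃ (m : Fin 3 → ℝ) (q : Fin 4 → ℝ) : ℝ := tidal₃ m (inv₁ q) (inv₂ q) (inv₃ q)

/-- The gradient of the reduced Hamiltonian at `(q, 0)`. -/
def effGrad (m : Fin 3 → ℝ) (μ₁ μ₂ : ℝ) (q : Fin 4 → ℝ) : Fin 4 → ℝ :=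
  ![μ₁ ^ 2 * q 0 / (nu₂ m * jac q ^ 2) - kinNum m μ₁ μ₂ q * q 3 / jac q ^ 3 +
      force₁ m q * q 0 + force₃ m q * q 2,
    μ₂ ^ 2 * q 1 / (nu₂ m * jac q ^ 2) + kinNum m μ₁ μ₂ q * q 2 / jac q ^ 3 +
      force₁ m q * q 1 + force₃ m q * q 3,
    μ₁ ^ 2 * q 2 / (nu₁ m * jac q ^ 2) + kinNum m μ₁ μ₂ q * q 1 / jac q ^ 3 +
      force₂ m q * q 2 + force₃ m q * q 0,
    μ₂ ^ 2 * q 3 / (nu₁ m * jac q ^ 2) - kinNum m μ₁ μ₂ q * q 0 / jac q ^ 3 +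
      force₂ m q * q 3 + force₃ m q * q 1]

lemma hasDerivAt_const_div_sqrt (c : ℝ) {x : ℝ} (hx : 0 < x) :
    HasDerivAt (fun y => c / √y) (-(1 / 2) * (c * invCube x)) x := by
  have h := ((Real.hasDerivAt_sqrt hx.ne').inv (by positivity : √x ≠ 0)).const_mul c
  have : 0 < √x := by positivity
  refine (h.congr_deriv ?_).congr_of_eventuallyEq (Eventually.of_forall fun y => ?_)
  · unfold invCube; field_simp
  · simp [div_eq_mul_inv]

/-- Both roots are functions of l², which has zero differential where l = 0; the strict inequality
μ₂ < μ₁ keeps the radicands positive. Hence at p = 0 the dependence on `L₃` contributes nothing to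
the gradient of H. -/
lemma hasFDerivAt_Ls_Ld {μ₁ μ₂ : ℝ} (h2 : 0 < μ₂) (h12 : μ₂ < μ₁) {E : Type*}
    [NormedAddCommGroup E] [NormedSpace ℝ E] {l : E → ℝ} {l' : E →L[ℝ] ℝ} {z : E}
    (hl : HasFDerivAt l l' z) (hz : l z = 0) :
    HasFDerivAt (fun w => (Ld μ₁ μ₂ (l w) + Ls μ₁ μ₂ (l w)) ^ 2) (0 : E →L[ℝ] ℝ) z ∧
    HasFDerivAt (fun w => (Ld μ₁ μ₂ (l w) - Ls μ₁ μ₂ (l w)) ^ 2) (0 : E →L[ℝ] ℝ) z := by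
  have key : ∀ c : ℝ, 0 < c → HasFDerivAt (fun w => √(c ^ 2 - l w ^ 2)) (0 : E →L[ℝ] ℝ) z := by
    intro c hc
    have h1 := ((hasFDerivAt_const (c ^ 2) z).sub (hl.pow 2))
    have := h1.sqrt (by simp [hz, hc.ne'])
    refine this.congr_fderiv ?_
    simp [hz]
  have hd : HasFDerivAt (fun w => Ld μ₁ μ₂ (l w)) (0 : E →L[ℝ] ℝ) z := key _ (by linarith)
  have hs : HasFDerivAt (fun w => Ls μ₁ μ₂ (l w)) (0 : E →L[ℝ] ℝ) z := key _ (by linarith)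
  exact ⟨((hd.add hs).pow 2).congr_fderiv (by simp), ((hd.sub hs).pow 2).congr_fderiv (by simp)⟩

lemma L₃_zero (q : Fin 4 → ℝ) : L₃ q 0 = 0 := by simp [L₃]

lemma Ld_zero {μ₁ μ₂ : ℝ} (h12 : μ₂ < μ₁) : Ld μ₁ μ₂ 0 = μ₁ - μ₂ := by
  simp [Ld, Real.sqrt_sq (sub_pos.2 h12).le]

lemma Ls_zero {μ₁ μ₂ : ℝ} (h2 : 0 < μ₂) (h12 : μ₂ < μ₁) : Ls μ₁ μ₂ 0 = μ₁ + μ₂ := by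
  simp [Ls, Real.sqrt_sq (by linarith : 0 ≤ μ₁ + μ₂)]

theorem hasFDerivAt_reducedHamiltonian {m : Fin 3 → ℝ} (hm : ∀ i, 0 < m i) {μ₁ μ₂ : ℝ}
    (h2 : 0 < μ₂) (h12 : μ₂ < μ₁) {q : Fin 4 → ℝ} (hq : jac q ≠ 0) :
    HasFDerivAt (reducedHamiltonian m μ₁ μ₂)
      (∑ i, effGrad m μ₁ μ₂ q i • ((ContinuousLinearMap.proj i : (Fin 4 → ℝ) →L[ℝ] ℝ).comp
        (ContinuousLinearMap.fst ℝ (Fin 4 → ℝ) (Fin 4 → ℝ)))) (q, 0) := by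
  set z : (Fin 4 → ℝ) × (Fin 4 → ℝ) := (q, 0) with hz
  have hQ : ∀ i, HasFDerivAt (fun z : (Fin 4 → ℝ) × (Fin 4 → ℝ) => z.1 i)
      ((ContinuousLinearMap.proj i : (Fin 4 → ℝ) →L[ℝ] ℝ).comp
        (ContinuousLinearMap.fst ℝ (Fin 4 → ℝ) (Fin 4 → ℝ))) z := fun i =>
    ((ContinuousLinearMap.proj i : (Fin 4 → ℝ) →L[ℝ] ℝ).comp
        (ContinuousLinearMap.fst ℝ (Fin 4 → ℝ) (Fin 4 → ℝ))).hasFDerivAt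
  have hP : ∀ i, HasFDerivAt (fun z : (Fin 4 → ℝ) × (Fin 4 → ℝ) => z.2 i)
      ((ContinuousLinearMap.proj i : (Fin 4 → ℝ) →L[ℝ] ℝ).comp
        (ContinuousLinearMap.snd ℝ (Fin 4 → ℝ) (Fin 4 → ℝ))) z := fun i =>
    ((ContinuousLinearMap.proj i : (Fin 4 → ℝ) →L[ℝ] ℝ).comp
        (ContinuousLinearMap.snd ℝ (Fin 4 → ℝ) (Fin 4 → ℝ))).hasFDerivAt
  have hP2 : ∀ i, HasFDerivAt (fun z : (Fin 4 → ℝ) × (Fin 4 → ℝ) => z.2 i ^ 2)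
      (0 : (Fin 4 → ℝ) × (Fin 4 → ℝ) →L[ℝ] ℝ) z := fun i =>
    ((hP i).pow 2).congr_fderiv (by simp [hz])
  have hL := ((((hQ 0).mul (hP 1)).sub ((hQ 1).mul (hP 0))).add ((hQ 2).mul (hP 3))).sub
    ((hQ 3).mul (hP 2))
  obtain ⟨hΦ, hΨ⟩ := hasFDerivAt_Ls_Ld (l := fun w : (Fin 4 → ℝ) × (Fin 4 → ℝ) => L₃ w.1 w.2)
    h2 h12 hL (by simp [hz, L₃])
  have hA : HasFDerivAt (fun w : (Fin 4 → ℝ) × (Fin 4 → ℝ) => area w.1) _ z :=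
    ((((hQ 0).mul (hQ 3)).sub ((hQ 1).mul (hQ 2))).mul_const (2 : ℝ)⁻¹)
  have hne : area q ≠ 0 := by unfold area; exact div_ne_zero hq two_ne_zero
  have hi : HasDerivAt (fun x : ℝ => 1 / (16 * x ^ 2)) (-(1 / 8) / (area q) ^ 3) (area q) := by
    have := (((hasDerivAt_pow 2 (area q)).const_mul 16).inv (by positivity))
    refine (this.congr_deriv ?_).congr_of_eventuallyEq (Eventually.of_forall fun y => by simp)
    push_cast
    field_simp
    norm_num
  have hI := HasDerivAt.comp_hasFDerivAt (h₂ := fun x : ℝ => 1 / (16 * x ^ 2)) z hi hA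
  have hs1 : HasFDerivAt (fun w : (Fin 4 → ℝ) × (Fin 4 → ℝ) => w.1 0 ^ 2 + w.1 1 ^ 2) _ z :=
    ((hQ 0).pow 2).add ((hQ 1).pow 2)
  have hs2 : HasFDerivAt (fun w : (Fin 4 → ℝ) × (Fin 4 → ℝ) => w.1 2 ^ 2 + w.1 3 ^ 2) _ z :=
    ((hQ 2).pow 2).add ((hQ 3).pow 2)
  have hs3 : HasFDerivAt (fun w : (Fin 4 → ℝ) × (Fin 4 → ℝ) => w.1 0 * w.1 2 + w.1 1 * w.1 3) _ z :=
    ((hQ 0).mul (hQ 2)).add ((hQ 1).mul (hQ 3))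
  have hV1 := HasDerivAt.comp_hasFDerivAt (h₂ := fun y : ℝ => m 1 * m 2 / √y) z
    (hasDerivAt_const_div_sqrt (m 1 * m 2) (x := inv₁ q) (inv₁_pos hq)) hs1
  have hV2 := HasDerivAt.comp_hasFDerivAt (h₂ := fun y : ℝ => m 0 * m 2 / √y) z
    (hasDerivAt_const_div_sqrt (m 0 * m 2) (x := distSq₂ m (inv₁ q) (inv₂ q) (inv₃ q))
      (distSq₂_pos m hq))
    (((hs1.const_mul ((m 1 / (m 1 + m 2)) ^ 2)).add
      (hs3.const_mul (2 * (m 1 / (m 1 + m 2))))).add hs2)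
  have hV3 := HasDerivAt.comp_hasFDerivAt (h₂ := fun y : ℝ => m 0 * m 1 / √y) z
    (hasDerivAt_const_div_sqrt (m 0 * m 1) (x := distSq₃ m (inv₁ q) (inv₂ q) (inv₃ q))
      (distSq₃_pos m hq))
    (((hs1.const_mul ((m 2 / (m 1 + m 2)) ^ 2)).sub
      (hs3.const_mul (2 * (m 2 / (m 1 + m 2))))).add hs2)
  have hV := ((hV1.add hV2).add hV3).neg
  have hT1 := ((((hP2 0).add (hP2 1)).add (hI.mul ((hΦ.mul ((hQ 2).pow 2)).add
    (hΨ.mul ((hQ 3).pow 2))))).const_mul (1 / (2 * nu₁ m)))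
  have hT2 := ((((hP2 2).add (hP2 3)).add (hI.mul ((hΦ.mul ((hQ 0).pow 2)).add
    (hΨ.mul ((hQ 1).pow 2))))).const_mul (1 / (2 * nu₂ m)))
  have hH := (hT1.add hT2).add hV
  refine HasFDerivAt.congr_fderiv (f := reducedHamiltonian m μ₁ μ₂) hH ?_
  have n1 := nu₁_pos hm
  have n2 := nu₂_pos hm
  have p1 := hm 1
  have p2 := hm 2
  refine ContinuousLinearMap.ext fun w => ?_
  have hD : area q = jac q / 2 := rfl
  simp only [hz, Fin.sum_univ_four, add_apply, smul_apply,
    sub_apply, neg_apply, ContinuousLinearMap.comp_apply,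
    ContinuousLinearMap.coe_fst', ContinuousLinearMap.proj_apply, smul_eq_mul, L₃_zero,
    Ld_zero h12, Ls_zero h2 h12, zero_apply, hD, nsmul_eq_mul,
    Function.comp_apply, Pi.mul_apply, Pi.add_apply, Nat.cast_ofNat]
  change _ = effGrad m μ₁ μ₂ q 0 * w.1 0 + effGrad m μ₁ μ₂ q 1 * w.1 1 +
    effGrad m μ₁ μ₂ q 2 * w.1 2 + effGrad m μ₁ μ₂ q 3 * w.1 3
  generalize w.1 0 = w0
  generalize w.1 1 = w1
  generalize w.1 2 = w2
  generalize w.1 3 = w3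
  simp only [effGrad, force₁, force₂, force₃, tidal₁, tidal₂, tidal₃, kinNum, Matrix.cons_val]
  generalize invCube (inv₁ q) = i1
  generalize invCube (distSq₂ m (inv₁ q) (inv₂ q) (inv₃ q)) = i2
  generalize invCube (distSq₃ m (inv₁ q) (inv₂ q) (inv₃ q)) = i3
  generalize jac q = D at *
  generalize nu₁ m = N1 at *
  generalize nu₂ m = N2 at *
  field_simp
  ring

lemma hasFDerivAt_zero_iff {m : Fin 3 → ℝ} (hm : ∀ i, 0 < m i) {μ₁ μ₂ : ℝ}
    (h2 : 0 < μ₂) (h12 : μ₂ < μ₁) {q : Fin 4 → ℝ} (hq : jac q ≠ 0) :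
    HasFDerivAt (reducedHamiltonian m μ₁ μ₂) (0 : (Fin 4 → ℝ) × (Fin 4 → ℝ) →L[ℝ] ℝ) (q, 0) ↔
      effGrad m μ₁ μ₂ q = 0 := by
  have h := hasFDerivAt_reducedHamiltonian hm h2 h12 hq
  constructor
  · intro h0
    have e := h.unique h0
    ext i
    have := congrArg (fun L => L (Pi.single i 1, 0)) e
    simpa [Pi.single_apply, sum_apply] using this
  · intro h0
    refine h.congr_fderiv ?_
    simp [h0]

/-! ### Existence of the family of critical points -/

/-! ### Homogeneity under dilations -/

lemma invCube_mul_sq {L x : ℝ} (hL : 0 < L) : invCube (L ^ 2 * x) = (L ^ 3)⁻¹ * invCube x := by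
  unfold invCube
  rw [Real.sqrt_mul (by positivity), Real.sqrt_sq hL.le, mul_pow, one_div, one_div, mul_inv]

lemma jac_smul (L : ℝ) (Q : Fin 4 → ℝ) : jac (fun i => L * Q i) = L ^ 2 * jac Q := by
  unfold jac; ring

lemma inv_smul (L : ℝ) (Q : Fin 4 → ℝ) : inv₁ (fun i => L * Q i) = L ^ 2 * inv₁ Q ∧
    inv₂ (fun i => L * Q i) = L ^ 2 * inv₂ Q ∧ inv₃ (fun i => L * Q i) = L ^ 2 * inv₃ Q := by
  refine ⟨?_, ?_, ?_⟩
  · unfold inv₁; ring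
  · unfold inv₂; ring
  · unfold inv₃; ring

lemma tidal_smul (m : Fin 3 → ℝ) {L : ℝ} (hL : 0 < L) (s₁ s₂ s₃ : ℝ) :
    tidal₁ m (L ^ 2 * s₁) (L ^ 2 * s₂) (L ^ 2 * s₃) = (L ^ 3)⁻¹ * tidal₁ m s₁ s₂ s₃ ∧
    tidal₂ m (L ^ 2 * s₁) (L ^ 2 * s₂) (L ^ 2 * s₃) = (L ^ 3)⁻¹ * tidal₂ m s₁ s₂ s₃ ∧
    tidal₃ m (L ^ 2 * s₁) (L ^ 2 * s₂) (L ^ 2 * s₃) = (L ^ 3)⁻¹ * tidal₃ m s₁ s₂ s₃ := by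
  have e2 : distSq₂ m (L ^ 2 * s₁) (L ^ 2 * s₂) (L ^ 2 * s₃) = L ^ 2 * distSq₂ m s₁ s₂ s₃ := by
    unfold distSq₂; ring
  have e3 : distSq₃ m (L ^ 2 * s₁) (L ^ 2 * s₂) (L ^ 2 * s₃) = L ^ 2 * distSq₃ m s₁ s₂ s₃ := by
    unfold distSq₃; ring
  refine ⟨?_, ?_, ?_⟩
  · unfold tidal₁; rw [e2, e3, invCube_mul_sq hL, invCube_mul_sq hL]; ring
  · unfold tidal₂; rw [e2, e3, invCube_mul_sq hL, invCube_mul_sq hL]; ring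
  · unfold tidal₃; rw [e2, e3, invCube_mul_sq hL, invCube_mul_sq hL]; ring

lemma force_smul (m : Fin 3 → ℝ) {L : ℝ} (hL : 0 < L) (Q : Fin 4 → ℝ) :
    force₁ m (fun i => L * Q i) = (L ^ 3)⁻¹ * force₁ m Q ∧
    force₂ m (fun i => L * Q i) = (L ^ 3)⁻¹ * force₂ m Q ∧
    force₃ m (fun i => L * Q i) = (L ^ 3)⁻¹ * force₃ m Q := by
  obtain ⟨i1, i2, i3⟩ := inv_smul L Q
  obtain ⟨t1, t2, t3⟩ := tidal_smul m hL (inv₁ Q) (inv₂ Q) (inv₃ Q)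
  refine ⟨?_, ?_, ?_⟩
  · unfold force₁; rw [i1, i2, i3, t1, invCube_mul_sq hL]; ring
  · unfold force₂; rw [i1, i2, i3, t2]
  · unfold force₃; rw [i1, i2, i3, t3]

/-! ### The constants of the rescaling -/

/-- The constant `c` with `μ = c u`. -/
def uScale (m : Fin 3 → ℝ) : ℝ := m 1 * m 2 * √(kappa m / (m 1 + m 2))

lemma kappa_pos {m : Fin 3 → ℝ} (hm : ∀ i, 0 < m i) : 0 < kappa m := by
  have := hm 0; have := hm 1; have := hm 2
  unfold kappa; positivity

lemma massRatio_pos {m : Fin 3 → ℝ} (hm : ∀ i, 0 < m i) : 0 < massRatio m := div_pos (nu₁_pos hm) (nu₂_pos hm)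

lemma uScale_pos {m : Fin 3 → ℝ} (hm : ∀ i, 0 < m i) : 0 < uScale m := by
  have := hm 1; have := hm 2; have := kappa_pos hm
  unfold uScale; positivity

lemma uScale_sq {m : Fin 3 → ℝ} (hm : ∀ i, 0 < m i) : uScale m ^ 2 = (m 1 * m 2) ^ 2 * kappa m / (m 1 + m 2) := by
  have := hm 1; have := hm 2; have := kappa_pos hm
  rw [uScale, mul_pow, Real.sq_sqrt (by positivity)]
  ring

lemma uParam_mul {m : Fin 3 → ℝ} (hm : ∀ i, 0 < m i) (u : ℝ) : uParam m (uScale m * u) = u := by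
  have : uScale m ≠ 0 := (uScale_pos hm).ne'
  change uScale m * u / uScale m = u
  field_simp

lemma uScale_mul_uParam {m : Fin 3 → ℝ} (hm : ∀ i, 0 < m i) (μ : ℝ) : uScale m * uParam m μ = μ := by
  have : uScale m ≠ 0 := (uScale_pos hm).ne'
  change uScale m * (μ / uScale m) = μ
  field_simp

lemma nu₂_eq_kappa {m : Fin 3 → ℝ} (hm : ∀ i, 0 < m i) : nu₂ m = 1 / (kappa m * (m 0 * (m 1 + m 2))) := by
  have := hm 0; have := hm 1; have := hm 2
  unfold kappa nu₂; field_simp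

lemma nu₁_eq_kappa {m : Fin 3 → ℝ} (hm : ∀ i, 0 < m i) : nu₁ m = massRatio m / (kappa m * (m 0 * (m 1 + m 2))) := by
  rw [massRatio, nu₂_eq_kappa hm]
  have := hm 0; have := hm 1; have := hm 2; have := kappa_pos hm
  field_simp

/-- This is the reason for the normalisation of u: it gives the centrifugal term and the attraction
of the pair the same coefficient m 1 * m 2, so the equation of the pair at v = 0 contains no masses.
-/
lemma uScale_sq_eq {m : Fin 3 → ℝ} (hm : ∀ i, 0 < m i) : uScale m ^ 2 = m 1 * m 2 * massRatio m / (m 0 * (m 1 + m 2)) := by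
  rw [uScale_sq hm, massRatio]
  have := hm 0; have := hm 1; have := hm 2
  unfold kappa nu₁ nu₂
  field_simp

/-- The rescaled gradient of the reduced Hamiltonian. -/
theorem effGrad_scaled {m : Fin 3 → ℝ} (hm : ∀ i, 0 < m i) {μ₁ v : ℝ} (hμ₁ : 0 < μ₁) {μ : ℝ}
    (hv : μ ^ 2 = uScale m ^ 2 * v) {Q : Fin 4 → ℝ} (hQ : jac Q ≠ 0) :
    effGrad m μ₁ (μ * μ₁) (fun i => kappa m * μ₁ ^ 2 * Q i) = fun i =>
      ((kappa m * μ₁ ^ 2) ^ 2)⁻¹ *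
      (let k := m 0 * (m 1 + m 2)
       let l := massRatio m
       let n := m 1 * m 2
       let N := k * (Q 2 ^ 2 / l + Q 0 ^ 2) + n * v * (Q 3 ^ 2 + l * Q 1 ^ 2)
       ![k * Q 0 / jac Q ^ 2 - N * Q 3 / jac Q ^ 3 + force₁ m Q * Q 0 + force₃ m Q * Q 2,
         n * v * l * Q 1 / jac Q ^ 2 + N * Q 2 / jac Q ^ 3 + force₁ m Q * Q 1 + force₃ m Q * Q 3,
         k * Q 2 / (l * jac Q ^ 2) + N * Q 1 / jac Q ^ 3 + force₂ m Q * Q 2 + force₃ m Q * Q 0,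
         n * v * Q 3 / jac Q ^ 2 - N * Q 0 / jac Q ^ 3 + force₂ m Q * Q 3 + force₃ m Q * Q 1] i) := by
  have p0 := hm 0
  have p1 := hm 1
  have p2 := hm 2
  have pk := kappa_pos hm
  have pl := massRatio_pos hm
  have hL : 0 < kappa m * μ₁ ^ 2 := by positivity
  have hμ2 : (μ * μ₁) ^ 2 = m 1 * m 2 * massRatio m / (m 0 * (m 1 + m 2)) * v * μ₁ ^ 2 := by
    rw [mul_pow, hv, uScale_sq_eq hm]
  obtain ⟨f1, f2, f3⟩ := force_smul m hL Q
  funext i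
  fin_cases i <;>
  · simp only [effGrad, kinNum, hμ2, jac_smul, f1, f2, f3, nu₁_eq_kappa hm, nu₂_eq_kappa hm,
      Fin.zero_eta, Fin.mk_one, Fin.reduceFinMk, Matrix.cons_val]
    generalize jac Q = D at *
    generalize force₁ m Q = F₁
    generalize force₂ m Q = F₂
    generalize force₃ m Q = F₃
    generalize massRatio m = l at *
    generalize kappa m = κ at *
    generalize m 0 = a at *
    generalize m 1 = b at *
    generalize m 2 = c at *
    have hS : b + c ≠ 0 := by positivity
    field_simp

/-- This is the derivative of the effective potential along a simultaneous rotation of the two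
Jacobi vectors. The determinant and the inner products are invariant, so only `kinNum` contributes.
At a critical point the combination q₃q₄/ν₁ + q₁q₂/ν₂ must therefore vanish, and conversely this
relation makes one component of the gradient redundant. -/
lemma effGrad_rotation {m : Fin 3 → ℝ} (hm : ∀ i, 0 < m i) (μ₁ μ₂ : ℝ) {q : Fin 4 → ℝ}
    (hq : jac q ≠ 0) :
    q 0 * effGrad m μ₁ μ₂ q 1 - q 1 * effGrad m μ₁ μ₂ q 0 + q 2 * effGrad m μ₁ μ₂ q 3 -
      q 3 * effGrad m μ₁ μ₂ q 2 =
    -((μ₁ ^ 2 - μ₂ ^ 2) * (q 2 * q 3 / nu₁ m + q 0 * q 1 / nu₂ m) / jac q ^ 2) := by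
  have n1 := nu₁_pos hm
  have n2 := nu₂_pos hm
  have p1 := hm 1
  have p2 := hm 2
  simp only [effGrad, kinNum, Matrix.cons_val]
  generalize force₁ m q = F₁
  generalize force₂ m q = F₂
  generalize force₃ m q = F₃
  field_simp
  ring

/-- The point of the reduced configuration space with the rescaled coordinates `(v, ξ, η, Y)`. -/
def rescPoint (m : Fin 3 → ℝ) (x : ℝ × ℝ × ℝ × ℝ) : Fin 4 → ℝ :=
  ![x.1 * x.2.1, x.1 * x.2.2.1, -(massRatio m * (x.1 * x.2.1) * (x.1 * x.2.2.1) / x.2.2.2),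
    x.2.2.2]

lemma jac_rescPoint {m : Fin 3 → ℝ} (hm : ∀ i, 0 < m i) {v ξ η Y : ℝ} (hv : 0 < v) (hξ : 0 < ξ)
    (hY : 0 < Y) : 0 < jac (rescPoint m (v, ξ, η, Y)) := by
  have pl := massRatio_pos hm
  have : jac (rescPoint m (v, ξ, η, Y)) =
      v * ξ * (Y ^ 2 + massRatio m * v ^ 2 * η ^ 2) / Y := by
    simp only [jac, rescPoint, Matrix.cons_val]
    field_simp
    ring
  rw [this]; positivity

/-- `rescPoint` satisfies q₃q₄/ν₁ + q₁q₂/ν₂ = 0 identically by its choice of q₃. So three components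
of the gradient come from the three rescaled equations, and the remaining one from
`effGrad_rotation` after division by q₄ ≠ 0. -/
theorem effGrad_eq_zero {m : Fin 3 → ℝ} (hm : ∀ i, 0 < m i) {μ₁ μ v ξ η Y : ℝ} (hμ₁ : 0 < μ₁)
    (hμ : μ ^ 2 = uScale m ^ 2 * v) (hv : 0 < v) (hξ : 0 < ξ) (hY : 0 < Y)
    (h₁ : eqn₁ m (v, ξ, η, Y) = 0) (h₂ : eqn₂ m (v, ξ, η, Y) = 0) (h₃ : eqn₃ m (v, ξ, η, Y) = 0) :
    effGrad m μ₁ (μ * μ₁) (fun i => kappa m * μ₁ ^ 2 * rescPoint m (v, ξ, η, Y) i) = 0 := by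
  have p0 := hm 0
  have p1 := hm 1
  have p2 := hm 2
  have pk := kappa_pos hm
  have pl := massRatio_pos hm
  have hL : 0 < kappa m * μ₁ ^ 2 := by positivity
  have hj := jac_rescPoint hm (η := η) hv hξ hY
  have hs := effGrad_scaled hm hμ₁ hμ hj.ne'
  have i1 : inv₁ (rescPoint m (v, ξ, η, Y)) = resc₁ (v, ξ, η, Y) := by
    simp only [inv₁, rescPoint, resc₁, Matrix.cons_val]; ring
  have i2 : inv₂ (rescPoint m (v, ξ, η, Y)) = resc₂ m (v, ξ, η, Y) := by
    simp only [inv₂, rescPoint, resc₂, Matrix.cons_val]; ring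
  have i3 : inv₃ (rescPoint m (v, ξ, η, Y)) = resc₃ m (v, ξ, η, Y) := by
    simp only [inv₃, rescPoint, resc₃, Matrix.cons_val]; ring
  have ic : invCube (resc₁ (v, ξ, η, Y)) = (v ^ 3)⁻¹ * invCube (ξ ^ 2 + η ^ 2) :=
    invCube_mul_sq hv
  have f1 : force₁ m (rescPoint m (v, ξ, η, Y)) =
      m 1 * m 2 * ((v ^ 3)⁻¹ * invCube (ξ ^ 2 + η ^ 2)) +
        tidal₁ m (resc₁ (v, ξ, η, Y)) (resc₂ m (v, ξ, η, Y)) (resc₃ m (v, ξ, η, Y)) := by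
    rw [force₁, i1, i2, i3, ic]
  have f2 : force₂ m (rescPoint m (v, ξ, η, Y)) =
      tidal₂ m (resc₁ (v, ξ, η, Y)) (resc₂ m (v, ξ, η, Y)) (resc₃ m (v, ξ, η, Y)) := by
    rw [force₂, i1, i2, i3]
  have f3 : force₃ m (rescPoint m (v, ξ, η, Y)) =
      tidal₃ m (resc₁ (v, ξ, η, Y)) (resc₂ m (v, ξ, η, Y)) (resc₃ m (v, ξ, η, Y)) := by
    rw [force₃, i1, i2, i3]
  have hja : jac (rescPoint m (v, ξ, η, Y)) =
      v * ξ * (Y ^ 2 + massRatio m * v ^ 2 * η ^ 2) / Y := by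
    simp only [jac, rescPoint, Matrix.cons_val]
    field_simp
    ring
  have hP : 0 < Y ^ 2 + massRatio m * v ^ 2 * η ^ 2 := by positivity
  simp only [eqn₁, eqn₂, eqn₃, areaFactor] at h₁ h₂ h₃
  have g0 : effGrad m μ₁ (μ * μ₁) (fun i => kappa m * μ₁ ^ 2 * rescPoint m (v, ξ, η, Y) i) 0 = 0 := by
    rw [hs]
    refine mul_eq_zero_of_right _ ?_
    simp only [f1, f3, hja]
    simp only [rescPoint, Matrix.cons_val]
    generalize tidal₁ m _ _ _ = t₁ at *
    generalize tidal₃ m _ _ _ = t₃ at *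
    generalize invCube (ξ ^ 2 + η ^ 2) = ι at *
    generalize massRatio m = l at *
    -- The factor undoes the normalisation that made the equation regular and free of masses at v =
    -- 0; similarly for the other two components.
    rw [← mul_eq_zero_of_right (m 1 * m 2 * ξ / v ^ 2) h₁]
    have hS : m 1 + m 2 ≠ 0 := by positivity
    field_simp
    ring
  have g1 : effGrad m μ₁ (μ * μ₁) (fun i => kappa m * μ₁ ^ 2 * rescPoint m (v, ξ, η, Y) i) 1 = 0 := by
    rw [hs]
    refine mul_eq_zero_of_right _ ?_
    simp only [f1, f3, hja]
    simp only [rescPoint, Matrix.cons_val]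
    generalize tidal₁ m _ _ _ = t₁ at *
    generalize tidal₃ m _ _ _ = t₃ at *
    generalize invCube (ξ ^ 2 + η ^ 2) = ι at *
    generalize massRatio m = l at *
    rw [← mul_eq_zero_of_right (m 1 * m 2 / v ^ 2) h₂]
    have hS : m 1 + m 2 ≠ 0 := by positivity
    field_simp
    ring
  have g3 : effGrad m μ₁ (μ * μ₁) (fun i => kappa m * μ₁ ^ 2 * rescPoint m (v, ξ, η, Y) i) 3 = 0 := by
    rw [hs]
    refine mul_eq_zero_of_right _ ?_
    simp only [f2, f3, hja]
    simp only [rescPoint, Matrix.cons_val]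
    generalize tidal₂ m _ _ _ = t₂ at *
    generalize tidal₃ m _ _ _ = t₃ at *
    generalize massRatio m = l at *
    rw [← mul_eq_zero_of_right Y h₃]
    have hS : m 1 + m 2 ≠ 0 := by positivity
    field_simp
    ring
  have hjs : jac (fun i => kappa m * μ₁ ^ 2 * rescPoint m (v, ξ, η, Y) i) ≠ 0 := by
    rw [jac_smul]; positivity
  have g2 : effGrad m μ₁ (μ * μ₁) (fun i => kappa m * μ₁ ^ 2 * rescPoint m (v, ξ, η, Y) i) 2 = 0 := by
    have r := effGrad_rotation hm μ₁ (μ * μ₁) hjs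
    rw [g0, g1, g3] at r
    have z : (kappa m * μ₁ ^ 2 * rescPoint m (v, ξ, η, Y) 2) *
        (kappa m * μ₁ ^ 2 * rescPoint m (v, ξ, η, Y) 3) / nu₁ m +
        (kappa m * μ₁ ^ 2 * rescPoint m (v, ξ, η, Y) 0) *
        (kappa m * μ₁ ^ 2 * rescPoint m (v, ξ, η, Y) 1) / nu₂ m = 0 := by
      have n1 := nu₁_pos hm
      have n2 := nu₂_pos hm
      simp only [rescPoint, massRatio, Matrix.cons_val]
      field_simp
      ring
    rw [z] at r
    have h3 : kappa m * μ₁ ^ 2 * rescPoint m (v, ξ, η, Y) 3 ≠ 0 := by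
      simp only [rescPoint, Matrix.cons_val]; positivity
    simp only [mul_zero, sub_zero, add_zero, zero_sub, zero_div, neg_zero, neg_eq_zero] at r
    exact (mul_eq_zero.1 r).resolve_left h3
  funext i
  fin_cases i
  exacts [g0, g1, g2, g3]

lemma AgreesTo.comp_sq {k : ℕ} {f g : ℝ → ℝ} (h : AgreesTo k f g) :
    (fun u : ℝ => f (u ^ 2) - g (u ^ 2)) =O[𝓝 0] fun u => u ^ (2 * k) := by
  have ht : Tendsto (fun u : ℝ => u ^ 2) (𝓝 0) (𝓝 0) := by
    have : ContinuousAt (fun u : ℝ => u ^ 2) 0 := by fun_prop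
    simpa [ContinuousAt] using this
  simpa [Function.comp_def, _root_.pow_mul] using h.isBigO.comp_tendsto ht

lemma tendsto_uParam {m : Fin 3 → ℝ} (hm : ∀ i, 0 < m i) :
    Tendsto (uParam m) (𝓝[>] 0) (𝓝[>] 0) := by
  have c := uScale_pos hm
  refine tendsto_nhdsWithin_iff.2 ⟨?_, ?_⟩
  · have : ContinuousAt (uParam m) 0 := by
      unfold uParam
      fun_prop (disch := exact c.ne')
    have h := this.tendsto.mono_left (nhdsWithin_le_nhds (s := Set.Ioi 0))
    simpa [uParam] using h
  · filter_upwards [self_mem_nhdsWithin] with μ hμ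
    exact div_pos hμ c

lemma massRatio_eq {m : Fin 3 → ℝ} (hm : ∀ i, 0 < m i) :
    massRatio m = m 1 * m 2 * (m 0 + m 1 + m 2) / (m 0 * (m 1 + m 2) ^ 2) := by
  have := hm 0
  have := hm 1
  have := hm 2
  unfold massRatio nu₁ nu₂
  field_simp

theorem exists_isCriticalFamily {m : Fin 3 → ℝ} (hm : ∀ i, 0 < m i) :
    ∃ Q : Fin 4 → ℝ → ℝ, IsCriticalFamily m Q := by
  have p0 := hm 0
  have p1 := hm 1
  have p2 := hm 2
  obtain ⟨ψ, hψ, ψ0, hev⟩ := exists_analytic_solution hm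
  set ξ : ℝ → ℝ := fun v => (ψ v).1 with hξ
  set η : ℝ → ℝ := fun v => (ψ v).2.1 with hη
  set Y : ℝ → ℝ := fun v => (ψ v).2.2 with hY
  have aξ : AnalyticAt ℝ ξ 0 := analyticAt_fst.comp hψ
  have aη : AnalyticAt ℝ η 0 := analyticAt_fst.comp (analyticAt_snd.comp hψ)
  have aY : AnalyticAt ℝ Y 0 := analyticAt_snd.comp (analyticAt_snd.comp hψ)
  have ξ0 : ξ 0 = 1 := by simp [hξ, ψ0]
  have η0 : η 0 = 0 := by simp [hη, ψ0]
  have Y0 : Y 0 = 1 := by simp [hY, ψ0]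
  obtain ⟨Eξ, Eη, EY⟩ := solution_expansions hm aξ.differentiableAt aη.differentiableAt
    aY.differentiableAt ξ0 η0 Y0 (hev.mono fun v h => h.1) (hev.mono fun v h => h.2.1)
    (hev.mono fun v h => h.2.2)
  have a2 : AnalyticAt ℝ (fun u : ℝ => u ^ 2) 0 := by fun_prop
  have bξ : AnalyticAt ℝ (fun u => ξ (u ^ 2)) 0 := AnalyticAt.fun_comp (by simpa using aξ) a2
  have bη : AnalyticAt ℝ (fun u => η (u ^ 2)) 0 := AnalyticAt.fun_comp (by simpa using aη) a2
  have bY : AnalyticAt ℝ (fun u => Y (u ^ 2)) 0 := AnalyticAt.fun_comp (by simpa using aY) a2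
  have Yne : Y ((0 : ℝ) ^ 2) ≠ 0 := by simp [Y0]
  refine ⟨fun i u => rescPoint m (u ^ 2, ψ (u ^ 2)) i, ?_, ?_, ?_, ?_, ?_, ?_⟩
  · have c0 : AnalyticAt ℝ (fun u => u ^ 2 * ξ (u ^ 2)) 0 := a2.mul bξ
    have c1 : AnalyticAt ℝ (fun u => u ^ 2 * η (u ^ 2)) 0 := a2.mul bη
    have c2 : AnalyticAt ℝ (fun u => -(massRatio m * (u ^ 2 * ξ (u ^ 2)) *
      (u ^ 2 * η (u ^ 2)) / Y (u ^ 2))) 0 := (((analyticAt_const.mul c0).mul c1).div bY Yne).neg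
    intro i
    fin_cases i
    exacts [c0, c1, c2, bY]
  · refine ((isBigO_refl (fun u : ℝ => u ^ 2) (𝓝 0)).mul Eξ.comp_sq).congr (fun u => ?_)
      fun u => by ring
    change _ = u ^ 2 * ξ (u ^ 2) - _
    ring
  · refine ((isBigO_refl (fun u : ℝ => u ^ 2) (𝓝 0)).mul Eη.comp_sq).congr (fun u => ?_)
      fun u => by ring
    change _ = u ^ 2 * η (u ^ 2) - _
    field_simp
  · set A := 3 / 2 * (m 0 * (m 1 - m 2) / (m 1 + m 2) ^ 2) with hA
    set B := (5 * m 1 ^ 2 + 24 * m 2 * m 1 + 5 * m 2 ^ 2) / (4 * (m 1 + m 2) ^ 2) with hB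
    set y := 3 / 2 * (m 1 * m 2 / (m 1 + m 2) ^ 2) with hy
    have η4 : AgreesTo 4 η fun _ => 0 := by
      refine (Eη.mono (show 4 ≤ 7 by norm_num)).trans ?_
      exact AgreesTo.of_eq (r := fun v => A * (1 - B * v ^ 2)) (by fun_prop) (by fun_prop)
        fun v => by ring
    have ξ3 : AgreesTo 3 (fun v => ξ v - 1) fun _ => 0 := by
      have e : AgreesTo 3 (fun v : ℝ => 1 - m 0 / (m 1 + m 2) * v ^ 3) fun _ => 1 :=
        AgreesTo.of_eq (r := fun v => -(m 0 / (m 1 + m 2))) (by fun_prop) (by fun_prop)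
          fun v => by ring
      exact (((Eξ.mono (show 3 ≤ 5 by norm_num)).trans e).sub (AgreesTo.const 1)).cast
        (fun v => rfl) fun v => by ring
    have Yi : AgreesTo 4 (fun v => (Y v)⁻¹ - (1 - y * v ^ 2)) fun _ => 0 := by
      have c : ContinuousAt (fun v : ℝ => (1 + y * v ^ 2)⁻¹) 0 := by fun_prop (disch := simp)
      have e : AgreesTo 4 (fun v : ℝ => 1 - y * v ^ 2) fun v => (1 + y * v ^ 2)⁻¹ := by
        refine AgreesTo.of_eq (r := fun v => -y ^ 2 * (1 + y * v ^ 2)⁻¹) c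
          (by fun_prop) fun v => ?_
        have : 1 + y * v ^ 2 ≠ 0 := by simp only [hy]; positivity
        field_simp
        ring
      exact (((EY.inv (by simp [Y0]) (by simp [Y0])).trans e.symm).sub
        (AgreesTo.refl e.left)).cast (fun v => rfl) fun v => by ring
    have cYi : ContinuousAt (fun v => (Y v)⁻¹) 0 := aY.continuousAt.inv₀ (by simp [Y0])
    -- In -λ v² ξ η / Y, replacing ξ by 1 costs order 4 + 3, replacing 1/Y by 1 - y v² costs order 4
    -- + 4, and replacing η by its expansion costs order 7. The factor v² raises the minimum 7 to 9,
    -- which is u¹⁸.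
    have e1 := (η4.mul_zero_order ξ3).zero_mul cYi
    have e2 := (η4.mul_zero_order Yi).mono (show 7 ≤ 4 + 4 by norm_num)
    have cp : ContinuousAt (fun v : ℝ => 1 - y * v ^ 2) 0 := by fun_prop
    have e3 := Eη.mul (AgreesTo.refl cp)
    have e4 := (((e1.add e2).add e3).const_mul (-massRatio m)).pow_mul 2
    have cc : ContinuousAt (fun v => v ^ 2 * (-massRatio m * (A * v ^ 4 * (1 - (B + y) * v ^ 2)))) 0 := by
      fun_prop
    have e5 : AgreesTo 9 (fun v => -(massRatio m * (v * ξ v) * (v * η v) / Y v))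
        fun v => v ^ 2 * (-massRatio m * (A * v ^ 4 * (1 - (B + y) * v ^ 2))) := by
      refine (e4.cast (fun v => by ring) fun v => rfl).trans ?_
      refine AgreesTo.of_eq (r := fun v => v * (-massRatio m * (A * B * y))) cc (by fun_prop)
        fun v => by ring
    refine e5.comp_sq.congr_left fun u => ?_
    refine congrArg₂ _ rfl ?_
    rw [massRatio_eq hm]
    simp only [hA, hB, hy]
    field_simp
    ring
  · refine EY.comp_sq.congr_left fun u => ?_
    change Y (u ^ 2) - _ = Y (u ^ 2) - _
    field_simp
  · have ht : Tendsto (fun u : ℝ => u ^ 2) (𝓝[>] 0) (𝓝 0) := by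
      have : ContinuousAt (fun u : ℝ => u ^ 2) 0 := by fun_prop
      simpa [ContinuousAt] using this.tendsto.mono_left (nhdsWithin_le_nhds (s := Set.Ioi 0))
    have hv := ht.comp (tendsto_uParam hm)
    filter_upwards [hv.eventually hev,
      hv.eventually (aξ.continuousAt.eventually (lt_mem_nhds (by rw [ξ0]; exact one_pos))),
      hv.eventually (aY.continuousAt.eventually (lt_mem_nhds (by rw [Y0]; exact one_pos))),
      (tendsto_uParam hm).eventually self_mem_nhdsWithin, self_mem_nhdsWithin,
      nhdsWithin_le_nhds (Iio_mem_nhds (zero_lt_one' ℝ))] with μ h hξp hYp hup hμp hμ1 μ₁ hμ₁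
    have hμ₂ : 0 < μ * μ₁ := mul_pos hμp hμ₁
    have hμ12 : μ * μ₁ < μ₁ := by
      have : μ < 1 := hμ1
      nlinarith
    have hu : (0 : ℝ) < uParam m μ ^ 2 := pow_pos hup 2
    have hL : 0 < kappa m * μ₁ ^ 2 := by have := kappa_pos hm; positivity
    have hj := jac_rescPoint hm (η := η (uParam m μ ^ 2)) hu hξp hYp
    have hj' : jac (fun i => kappa m * μ₁ ^ 2 * rescPoint m (uParam m μ ^ 2, ψ (uParam m μ ^ 2)) i)
        ≠ 0 := by
      rw [jac_smul]; exact (mul_pos (pow_pos hL 2) hj).ne'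
    refine (hasFDerivAt_zero_iff hm hμ₂ hμ12 hj').2 ?_
    refine effGrad_eq_zero hm hμ₁ ?_ hu hξp hYp h.1 h.2.1 h.2.2
    rw [← mul_pow, uScale_mul_uParam hm]

/-! ### A criterion for strict local minima with two scales -/

/-- Values of the Hessian quadratic form thus reduce to calculus in one variable, along the line p +
t v. -/
lemma fderiv_fderiv_apply_of_line {E : Type*} [NormedAddCommGroup E] [NormedSpace ℝ E] {f : E → ℝ}
    {p v : E} (hf : ContDiffAt ℝ 2 f p) {φ' : ℝ → ℝ} {d : ℝ}
    (h₁ : ∀ᶠ t in 𝓝 (0 : ℝ), HasDerivAt (fun t => f (p + t • v)) (φ' t) t)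
    (h₂ : HasDerivAt φ' d 0) : fderiv ℝ (fderiv ℝ f) p v v = d := by
  have hd : DifferentiableAt ℝ (fderiv ℝ f) p :=
    (hf.fderiv_right (m := 1) (by norm_num)).differentiableAt (by norm_num)
  have hl : ∀ t : ℝ, HasDerivAt (fun t : ℝ => p + t • v) v t := fun t => by
    simpa using ((hasDerivAt_id t).smul_const v).const_add p
  have hc : ContinuousAt (fun t : ℝ => p + t • v) 0 := (hl 0).continuousAt
  have hev : ∀ᶠ x in 𝓝 p, DifferentiableAt ℝ f x := by
    filter_upwards [hf.eventually (by simp)] with x hx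
    exact hx.differentiableAt (by norm_num)
  have hev' : ∀ᶠ t in 𝓝 (0 : ℝ), DifferentiableAt ℝ f (p + t • v) :=
    hc.eventually (by simpa using hev)
  have e : φ' =ᶠ[𝓝 0] fun t => fderiv ℝ f (p + t • v) v := by
    filter_upwards [h₁, hev'] with t ht hdt
    exact ht.unique (hdt.hasFDerivAt.comp_hasDerivAt t (hl t))
  have h3 : HasDerivAt (fun t : ℝ => fderiv ℝ f (p + t • v)) (fderiv ℝ (fderiv ℝ f) p v) 0 := by
    have hd' : HasFDerivAt (fderiv ℝ f) (fderiv ℝ (fderiv ℝ f) p) (p + (0 : ℝ) • v) := by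
      simpa using hd.hasFDerivAt
    exact hd'.comp_hasDerivAt 0 (hl 0)
  have h4 : HasDerivAt (fun t : ℝ => fderiv ℝ f (p + t • v) v) (fderiv ℝ (fderiv ℝ f) p v v) 0 := by
    simpa using h3.clm_apply (hasDerivAt_const 0 v)
  exact h4.unique (h₂.congr_of_eventuallyEq e.symm)

/-- The derivative of a C² function is strictly differentiable. Strictness matters: the increments
are taken between two arbitrary nearby points, since the critical point to be tested is not the
limit point p itself. -/
lemma exists_ball_fderiv_approx {E : Type*} [NormedAddCommGroup E] [NormedSpace ℝ E] {f : E → ℝ}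
    {p : E} (hf : ContDiffAt ℝ 2 f p) {ε : ℝ} (hε : 0 < ε) :
    ∃ δ > 0, (∀ x ∈ Metric.ball p δ, DifferentiableAt ℝ f x) ∧
      ∀ x ∈ Metric.ball p δ, ∀ y ∈ Metric.ball p δ,
        ‖fderiv ℝ f x - fderiv ℝ f y - fderiv ℝ (fderiv ℝ f) p (x - y)‖ ≤ ε * ‖x - y‖ := by
  have hs : HasStrictFDerivAt (fderiv ℝ f) (fderiv ℝ (fderiv ℝ f) p) p :=
    (hf.fderiv_right (m := 1) (by norm_num)).hasStrictFDerivAt (by norm_num)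
  have h1 := hs.isLittleO.def hε
  have h2 : ∀ᶠ x in 𝓝 p, DifferentiableAt ℝ f x := by
    filter_upwards [hf.eventually (by simp)] with x hx
    exact hx.differentiableAt (by norm_num)
  obtain ⟨δ₁, hδ₁, hb₁⟩ := Metric.eventually_nhds_iff_ball.1 h1
  obtain ⟨δ₂, hδ₂, hb₂⟩ := Metric.eventually_nhds_iff_ball.1 h2
  refine ⟨min δ₁ δ₂, lt_min hδ₁ hδ₂, fun x hx => hb₂ x (Metric.ball_subset_ball (min_le_right _ _) hx),
    fun x hx y hy => ?_⟩
  refine hb₁ (x, y) ?_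
  have hx' := Metric.ball_subset_ball (min_le_left δ₁ δ₂) hx
  have hy' := Metric.ball_subset_ball (min_le_left δ₁ δ₂) hy
  rw [Metric.mem_ball, Prod.dist_eq]
  exact max_lt hx' hy'

/-- A and B stand for the increments of the derivatives of F and G along a segment, with x and |b|
the sizes of its inner and outer parts. Since n / u² ≥ n, the convexity of F absorbs the error of G
in the inner direction, and the term k b² absorbs it in the outer one. -/
lemma two_scale_pos {A B c k n u t ε x b f N : ℝ} (hn : 0 < n) (hc : 0 < c) (ht : 0 < t)
    (hu0 : 0 < u) (hu1 : u < 1) (hx : 0 ≤ x) (ε1 : ε ≤ c / 2) (ε2 : ε ≤ k / 2)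
    (ε3 : ε ≤ n * c / 4) (ε0 : 0 < ε) (hf : c * x ^ 2 ≤ f) (hN : N ^ 2 ≤ x ^ 2 + b ^ 2)
    (hA : -(ε * (t * x) * x) ≤ A - t * f) (hB : -(ε * (t * N) * N) ≤ B - t * (k * b ^ 2))
    (hab : x ≠ 0 ∨ b ≠ 0) : 0 < n / u ^ 2 * A + B := by
  have hA1 : t * (c / 2 * x ^ 2) ≤ A := by
    have h1 : t * (c * x ^ 2) ≤ t * f := mul_le_mul_of_nonneg_left hf ht.le
    have h2 : ε * (t * x ^ 2) ≤ c / 2 * (t * x ^ 2) := mul_le_mul_of_nonneg_right ε1 (by positivity)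
    linarith
  have hB1 : t * (k * b ^ 2) - t * (ε * (x ^ 2 + b ^ 2)) ≤ B := by
    have : t * (ε * N ^ 2) ≤ t * (ε * (x ^ 2 + b ^ 2)) := by gcongr
    linarith
  have hn1 : n * (t * (c / 2 * x ^ 2)) ≤ n / u ^ 2 * A := by
    have h6 : n ≤ n / u ^ 2 := by
      rw [le_div_iff₀ (by positivity)]
      have : u ^ 2 ≤ 1 := pow_le_one₀ hu0.le hu1.le
      nlinarith
    have h7 : 0 ≤ t * (c / 2 * x ^ 2) := by positivity
    calc n * (t * (c / 2 * x ^ 2)) ≤ n / u ^ 2 * (t * (c / 2 * x ^ 2)) :=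
          mul_le_mul_of_nonneg_right h6 h7
      _ ≤ _ := mul_le_mul_of_nonneg_left hA1 (by positivity)
  have h8 : t * (ε * x ^ 2) ≤ t * (n * c / 4 * x ^ 2) := by gcongr
  have h9 : t * (ε * b ^ 2) ≤ t * (k / 2 * b ^ 2) := by gcongr
  have hk : 0 < k := by linarith
  have h10 : 0 < t * (n * c / 4 * x ^ 2) + t * (k / 2 * b ^ 2) := by
    rcases hab with h | h
    · have : 0 < x := hx.lt_of_ne' h
      positivity
    · positivity
  linarith

/-- A critical point of `n / u² * F(x, u) + G(x, y, u)` near `(x₀, y₀)` is, for small `u > 0`, a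
strict local minimum, if `F` has positive second derivative at `(x₀, 0)` and `G` has a positive
second derivative with respect to `y` and no other second derivatives at `u = 0`. -/
theorem exists_nhds_strict_min {X : Type*} [NormedAddCommGroup X] [NormedSpace ℝ X]
    {F : X × ℝ → ℝ} {G : (X × ℝ) × ℝ → ℝ} {x₀ : X} {y₀ : ℝ}
    (hF : ContDiffAt ℝ 2 F (x₀, 0)) (hG : ContDiffAt ℝ 2 G ((x₀, y₀), 0)) {c k n : ℝ}
    (hc : 0 < c) (hk : 0 < k) (hn : 0 < n)
    (F2 : ∀ a : X, c * ‖a‖ ^ 2 ≤ fderiv ℝ (fderiv ℝ F) (x₀, 0) (a, 0) (a, 0))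
    (G2 : ∀ (a : X) (b : ℝ),
      fderiv ℝ (fderiv ℝ G) ((x₀, y₀), 0) ((a, b), 0) ((a, b), 0) = k * b ^ 2) :
    ∃ δ > 0, ∀ u ∈ Set.Ioo 0 δ, ∀ w ∈ Metric.ball (x₀, y₀) δ,
      HasFDerivAt (fun w : X × ℝ => n / u ^ 2 * F (w.1, u) + G (w, u)) (0 : X × ℝ →L[ℝ] ℝ) w →
      ∀ w' ∈ Metric.ball (x₀, y₀) δ, w' ≠ w →
        n / u ^ 2 * F (w.1, u) + G (w, u) < n / u ^ 2 * F (w'.1, u) + G (w', u) := by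
  -- The three bounds keep half of the convexity of F, half of that of G in the outer direction, and
  -- let a part of the convexity of F pay for the inner error of G.
  set ε := min (c / 2) (min (k / 2) (n * c / 4)) with hε
  have ε1 : ε ≤ c / 2 := min_le_left _ _
  have ε2 : ε ≤ k / 2 := (min_le_right _ _).trans (min_le_left _ _)
  have ε3 : ε ≤ n * c / 4 := (min_le_right _ _).trans (min_le_right _ _)
  have ε0 : 0 < ε := by positivity
  obtain ⟨δ₁, hδ₁, dF, sF⟩ := exists_ball_fderiv_approx hF ε0
  obtain ⟨δ₂, hδ₂, dG, sG⟩ := exists_ball_fderiv_approx hG ε0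
  refine ⟨min (min δ₁ δ₂) 1, by positivity, fun u hu w hw hcrit w' hw' hne => ?_⟩
  set δ := min (min δ₁ δ₂) 1 with hδ
  have δ1 : δ ≤ δ₁ := (min_le_left _ _).trans (min_le_left _ _)
  have δ2 : δ ≤ δ₂ := (min_le_left _ _).trans (min_le_right _ _)
  have hu1 : u < 1 := hu.2.trans_le (min_le_right _ _)
  have hu0 : 0 < u := hu.1
  set a := w'.1 - w.1 with ha
  set b := w'.2 - w.2 with hb
  have hw't : ∀ t ∈ Set.Icc (0 : ℝ) 1, w + t • (w' - w) ∈ Metric.ball (x₀, y₀) δ := fun t ht =>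
    (convex_ball (x₀, y₀) δ).add_smul_sub_mem hw hw' ht
  have uin : |u| < δ := by rw [abs_of_pos hu0]; exact hu.2
  have mG : ∀ z ∈ Metric.ball (x₀, y₀) δ, (z, u) ∈ Metric.ball ((x₀, y₀), (0 : ℝ)) δ₂ := by
    intro z hz
    rw [Metric.mem_ball, Prod.dist_eq]
    refine max_lt (lt_of_lt_of_le hz δ2) ?_
    simpa using lt_of_lt_of_le uin δ2
  have mF : ∀ z ∈ Metric.ball (x₀, y₀) δ, (z.1, u) ∈ Metric.ball (x₀, (0 : ℝ)) δ₁ := by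
    intro z hz
    rw [Metric.mem_ball, Prod.dist_eq]
    refine max_lt (lt_of_le_of_lt ?_ (lt_of_lt_of_le hz δ1)) ?_
    · rw [Prod.dist_eq]; exact le_max_left _ _
    · simpa using lt_of_lt_of_le uin δ1
  set φ' : ℝ → ℝ := fun t => n / u ^ 2 * fderiv ℝ F ((w + t • (w' - w)).1, u) (a, 0) +
    fderiv ℝ G (w + t • (w' - w), u) ((a, b), 0) with hφ'
  have hl : ∀ t : ℝ, HasDerivAt (fun t : ℝ => w + t • (w' - w)) (a, b) t := fun t =>
    (((hasDerivAt_id t).smul_const (w' - w)).const_add w).congr_deriv (by simp [ha, hb, Prod.ext_iff])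
  have hφ : ∀ t ∈ Set.Icc (0 : ℝ) 1, HasDerivAt (fun t : ℝ => n / u ^ 2 *
      F ((w + t • (w' - w)).1, u) + G (w + t • (w' - w), u)) (φ' t) t := by
    intro t ht
    have h1 : HasDerivAt (fun t : ℝ => ((w + t • (w' - w)).1, u)) (a, (0 : ℝ)) t :=
      (hl t).fst.prodMk (hasDerivAt_const t u)
    have h2 : HasDerivAt (fun t : ℝ => (w + t • (w' - w), u)) ((a, b), (0 : ℝ)) t :=
      (hl t).prodMk (hasDerivAt_const t u)
    have f1 := (dF _ (mF _ (hw't t ht))).hasFDerivAt.comp_hasDerivAt t h1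
    have f2 := (dG _ (mG _ (hw't t ht))).hasFDerivAt.comp_hasDerivAt t h2
    exact (f1.const_mul _).add f2
  have hφ0 : φ' 0 = 0 := by
    have h1 : HasFDerivAt (fun w : X × ℝ => n / u ^ 2 * F (w.1, u) + G (w, u))
        (0 : X × ℝ →L[ℝ] ℝ) (w + (0 : ℝ) • (w' - w)) := by simpa using hcrit
    have h2 := h1.comp_hasDerivAt 0 (hl 0)
    exact (hφ 0 (by simp)).unique h2
  have hab : a ≠ 0 ∨ b ≠ 0 := by
    by_contra! h
    apply hne
    exact Prod.ext (sub_eq_zero.1 h.1) (sub_eq_zero.1 h.2)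
  -- As φ' vanishes at 0, φ' t is the sum of the increments of the two derivatives between w and w +
  -- t • (w' - w), and these are controlled by the Hessians at the limit point.
  have hpos : ∀ t ∈ Set.Ioo (0 : ℝ) 1, 0 < φ' t := by
    intro t ht
    have ht' : t ∈ Set.Icc (0 : ℝ) 1 := Set.Ioo_subset_Icc_self ht
    have e1 : ((w + t • (w' - w)).1, u) - (w.1, u) = t • ((a, 0) : X × ℝ) := by simp [ha]
    have e2 : (w + t • (w' - w), u) - (w, u) = t • (((a, b), 0) : (X × ℝ) × ℝ) := by
      simp [ha, hb, Prod.ext_iff]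
    have s1 := sF _ (mF _ (hw't t ht')) _ (mF _ hw)
    have s2 := sG _ (mG _ (hw't t ht')) _ (mG _ hw)
    rw [e1] at s1
    rw [e2] at s2
    have n1 : ‖((a, 0) : X × ℝ)‖ = ‖a‖ := by simp [Prod.norm_def]
    have n2 : ‖(((a, b), 0) : (X × ℝ) × ℝ)‖ ^ 2 ≤ ‖a‖ ^ 2 + b ^ 2 := by
      have : ‖(((a, b), 0) : (X × ℝ) × ℝ)‖ = max ‖a‖ |b| := by simp [Prod.norm_def]
      rw [this]
      rcases max_choice ‖a‖ |b| with h | h <;> rw [h]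
      · nlinarith [sq_nonneg b]
      · rw [sq_abs]; nlinarith [sq_nonneg ‖a‖]
    have r1 := (ContinuousLinearMap.le_opNorm _ ((a, 0) : X × ℝ)).trans
      (mul_le_mul_of_nonneg_right s1 (norm_nonneg ((a, 0) : X × ℝ)))
    have r2 := (ContinuousLinearMap.le_opNorm _ (((a, b), 0) : (X × ℝ) × ℝ)).trans
      (mul_le_mul_of_nonneg_right s2 (norm_nonneg (((a, b), 0) : (X × ℝ) × ℝ)))
    simp only [sub_apply, map_smul, smul_apply, norm_smul, Real.norm_eq_abs, abs_of_pos ht.1,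
      smul_eq_mul] at r1 r2
    have r1' := (abs_le.1 r1).1
    have r2' := (abs_le.1 r2).1
    have key : φ' t = n / u ^ 2 * (fderiv ℝ F ((w + t • (w' - w)).1, u) (a, 0) -
        fderiv ℝ F (w.1, u) (a, 0)) + (fderiv ℝ G (w + t • (w' - w), u) ((a, b), 0) -
        fderiv ℝ G (w, u) ((a, b), 0)) := by
      have : φ' 0 = n / u ^ 2 * fderiv ℝ F (w.1, u) (a, 0) + fderiv ℝ G (w, u) ((a, b), 0) := by
        simp [hφ']
      rw [hφ0] at this
      simp only [hφ']
      linear_combination -this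
    rw [G2 a b] at r2'
    rw [n1] at r1'
    rw [key]
    exact two_scale_pos hn hc ht.1 hu0 hu1 (norm_nonneg a) ε1 ε2 ε3 ε0 (F2 a) n2 r1' r2'
      (hab.imp norm_ne_zero_iff.2 id)
  have hmono : StrictMonoOn (fun t : ℝ => n / u ^ 2 *
      F ((w + t • (w' - w)).1, u) + G (w + t • (w' - w), u)) (Set.Icc 0 1) := by
    refine strictMonoOn_of_deriv_pos (convex_Icc 0 1)
      (fun t ht => (hφ t ht).continuousAt.continuousWithinAt) fun t ht => ?_
    rw [interior_Icc] at ht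
    rw [(hφ t (Set.Ioo_subset_Icc_self ht)).deriv]
    exact hpos t ht
  simpa using hmono (by simp) (by simp) (zero_lt_one' ℝ)

/-! ### The effective potential near the family -/

/-- The rescaled effective potential of the close pair. -/
def pairPotential (c : ℝ) (x : (ℝ × ℝ × ℝ) × ℝ) : ℝ :=
  (1 + x.1.2.2 ^ 2) / (2 * (x.1.1 - c * x.2 * x.1.2.1 * x.1.2.2) ^ 2) -
    1 / √(x.1.1 ^ 2 + x.1.2.1 ^ 2)

/-- The remaining part of the rescaled effective potential. -/
def outerPotential (m : Fin 3 → ℝ) (x : ((ℝ × ℝ × ℝ) × ℝ) × ℝ) : ℝ :=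
  (m 0 * (m 1 + m 2) * x.1.1.1 ^ 2 + m 1 * m 2 * massRatio m * x.2 ^ 2 * x.1.1.2.1 ^ 2) /
      (2 * x.1.2 ^ 2 * (x.1.1.1 - uScale m * x.2 * x.1.1.2.1 * x.1.1.2.2) ^ 2) -
    m 0 * m 2 / √(distSq₂ m (x.2 ^ 4 * (x.1.1.1 ^ 2 + x.1.1.2.1 ^ 2))
      (x.1.2 ^ 2 * (1 + uScale m ^ 2 * x.2 ^ 2 * x.1.1.2.2 ^ 2))
      (x.2 ^ 2 * x.1.2 * (uScale m * x.2 * x.1.1.1 * x.1.1.2.2 + x.1.1.2.1))) -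
    m 0 * m 1 / √(distSq₃ m (x.2 ^ 4 * (x.1.1.1 ^ 2 + x.1.1.2.1 ^ 2))
      (x.1.2 ^ 2 * (1 + uScale m ^ 2 * x.2 ^ 2 * x.1.1.2.2 ^ 2))
      (x.2 ^ 2 * x.1.2 * (uScale m * x.2 * x.1.1.1 * x.1.1.2.2 + x.1.1.2.1)))

/-- The configuration with the rescaled coordinates `w`. -/
def scaledPoint (c L u : ℝ) (w : (ℝ × ℝ × ℝ) × ℝ) : Fin 4 → ℝ :=
  ![L * (u ^ 2 * w.1.1), L * (u ^ 2 * w.1.2.1), L * (c * u * w.1.2.2 * w.2), L * w.2]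

/-- The rescaled coordinates of a configuration. -/
def scaledCoord (c L u : ℝ) (q : Fin 4 → ℝ) : (ℝ × ℝ × ℝ) × ℝ :=
  ((q 0 / (L * u ^ 2), q 1 / (L * u ^ 2), q 2 / (c * u * q 3)), q 3 / L)

lemma scaledPoint_scaledCoord {c L u : ℝ} (hc : c ≠ 0) (hL : L ≠ 0) (hu : u ≠ 0) {q : Fin 4 → ℝ}
    (hq : q 3 ≠ 0) : scaledPoint c L u (scaledCoord c L u q) = q := by
  funext i
  fin_cases i <;> simp [scaledPoint, scaledCoord] <;> field_simp

lemma scaledCoord_scaledPoint {c L u : ℝ} (hc : c ≠ 0) (hL : L ≠ 0) (hu : u ≠ 0)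
    {w : (ℝ × ℝ × ℝ) × ℝ} (hw : w.2 ≠ 0) : scaledCoord c L u (scaledPoint c L u w) = w := by
  simp only [scaledPoint, scaledCoord, Matrix.cons_val, Prod.ext_iff]
  refine ⟨⟨?_, ?_, ?_⟩, ?_⟩ <;> field_simp

lemma continuousAt_scaledCoord {c L u : ℝ} (hc : c ≠ 0) (hu : u ≠ 0) {q : Fin 4 → ℝ}
    (hq : q 3 ≠ 0) : ContinuousAt (scaledCoord c L u) q := by
  unfold scaledCoord
  have h2 : c * u * q 3 ≠ 0 := by positivity
  have hp : ∀ i : Fin 4, ContinuousAt (fun q : Fin 4 → ℝ => q i) q := fun i =>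
    (continuous_apply i).continuousAt
  exact (((hp 0).div_const _).prodMk (((hp 1).div_const _).prodMk
    ((hp 2).div ((hp 3).const_mul _) h2))).prodMk ((hp 3).div_const _)

lemma potential_smul (m : Fin 3 → ℝ) {L : ℝ} (hL : 0 < L) (s₁ s₂ s₃ : ℝ) :
    potential m (L ^ 2 * s₁) (L ^ 2 * s₂) (L ^ 2 * s₃) = L⁻¹ * potential m s₁ s₂ s₃ := by
  have h : ∀ x, √(L ^ 2 * x) = L * √x := fun x => by
    rw [Real.sqrt_mul (by positivity), Real.sqrt_sq hL.le]
  have e : ∀ a b : ℝ, a / (L * b) = L⁻¹ * (a / b) := fun a b => by rw [div_mul_eq_div_div_swap]; ring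
  simp only [potential]
  rw [show ∀ a : ℝ, a ^ 2 * (L ^ 2 * s₁) + 2 * a * (L ^ 2 * s₃) + L ^ 2 * s₂ =
      L ^ 2 * (a ^ 2 * s₁ + 2 * a * s₃ + s₂) from fun a => by ring,
    show ∀ a : ℝ, a ^ 2 * (L ^ 2 * s₁) - 2 * a * (L ^ 2 * s₃) + L ^ 2 * s₂ =
      L ^ 2 * (a ^ 2 * s₁ - 2 * a * s₃ + s₂) from fun a => by ring, h, h, h, e, e, e]
  ring

lemma reducedHamiltonian_zero (m : Fin 3 → ℝ) {μ₁ μ₂ : ℝ} (h2 : 0 < μ₂) (h12 : μ₂ < μ₁)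
    (q : Fin 4 → ℝ) : reducedHamiltonian m μ₁ μ₂ (q, 0) =
      kinNum m μ₁ μ₂ q / (2 * jac q ^ 2) + potential m (inv₁ q) (inv₂ q) (inv₃ q) := by
  have hD : area q = jac q / 2 := rfl
  simp only [reducedHamiltonian, fRed, L₃_zero, Ld_zero h12, Ls_zero h2 h12, hD, Pi.zero_apply,
    kinNum, inv₁, inv₂, inv₃]
  congr 1
  by_cases h : jac q = 0
  · simp [h]
  · ring

/-- Lengths scale with L, energies with 1/L. The third rescaled variable is chosen such that μ₁ q₃ =
μ₂ q₄ times it, which makes the two leading centrifugal terms comparable. The size u² of the pair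
then gives its energy the factor u⁻², and everything else is regular at u = 0. The bound on u says
μ₂ < μ₁. -/
lemma scaled_reducedHamiltonian {m : Fin 3 → ℝ} (hm : ∀ i, 0 < m i) {μ₁ u : ℝ} (hμ₁ : 0 < μ₁)
    (hu : 0 < u) (hu1 : uScale m * u < 1) {w : (ℝ × ℝ × ℝ) × ℝ} (hY : w.2 ≠ 0)
    (hD : w.1.1 - uScale m * u * w.1.2.1 * w.1.2.2 ≠ 0) :
    kappa m * μ₁ ^ 2 * reducedHamiltonian m μ₁ (uScale m * u * μ₁)
        (scaledPoint (uScale m) (kappa m * μ₁ ^ 2) u w, 0) =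
      m 1 * m 2 / u ^ 2 * pairPotential (uScale m) (w.1, u) + outerPotential m (w, u) := by
  have p0 := hm 0
  have p1 := hm 1
  have p2 := hm 2
  have pk := kappa_pos hm
  have pl := massRatio_pos hm
  have pc := uScale_pos hm
  set L := kappa m * μ₁ ^ 2 with hLdef
  have hL : 0 < L := by positivity
  have hμ2 : (uScale m * u * μ₁) ^ 2 = m 1 * m 2 * massRatio m / (m 0 * (m 1 + m 2)) * u ^ 2 *
      μ₁ ^ 2 := by rw [mul_pow, mul_pow, uScale_sq_eq hm]
  have j : jac (scaledPoint (uScale m) L u w) =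
      L ^ 2 * (u ^ 2 * w.2 * (w.1.1 - uScale m * u * w.1.2.1 * w.1.2.2)) := by
    simp only [jac, scaledPoint, Matrix.cons_val]; ring
  have i1 : inv₁ (scaledPoint (uScale m) L u w) =
      L ^ 2 * (u ^ 4 * (w.1.1 ^ 2 + w.1.2.1 ^ 2)) := by
    simp only [inv₁, scaledPoint, Matrix.cons_val]; ring
  have i2 : inv₂ (scaledPoint (uScale m) L u w) =
      L ^ 2 * (w.2 ^ 2 * (1 + uScale m ^ 2 * u ^ 2 * w.1.2.2 ^ 2)) := by
    simp only [inv₂, scaledPoint, Matrix.cons_val]; ring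
  have i3 : inv₃ (scaledPoint (uScale m) L u w) =
      L ^ 2 * (u ^ 2 * w.2 * (uScale m * u * w.1.1 * w.1.2.2 + w.1.2.1)) := by
    simp only [inv₃, scaledPoint, Matrix.cons_val]; ring
  rw [reducedHamiltonian_zero m (by positivity) (by nlinarith), j, i1, i2, i3, potential_smul m hL,
    mul_add, mul_inv_cancel_left₀ hL.ne']
  have hsq : √(u ^ 4 * (w.1.1 ^ 2 + w.1.2.1 ^ 2)) = u ^ 2 * √(w.1.1 ^ 2 + w.1.2.1 ^ 2) := by
    rw [Real.sqrt_mul (by positivity), show u ^ 4 = (u ^ 2) ^ 2 by ring, Real.sqrt_sq (by positivity)]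
  have hkin : L * (kinNum m μ₁ (uScale m * u * μ₁) (scaledPoint (uScale m) L u w) /
      (2 * (L ^ 2 * (u ^ 2 * w.2 * (w.1.1 - uScale m * u * w.1.2.1 * w.1.2.2))) ^ 2)) =
      m 1 * m 2 / u ^ 2 * ((1 + w.1.2.2 ^ 2) /
        (2 * (w.1.1 - uScale m * u * w.1.2.1 * w.1.2.2) ^ 2)) +
      (m 0 * (m 1 + m 2) * w.1.1 ^ 2 + m 1 * m 2 * massRatio m * u ^ 2 * w.1.2.1 ^ 2) /
      (2 * w.2 ^ 2 * (w.1.1 - uScale m * u * w.1.2.1 * w.1.2.2) ^ 2) := by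
    have e : kinNum m μ₁ (uScale m * u * μ₁) (scaledPoint (uScale m) L u w) =
        L ^ 3 * u ^ 2 * (m 1 * m 2 * w.2 ^ 2 * (1 + w.1.2.2 ^ 2) + u ^ 2 * (m 0 * (m 1 + m 2) *
          w.1.1 ^ 2 + m 1 * m 2 * massRatio m * u ^ 2 * w.1.2.1 ^ 2)) := by
      simp only [kinNum, scaledPoint, Matrix.cons_val, hμ2, nu₁_eq_kappa hm, nu₂_eq_kappa hm]
      simp only [mul_pow, uScale_sq_eq hm, hLdef]
      have hS : m 1 + m 2 ≠ 0 := by positivity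
      generalize massRatio m = l at *
      generalize kappa m = κ at *
      field_simp
      ring
    rw [e]
    generalize w.1.1 - uScale m * u * w.1.2.1 * w.1.2.2 = D at *
    field_simp
  rw [hkin]
  simp only [potential, pairPotential, outerPotential, hsq, distSq₂, distSq₃]
  rw [show ∀ a b : ℝ, a / (u ^ 2 * b) = a / u ^ 2 * (1 / b) from fun a b => by
    rw [div_mul_eq_div_div]; ring]
  ring

lemma contDiffAt_pairPotential (c : ℝ) : ContDiffAt ℝ 2 (pairPotential c) ((1, 0, 0), 0) := by
  have h1 : 2 * ((1 : ℝ) - c * 0 * 0 * 0) ^ 2 ≠ 0 := by norm_num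
  have h2 : √((1 : ℝ) ^ 2 + 0 ^ 2) ≠ 0 := by norm_num
  have h3 : (1 : ℝ) ^ 2 + 0 ^ 2 ≠ 0 := by norm_num
  have hs : ContDiffAt ℝ 2 (fun x : (ℝ × ℝ × ℝ) × ℝ => √(x.1.1 ^ 2 + x.1.2.1 ^ 2))
    ((1, 0, 0), 0) := ContDiffAt.sqrt (by fun_prop) h3
  unfold pairPotential
  refine ContDiffAt.sub (ContDiffAt.div ?_ ?_ h1) (ContDiffAt.div ?_ hs h2) <;> fun_prop

lemma contDiffAt_outerPotential (m : Fin 3 → ℝ) :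
    ContDiffAt ℝ 2 (outerPotential m) (((1, 0, 0), 1), 0) := by
  unfold outerPotential
  have e2 : ContDiffAt ℝ 2 (fun x : ((ℝ × ℝ × ℝ) × ℝ) × ℝ =>
      √(distSq₂ m (x.2 ^ 4 * (x.1.1.1 ^ 2 + x.1.1.2.1 ^ 2))
      (x.1.2 ^ 2 * (1 + uScale m ^ 2 * x.2 ^ 2 * x.1.1.2.2 ^ 2))
      (x.2 ^ 2 * x.1.2 * (uScale m * x.2 * x.1.1.1 * x.1.1.2.2 + x.1.1.2.1))))
      (((1, 0, 0), 1), 0) :=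
    ContDiffAt.sqrt (by unfold distSq₂; fun_prop) (by simp [distSq₂])
  have e3 : ContDiffAt ℝ 2 (fun x : ((ℝ × ℝ × ℝ) × ℝ) × ℝ =>
      √(distSq₃ m (x.2 ^ 4 * (x.1.1.1 ^ 2 + x.1.1.2.1 ^ 2))
      (x.1.2 ^ 2 * (1 + uScale m ^ 2 * x.2 ^ 2 * x.1.1.2.2 ^ 2))
      (x.2 ^ 2 * x.1.2 * (uScale m * x.2 * x.1.1.1 * x.1.1.2.2 + x.1.1.2.1))))
      (((1, 0, 0), 1), 0) :=
    ContDiffAt.sqrt (by unfold distSq₃; fun_prop) (by simp [distSq₃])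
  refine ContDiffAt.sub (ContDiffAt.sub (ContDiffAt.div ?_ ?_ ?_)
    (ContDiffAt.div (by fun_prop) e2 ?_)) (ContDiffAt.div (by fun_prop) e3 ?_)
  · fun_prop
  · fun_prop
  · norm_num
  · simp [distSq₂]
  · simp [distSq₃]

/-- For u = 0 the function is (1 + z²)/(2x²) - 1/√(x² + y²). At (1, 0, 0) its pure second
derivatives are 3 - 2, 1 and 1, and its mixed ones vanish. -/
lemma fderiv_fderiv_pairPotential (c : ℝ) (a : ℝ × ℝ × ℝ) :
    fderiv ℝ (fderiv ℝ (pairPotential c)) ((1, 0, 0), 0) (a, 0) (a, 0) =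
      a.1 ^ 2 + a.2.1 ^ 2 + a.2.2 ^ 2 := by
  obtain ⟨x, y, z⟩ := a
  have hP : ∀ t : ℝ, HasDerivAt (fun t : ℝ => 1 + t * x) x t := fun t => by
    simpa using ((hasDerivAt_id t).mul_const x).const_add 1
  have hr : ∀ t : ℝ, HasDerivAt (fun t : ℝ => (1 + t * x) ^ 2 + (t * y) ^ 2)
      (2 * (x * (1 + t * x) + t * y ^ 2)) t := fun t =>
    (((hP t).pow 2).add (((hasDerivAt_id t).mul_const y).pow 2)).congr_deriv (by simp; ring)
  have hz : ∀ t : ℝ, HasDerivAt (fun t : ℝ => 1 + (t * z) ^ 2) (2 * t * z ^ 2) t := fun t =>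
    ((((hasDerivAt_id t).mul_const z).pow 2).const_add 1).congr_deriv (by simp; ring)
  refine fderiv_fderiv_apply_of_line (contDiffAt_pairPotential c)
    (φ' := fun t => t * z ^ 2 / (1 + t * x) ^ 2 - (1 + (t * z) ^ 2) * x / (1 + t * x) ^ 3 +
      (x * (1 + t * x) + t * y ^ 2) * invCube ((1 + t * x) ^ 2 + (t * y) ^ 2)) ?_ ?_
  · have h1 : ∀ᶠ t in 𝓝 (0 : ℝ), 1 + t * x ≠ 0 :=
      (hP 0).continuousAt.eventually_ne (by simp)
    filter_upwards [h1] with t ht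
    have hr0 : 0 < (1 + t * x) ^ 2 + (t * y) ^ 2 := by positivity
    have d1 := (hz t).div (((hP t).pow 2).const_mul 2) (mul_ne_zero two_ne_zero (pow_ne_zero 2 ht))
    have d2 := HasDerivAt.comp t (h₂ := fun y : ℝ => 1 / √y) (hasDerivAt_const_div_sqrt 1 hr0) (hr t)
    refine ((d1.sub d2).congr_deriv ?_).congr_of_eventuallyEq (Eventually.of_forall fun t => ?_)
    · simp only [Pi.pow_apply]
      field_simp
      ring
    · simp [pairPotential]
  · have i1 : HasDerivAt (fun t : ℝ => invCube ((1 + t * x) ^ 2 + (t * y) ^ 2)) (-(3 * x)) 0 := by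
      refine (HasDerivAt.comp (0 : ℝ) (h₂ := invCube) (hasDerivAt_invCube (by norm_num))
        (hr 0)).congr_deriv ?_
      norm_num
      ring
    have i2 : HasDerivAt (fun t : ℝ => x * (1 + t * x) + t * y ^ 2) (x ^ 2 + y ^ 2) 0 :=
      (((hP 0).const_mul x).add ((hasDerivAt_id (0 : ℝ)).mul_const (y ^ 2))).congr_deriv
        (by simp; ring)
    have i3 := ((hasDerivAt_id (0 : ℝ)).mul_const (z ^ 2)).div ((hP 0).pow 2) (by norm_num)
    have i4 := ((hz 0).mul_const x).div ((hP 0).pow 3) (by norm_num)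
    refine ((i3.sub i4).add (i2.mul i1)).congr_deriv ?_
    norm_num [invCube]
    ring

/-- For u = 0 the inner variables cancel and k/(2Y²) - k/Y remains, the radial Kepler potential,
with second derivative 3k - 2k at Y = 1. -/
lemma fderiv_fderiv_outerPotential (m : Fin 3 → ℝ) (a : ℝ × ℝ × ℝ) (b : ℝ) :
    fderiv ℝ (fderiv ℝ (outerPotential m)) (((1, 0, 0), 1), 0) ((a, b), 0) ((a, b), 0) =
      m 0 * (m 1 + m 2) * b ^ 2 := by
  obtain ⟨x, y, z⟩ := a
  have hP : ∀ (x t : ℝ), HasDerivAt (fun t : ℝ => 1 + t * x) x t := fun x t => by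
    simpa using ((hasDerivAt_id t).mul_const x).const_add 1
  set k := m 0 * (m 1 + m 2) with hk
  refine fderiv_fderiv_apply_of_line (contDiffAt_outerPotential m)
    (φ' := fun t => -(k * b) / (1 + t * b) ^ 3 + k * b / (1 + t * b) ^ 2) ?_ ?_
  · have h1 : ∀ x, ∀ᶠ t in 𝓝 (0 : ℝ), 0 < 1 + t * x := fun x =>
      (hP x 0).continuousAt.eventually (lt_mem_nhds (by simp))
    have e : ∀ᶠ t in 𝓝 (0 : ℝ), outerPotential m ((((1, 0, 0), 1), 0) + t • (((x, y, z), b), 0)) =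
        k / (2 * (1 + t * b) ^ 2) - k / (1 + t * b) := by
      filter_upwards [h1 x, h1 b] with t ht hb
      simp only [outerPotential, distSq₂, distSq₃, Prod.smul_mk, Prod.mk_add_mk, smul_eq_mul,
        mul_zero, add_zero, zero_add, zero_mul, zero_pow, ne_eq, OfNat.ofNat_ne_zero,
        not_false_eq_true, sub_zero, mul_one, Real.sqrt_sq hb.le]
      rw [hk]
      field_simp
      ring
    filter_upwards [e.eventually_nhds, h1 b] with t ht hb
    refine HasDerivAt.congr_of_eventuallyEq ?_ ht
    have d1 := (hasDerivAt_const t k).div (((hP b t).pow 2).const_mul 2)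
      (mul_ne_zero two_ne_zero (pow_ne_zero 2 hb.ne'))
    have d2 := (hasDerivAt_const t k).div (hP b t) hb.ne'
    refine (d1.sub d2).congr_deriv ?_
    simp only [Pi.pow_apply]
    field_simp
    ring
  · have i1 := (hasDerivAt_const (0 : ℝ) (-(k * b))).div ((hP b 0).pow 3) (by norm_num)
    have i2 := (hasDerivAt_const (0 : ℝ) (k * b)).div ((hP b 0).pow 2) (by norm_num)
    refine (i1.add i2).congr_deriv ?_
    norm_num
    ring

lemma differentiable_scaledPoint (c L u : ℝ) : Differentiable ℝ (scaledPoint c L u) := by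
  refine differentiable_pi.2 fun i => ?_
  fin_cases i <;> simp [scaledPoint] <;> fun_prop

lemma isLittleO_pow_div {f g : ℝ → ℝ} {a : ℝ} {k l : ℕ} (hkl : l < k)
    (h : (fun u => f u - g u) =O[𝓝 0] fun u : ℝ => u ^ k)
    (hg : Tendsto (fun u => g u / u ^ l) (𝓝[>] 0) (𝓝 a)) :
    Tendsto (fun u => f u / u ^ l) (𝓝[>] 0) (𝓝 a) := by
  have h1 : Tendsto (fun u => (f u - g u) / u ^ l) (𝓝[>] 0) (𝓝 0) := by
    have := (h.trans_isLittleO (Asymptotics.isLittleO_pow_pow hkl)).tendsto_div_nhds_zero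
    exact this.mono_left nhdsWithin_le_nhds
  simpa [← add_div] using h1.add hg

/-- In the rescaled coordinates, a critical family has a limit as `u → 0⁺`. -/
lemma IsCriticalFamily.tendsto_scaled {m : Fin 3 → ℝ} (hm : ∀ i, 0 < m i) {Q : Fin 4 → ℝ → ℝ}
    (hQ : IsCriticalFamily m Q) :
    Tendsto (fun u => (((Q 0 u / u ^ 2, Q 1 u / u ^ 2, Q 2 u / (uScale m * u * Q 3 u)), Q 3 u) :
      (ℝ × ℝ × ℝ) × ℝ)) (𝓝[>] 0) (𝓝 ((1, 0, 0), 1)) := by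
  have pc := uScale_pos hm
  have hlim : ∀ (g : ℝ → ℝ) (l : ℕ) (h : ℝ → ℝ), (∀ u, u ≠ 0 → g u / u ^ l = h u) →
      Continuous h → Tendsto (fun u => g u / u ^ l) (𝓝[>] 0) (𝓝 (h 0)) := fun g l h e hc => by
    refine ((hc.tendsto 0).mono_left nhdsWithin_le_nhds).congr' ?_
    filter_upwards [self_mem_nhdsWithin] with u hu
    exact (e u (ne_of_gt hu)).symm
  have t0 := isLittleO_pow_div (l := 2) (by norm_num) hQ.expansion₁
    (hlim _ 2 (fun u => 1 - m 0 / (m 1 + m 2) * u ^ 6) (fun u hu => by field_simp) (by fun_prop))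
  have t1 := isLittleO_pow_div (l := 2) (by norm_num) hQ.expansion₂
    (hlim _ 2 (fun u => 3 * u ^ 8 * m 0 * (m 1 - m 2) / (2 * (m 1 + m 2) ^ 2) *
        (1 - u ^ 4 * (5 * m 1 ^ 2 + 24 * m 2 * m 1 + 5 * m 2 ^ 2) / (4 * (m 1 + m 2) ^ 2)))
      (fun u hu => by rw [div_eq_iff (by positivity)]; ring) (by fun_prop))
  have t2 := isLittleO_pow_div (l := 1) (by norm_num) hQ.expansion₃
    (hlim _ 1 (fun u => -(3 * u ^ 11 * (m 0 + m 1 + m 2) * m 1 * m 2 * (m 1 - m 2) /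
        (2 * (m 1 + m 2) ^ 4)) *
        (1 - 5 * u ^ 4 * (m 1 ^ 2 + 6 * m 2 * m 1 + m 2 ^ 2) / (4 * (m 1 + m 2) ^ 2)))
      (fun u hu => by rw [div_eq_iff (by positivity)]; ring) (by fun_prop))
  have t3 := isLittleO_pow_div (l := 0) (by norm_num) hQ.expansion₄
    (hlim _ 0 (fun u => 1 + 3 * u ^ 4 * m 1 * m 2 / (2 * (m 1 + m 2) ^ 2))
      (fun u hu => by simp) (by fun_prop))
  norm_num at t0 t1 t2 t3
  have t2' := t2.div (t3.const_mul (uScale m)) (by simpa using pc.ne')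
  refine (t0.prodMk_nhds (t1.prodMk_nhds ?_)).prodMk_nhds t3
  rw [zero_div] at t2'
  refine t2'.congr fun u => ?_
  simp only [Pi.div_apply]
  rw [div_div]
  congr 1
  ring

lemma IsCriticalFamily.familyPoint_eq {m : Fin 3 → ℝ} (hm : ∀ i, 0 < m i) {Q : Fin 4 → ℝ → ℝ}
    {μ₁ u : ℝ} (hu : 0 < u) (h3 : Q 3 u ≠ 0) :
    familyPoint m Q μ₁ (uScale m * u) = (scaledPoint (uScale m) (kappa m * μ₁ ^ 2) u
      ((Q 0 u / u ^ 2, Q 1 u / u ^ 2, Q 2 u / (uScale m * u * Q 3 u)), Q 3 u), 0) := by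
  have pc := uScale_pos hm
  refine Prod.ext ?_ rfl
  funext i
  fin_cases i <;> simp [scaledPoint, familyPoint, uParam_mul hm] <;> field_simp <;> simp

/-- At small `μ`, the point of a critical family is a strict local minimum of the effective
potential. -/
theorem IsCriticalFamily.eventually_strict_min_config {m : Fin 3 → ℝ} (hm : ∀ i, 0 < m i)
    {Q : Fin 4 → ℝ → ℝ} (hQ : IsCriticalFamily m Q) :
    ∀ᶠ μ : ℝ in 𝓝[>] 0, ∀ μ₁ : ℝ, 0 < μ₁ → ∀ᶠ q in 𝓝 (familyPoint m Q μ₁ μ).1,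
      q ≠ (familyPoint m Q μ₁ μ).1 →
      reducedHamiltonian m μ₁ (μ * μ₁) ((familyPoint m Q μ₁ μ).1, 0) <
        reducedHamiltonian m μ₁ (μ * μ₁) (q, 0) := by
  have p0 := hm 0
  have p1 := hm 1
  have p2 := hm 2
  have pk := kappa_pos hm
  have pc := uScale_pos hm
  obtain ⟨δ, hδ, hmin⟩ := exists_nhds_strict_min (contDiffAt_pairPotential (uScale m))
    (contDiffAt_outerPotential m) one_pos (by positivity : 0 < m 0 * (m 1 + m 2))
    (by positivity : 0 < m 1 * m 2)
    (fun a => by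
      rw [fderiv_fderiv_pairPotential, one_mul]
      obtain ⟨x, y, z⟩ := a
      have : ‖(x, y, z)‖ = max |x| (max |y| |z|) := rfl
      rw [this]
      rcases max_choice |x| (max |y| |z|) with h | h <;> rw [h]
      · rw [sq_abs]; nlinarith [sq_nonneg y, sq_nonneg z]
      · rcases max_choice |y| |z| with h | h <;> rw [h, sq_abs] <;>
          nlinarith [sq_nonneg x, sq_nonneg y, sq_nonneg z])
    (fun a b => fderiv_fderiv_outerPotential m a b)
  have hu := tendsto_uParam hm
  have e1 := (hQ.tendsto_scaled hm).comp hu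
  have e2 := e1.eventually (Metric.ball_mem_nhds _ hδ)
  have e3 := hu.eventually (Ioo_mem_nhdsGT (lt_min hδ (by positivity : 0 < 1 / uScale m)))
  have hcont : ContinuousAt (fun x : ((ℝ × ℝ × ℝ) × ℝ) × ℝ =>
      x.1.1.1 - uScale m * x.2 * x.1.1.2.1 * x.1.1.2.2) (((1, 0, 0), 1), 0) := by fun_prop
  have hcont' : ContinuousAt (fun x : ((ℝ × ℝ × ℝ) × ℝ) × ℝ => x.1.2) (((1, 0, 0), 1), 0) := by
    fun_prop
  have e4 := (e1.prodMk_nhds (hu.mono_right nhdsWithin_le_nhds)).eventually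
    ((hcont.eventually (lt_mem_nhds (by norm_num : (0 : ℝ) < 1 - uScale m * 0 * 0 * 0))).and
      (hcont'.eventually (lt_mem_nhds one_pos)))
  filter_upwards [e2, e3, e4, hQ.critical] with μ hball hIoo hDY hcrit μ₁ hμ₁
  set u := uParam m μ with hudef
  have hμ : μ = uScale m * u := (uScale_mul_uParam hm μ).symm
  have hu0 : 0 < u := hIoo.1
  have hu1 : uScale m * u < 1 := by
    have := hIoo.2.trans_le (min_le_right _ _)
    rw [lt_div_iff₀ pc] at this
    linarith
  set w : (ℝ × ℝ × ℝ) × ℝ :=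
    ((Q 0 u / u ^ 2, Q 1 u / u ^ 2, Q 2 u / (uScale m * u * Q 3 u)), Q 3 u) with hw
  have hD : 0 < w.1.1 - uScale m * u * w.1.2.1 * w.1.2.2 := hDY.1
  have hY : 0 < w.2 := hDY.2
  set L := kappa m * μ₁ ^ 2 with hL
  have hL0 : 0 < L := by positivity
  have hfp : familyPoint m Q μ₁ μ = (scaledPoint (uScale m) L u w, 0) := by
    rw [hμ, IsCriticalFamily.familyPoint_eq hm hu0 hY.ne']
  have hev : ∀ᶠ w' in 𝓝 w, w'.2 ≠ 0 ∧ w'.1.1 - uScale m * u * w'.1.2.1 * w'.1.2.2 ≠ 0 :=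
    (ContinuousAt.eventually_ne (by fun_prop) hY.ne').and
      (ContinuousAt.eventually_ne (by fun_prop) hD.ne')
  have heq : ∀ w' : (ℝ × ℝ × ℝ) × ℝ, w'.2 ≠ 0 ∧
      w'.1.1 - uScale m * u * w'.1.2.1 * w'.1.2.2 ≠ 0 →
      m 1 * m 2 / u ^ 2 * pairPotential (uScale m) (w'.1, u) + outerPotential m (w', u) =
      L * reducedHamiltonian m μ₁ (μ * μ₁) (scaledPoint (uScale m) L u w', 0) := fun w' h => by
    rw [hμ]
    exact (scaled_reducedHamiltonian hm hμ₁ hu0 hu1 h.1 h.2).symm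
  -- Criticality is carried over by the chain rule through `scaledPoint`. The formula for the
  -- rescaled Hamiltonian holds only where its denominators do not vanish, hence the eventual
  -- equality.
  have hcritw : HasFDerivAt (fun w => m 1 * m 2 / u ^ 2 * pairPotential (uScale m) (w.1, u) +
      outerPotential m (w, u)) (0 : (ℝ × ℝ × ℝ) × ℝ →L[ℝ] ℝ) w := by
    have h1 := hcrit μ₁ hμ₁
    rw [hfp] at h1
    have h2 := HasFDerivAt.comp w h1
      (((differentiable_scaledPoint (uScale m) L u) w).hasFDerivAt.prodMk
        (hasFDerivAt_const (0 : Fin 4 → ℝ) w))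
    refine ((h2.const_mul L).congr_fderiv (by simp)).congr_of_eventuallyEq ?_
    filter_upwards [hev] with w' hw'
    exact heq w' hw'
  have hcoord : scaledCoord (uScale m) L u (scaledPoint (uScale m) L u w) = w :=
    scaledCoord_scaledPoint pc.ne' hL0.ne' hu0.ne' hY.ne'
  have hq3 : scaledPoint (uScale m) L u w 3 ≠ 0 := by
    simp [scaledPoint, hL0.ne', hY.ne']
  have hcc := continuousAt_scaledCoord (L := L) pc.ne' hu0.ne' hq3
  rw [hfp]
  have n1 : ∀ᶠ q in 𝓝 (scaledPoint (uScale m) L u w),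
      scaledCoord (uScale m) L u q ∈ Metric.ball ((1, 0, 0), 1) δ := by
    refine hcc.eventually ?_
    rw [hcoord]
    exact Metric.isOpen_ball.mem_nhds hball
  have n2 : ∀ᶠ q in 𝓝 (scaledPoint (uScale m) L u w), q 3 ≠ 0 :=
    (continuous_apply (3 : Fin 4)).continuousAt.eventually_ne hq3
  have n3 := (hcc.tendsto.mono_right (by rw [hcoord])).eventually hev
  filter_upwards [n1, n2, n3] with q hq1 hq2 hq3 hne
  have hback := scaledPoint_scaledCoord pc.ne' hL0.ne' hu0.ne' hq2
  have := hmin u ⟨hu0, hIoo.2.trans_le (min_le_left _ _)⟩ w hball hcritw _ hq1 (fun h => hne (by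
    rw [← hback, h]))
  rw [heq _ ⟨hY.ne', hD.ne'⟩, heq _ hq3, hback] at this
  exact lt_of_mul_lt_mul_left this hL0.le

/-! ### Strict minima of the reduced Hamiltonian -/

/-- With G = (Ld - Ls)² - 4μ₂² one has (Ld + Ls)² = 4μ₁² - 4l² - G, so the claim is G (b - a) ≥ 4 l²
a. The bound (μ₁² - μ₂²) G ≥ 4 μ₂² l² and the hypothesis in the form (μ₁² - μ₂²) a ≤ μ₂² (b - a)
give it. -/
lemma four_mul_le_Ld_Ls {μ₁ μ₂ l a b : ℝ} (h2 : 0 < μ₂) (h12 : μ₂ < μ₁)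
    (hl : l ^ 2 ≤ (μ₁ - μ₂) ^ 2) (ha : 0 ≤ a) (hab : μ₁ ^ 2 * a ≤ μ₂ ^ 2 * b) :
    4 * μ₁ ^ 2 * a + 4 * μ₂ ^ 2 * b ≤
      (Ld μ₁ μ₂ l + Ls μ₁ μ₂ l) ^ 2 * a + (Ld μ₁ μ₂ l - Ls μ₁ μ₂ l) ^ 2 * b := by
  set x := Ld μ₁ μ₂ l
  set y := Ls μ₁ μ₂ l
  have hx0 : 0 ≤ x := Real.sqrt_nonneg _
  have hy0 : 0 ≤ y := Real.sqrt_nonneg _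
  have hx : x ^ 2 = (μ₁ - μ₂) ^ 2 - l ^ 2 := Real.sq_sqrt (by linarith)
  have hy : y ^ 2 = (μ₁ + μ₂) ^ 2 - l ^ 2 := Real.sq_sqrt (by nlinarith)
  have h1 : 0 < μ₁ := h2.trans h12
  have hΔ : 0 < μ₁ ^ 2 - μ₂ ^ 2 := by nlinarith
  -- The two sides are compared through their squares, whose difference is (2μ₁μ₂l²)².
  have hP : (μ₁ ^ 2 - μ₂ ^ 2) * (x * y) ≤ (μ₁ ^ 2 - μ₂ ^ 2) ^ 2 - (μ₁ ^ 2 + μ₂ ^ 2) * l ^ 2 := by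
    refine abs_le_of_sq_le_sq' (a := (μ₁ ^ 2 - μ₂ ^ 2) * (x * y)) ?_ ?_ |>.2
    · have e : ((μ₁ ^ 2 - μ₂ ^ 2) ^ 2 - (μ₁ ^ 2 + μ₂ ^ 2) * l ^ 2) ^ 2 -
          ((μ₁ ^ 2 - μ₂ ^ 2) * (x * y)) ^ 2 = (2 * μ₁ * μ₂ * l ^ 2) ^ 2 := by
        have : ((μ₁ ^ 2 - μ₂ ^ 2) * (x * y)) ^ 2 = (μ₁ ^ 2 - μ₂ ^ 2) ^ 2 * (x ^ 2 * y ^ 2) := by ring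
        rw [this, hx, hy]; ring
      nlinarith [sq_nonneg (2 * μ₁ * μ₂ * l ^ 2)]
    · have : (μ₁ ^ 2 + μ₂ ^ 2) * l ^ 2 ≤ (μ₁ ^ 2 + μ₂ ^ 2) * (μ₁ - μ₂) ^ 2 := by gcongr
      nlinarith [mul_pos (mul_pos h1 h2) (sq_pos_of_pos (sub_pos.2 h12))]
  have hG : 4 * μ₂ ^ 2 * l ^ 2 ≤ (μ₁ ^ 2 - μ₂ ^ 2) * ((x - y) ^ 2 - 4 * μ₂ ^ 2) := by
    have : (x - y) ^ 2 = x ^ 2 + y ^ 2 - 2 * (x * y) := by ring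
    rw [this, hx, hy]
    nlinarith
  have hS : (x + y) ^ 2 = 4 * μ₁ ^ 2 - 4 * l ^ 2 - ((x - y) ^ 2 - 4 * μ₂ ^ 2) := by
    have : (x + y) ^ 2 = 2 * x ^ 2 + 2 * y ^ 2 - (x - y) ^ 2 := by ring
    rw [this, hx, hy]; ring
  set G := (x - y) ^ 2 - 4 * μ₂ ^ 2 with hGdef
  have hG0 : 0 ≤ G := by
    by_contra hneg
    have : 0 ≤ 4 * μ₂ ^ 2 * l ^ 2 := by positivity
    nlinarith
  have hd : (x - y) ^ 2 = G + 4 * μ₂ ^ 2 := by rw [hGdef]; ring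
  rw [hS, hd]
  have k1 : (μ₁ ^ 2 - μ₂ ^ 2) * a * G ≤ μ₂ ^ 2 * (b - a) * G := by
    refine mul_le_mul_of_nonneg_right ?_ hG0
    linarith
  have k2 : 4 * μ₂ ^ 2 * l ^ 2 * a ≤ (μ₁ ^ 2 - μ₂ ^ 2) * G * a := mul_le_mul_of_nonneg_right hG ha
  have k3 : 0 ≤ μ₂ ^ 2 * (G * (b - a) - 4 * l ^ 2 * a) := by linarith
  have k4 := nonneg_of_mul_nonneg_right k3 (by positivity)
  linarith

/-- Moving away from p = 0 changes the centrifugal terms only through `L₃`. When most of `kinNum`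
sits in its μ₂ part, this change is nonnegative, so H grows at least by the kinetic energy of p. -/
lemma reducedHamiltonian_zero_add_le {m : Fin 3 → ℝ} {μ₁ μ₂ : ℝ} (h2 : 0 < μ₂) (h12 : μ₂ < μ₁)
    {q p : Fin 4 → ℝ} (hl : L₃ q p ^ 2 ≤ (μ₁ - μ₂) ^ 2) (hn1 : 0 < nu₁ m) (hn2 : 0 < nu₂ m)
    (hab : μ₁ ^ 2 * (q 2 ^ 2 / nu₁ m + q 0 ^ 2 / nu₂ m) ≤
      μ₂ ^ 2 * (q 3 ^ 2 / nu₁ m + q 1 ^ 2 / nu₂ m)) :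
    reducedHamiltonian m μ₁ μ₂ (q, 0) + (1 / (2 * nu₁ m) * (p 0 ^ 2 + p 1 ^ 2) +
      1 / (2 * nu₂ m) * (p 2 ^ 2 + p 3 ^ 2)) ≤ reducedHamiltonian m μ₁ μ₂ (q, p) := by
  have h := four_mul_le_Ld_Ls h2 h12 hl
    (a := q 2 ^ 2 / nu₁ m + q 0 ^ 2 / nu₂ m) (by positivity) hab
  have h' := mul_le_mul_of_nonneg_left h
    (by positivity : 0 ≤ 1 / (16 * area q ^ 2) * (1 / 2))
  have e : (Ld μ₁ μ₂ 0 + Ls μ₁ μ₂ 0) ^ 2 = 4 * μ₁ ^ 2 ∧ (Ld μ₁ μ₂ 0 - Ls μ₁ μ₂ 0) ^ 2 = 4 * μ₂ ^ 2 := by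
    rw [Ld_zero h12, Ls_zero h2 h12]; constructor <;> ring
  simp only [reducedHamiltonian, fRed, L₃_zero, e.1, e.2, Pi.zero_apply]
  generalize Ld μ₁ μ₂ (L₃ q p) = x at *
  generalize Ls μ₁ μ₂ (L₃ q p) = y at *
  generalize 1 / (16 * area q ^ 2) = A at *
  generalize potential m (q 0 ^ 2 + q 1 ^ 2) (q 2 ^ 2 + q 3 ^ 2) (q 0 * q 2 + q 1 * q 3) = V
  rw [← sub_nonneg] at h' ⊢
  refine h'.trans_eq ?_
  ring

/-- At small `μ`, the points of a critical family are nondegenerate triangles, and the rotation in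
the direction of the third axis is favourable. -/
theorem IsCriticalFamily.eventually_nondegenerate {m : Fin 3 → ℝ} (hm : ∀ i, 0 < m i)
    {Q : Fin 4 → ℝ → ℝ} (hQ : IsCriticalFamily m Q) :
    ∀ᶠ μ : ℝ in 𝓝[>] 0, (0 < μ ∧ μ < 1) ∧ ∀ μ₁ : ℝ, 0 < μ₁ →
      0 < jac (familyPoint m Q μ₁ μ).1 ∧
      μ₁ ^ 2 * ((familyPoint m Q μ₁ μ).1 2 ^ 2 / nu₁ m + (familyPoint m Q μ₁ μ).1 0 ^ 2 / nu₂ m) <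
        (μ * μ₁) ^ 2 *
          ((familyPoint m Q μ₁ μ).1 3 ^ 2 / nu₁ m + (familyPoint m Q μ₁ μ).1 1 ^ 2 / nu₂ m) := by
  have pk := kappa_pos hm
  have pc := uScale_pos hm
  have n1 := nu₁_pos hm
  have hu := tendsto_uParam hm
  have e1 := (hQ.tendsto_scaled hm).comp hu
  have c1 : ContinuousAt (fun x : ((ℝ × ℝ × ℝ) × ℝ) × ℝ =>
      x.1.1.1 - uScale m * x.2 * x.1.1.2.1 * x.1.1.2.2) (((1, 0, 0), 1), 0) := by fun_prop
  have c2 : ContinuousAt (fun x : ((ℝ × ℝ × ℝ) × ℝ) × ℝ => x.1.2) (((1, 0, 0), 1), 0) := by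
    fun_prop
  -- This is the difference of the two sides, divided by L² u² μ₁². At the limit point it equals
  -- uScale² / ν₁ > 0.
  have c3 : ContinuousAt (fun x : ((ℝ × ℝ × ℝ) × ℝ) × ℝ =>
      uScale m ^ 2 * (x.1.2 ^ 2 / nu₁ m + x.2 ^ 4 * x.1.1.2.1 ^ 2 / nu₂ m) -
      (uScale m ^ 2 * x.1.1.2.2 ^ 2 * x.1.2 ^ 2 / nu₁ m + x.2 ^ 2 * x.1.1.1 ^ 2 / nu₂ m))
      (((1, 0, 0), 1), 0) := by
    fun_prop
  have e4 := (e1.prodMk_nhds (hu.mono_right nhdsWithin_le_nhds)).eventually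
    ((c1.eventually (lt_mem_nhds (by norm_num : (0 : ℝ) < 1 - uScale m * 0 * 0 * 0))).and
      ((c2.eventually (lt_mem_nhds one_pos)).and
        (c3.eventually (lt_mem_nhds (a := 0) (by simp; positivity)))))
  filter_upwards [e4, hu self_mem_nhdsWithin, Ioo_mem_nhdsGT one_pos] with μ ⟨hD, hY, hC⟩ hu0 h01
  refine ⟨h01, fun μ₁ hμ₁ => ?_⟩
  set u := uParam m μ with hudef
  have hu0 : 0 < u := hu0
  have hμ : μ = uScale m * u := (uScale_mul_uParam hm μ).symm
  rw [hμ, IsCriticalFamily.familyPoint_eq hm hu0 hY.ne']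
  set w : (ℝ × ℝ × ℝ) × ℝ :=
    ((Q 0 u / u ^ 2, Q 1 u / u ^ 2, Q 2 u / (uScale m * u * Q 3 u)), Q 3 u) with hw
  have hD : 0 < w.1.1 - uScale m * u * w.1.2.1 * w.1.2.2 := hD
  have hY : 0 < w.2 := hY
  have hC : 0 < uScale m ^ 2 * (w.2 ^ 2 / nu₁ m + u ^ 4 * w.1.2.1 ^ 2 / nu₂ m) -
      (uScale m ^ 2 * w.1.2.2 ^ 2 * w.2 ^ 2 / nu₁ m + u ^ 2 * w.1.1 ^ 2 / nu₂ m) := hC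
  set L := kappa m * μ₁ ^ 2 with hL
  have hL0 : 0 < L := by positivity
  constructor
  · have j : jac (scaledPoint (uScale m) L u w) =
        L ^ 2 * (u ^ 2 * w.2 * (w.1.1 - uScale m * u * w.1.2.1 * w.1.2.2)) := by
      simp only [jac, scaledPoint, Matrix.cons_val]; ring
    rw [j]; positivity
  · rw [← sub_pos]
    have := mul_pos (by positivity : 0 < L ^ 2 * u ^ 2 * μ₁ ^ 2) hC
    refine this.trans_eq ?_
    simp only [scaledPoint, Matrix.cons_val]
    ring

lemma continuous_L₃ : Continuous fun z : (Fin 4 → ℝ) × (Fin 4 → ℝ) => L₃ z.1 z.2 := by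
  unfold L₃; fun_prop

/-- At small `μ`, the point of a critical family is a strict local minimum of the reduced
Hamiltonian. -/
theorem IsCriticalFamily.eventually_strict_min {m : Fin 3 → ℝ} (hm : ∀ i, 0 < m i)
    {Q : Fin 4 → ℝ → ℝ} (hQ : IsCriticalFamily m Q) :
    ∀ᶠ μ : ℝ in 𝓝[>] 0, ∀ μ₁ : ℝ, 0 < μ₁ → ∀ᶠ ζ in 𝓝[≠] (familyPoint m Q μ₁ μ),
      reducedHamiltonian m μ₁ (μ * μ₁) (familyPoint m Q μ₁ μ) <
        reducedHamiltonian m μ₁ (μ * μ₁) ζ := by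
  have n1 := nu₁_pos hm
  have n2 := nu₂_pos hm
  filter_upwards [hQ.eventually_strict_min_config hm, hQ.eventually_nondegenerate hm] with
    μ hmin ⟨⟨h0, h1⟩, hnd⟩ μ₁ hμ₁
  have h2 : 0 < μ * μ₁ := by positivity
  have h12 : μ * μ₁ < μ₁ := by nlinarith
  obtain ⟨-, hab⟩ := hnd μ₁ hμ₁
  have hmin := hmin μ₁ hμ₁
  set ζ₀ := familyPoint m Q μ₁ μ with hζ₀
  have hp0 : ζ₀ = (ζ₀.1, 0) := rfl
  have c1 : ∀ᶠ ζ in 𝓝 ζ₀, L₃ ζ.1 ζ.2 ^ 2 < (μ₁ - μ * μ₁) ^ 2 := by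
    refine (continuous_L₃.pow 2).continuousAt.eventually (gt_mem_nhds ?_)
    change L₃ ζ₀.1 ζ₀.2 ^ 2 < _
    rw [show L₃ ζ₀.1 ζ₀.2 = 0 from L₃_zero _]
    rw [zero_pow two_ne_zero]
    exact pow_pos (by linarith) 2
  have c2 : ∀ᶠ ζ in 𝓝 ζ₀, 0 < (μ * μ₁) ^ 2 * (ζ.1 3 ^ 2 / nu₁ m + ζ.1 1 ^ 2 / nu₂ m) -
      μ₁ ^ 2 * (ζ.1 2 ^ 2 / nu₁ m + ζ.1 0 ^ 2 / nu₂ m) := by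
    refine Continuous.continuousAt (by fun_prop) |>.eventually (lt_mem_nhds (sub_pos.2 hab))
  have c3 := (continuous_fst.tendsto ζ₀).eventually hmin
  filter_upwards [c1.filter_mono nhdsWithin_le_nhds, c2.filter_mono nhdsWithin_le_nhds,
    c3.filter_mono nhdsWithin_le_nhds, self_mem_nhdsWithin] with ζ z1 z2 z3 hne
  have hle := reducedHamiltonian_zero_add_le h2 h12 z1.le n1 n2 (sub_pos.1 z2).le
  rw [Prod.mk.eta] at hle
  -- If p = 0, strictness comes from the configuration, otherwise from the kinetic energy of p.
  by_cases hp : ζ.2 = 0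
  · have hq : ζ.1 ≠ ζ₀.1 := fun h => hne (Prod.ext h hp)
    have := z3 hq
    rw [hp0]
    have e : ζ = (ζ.1, 0) := Prod.ext rfl hp
    rw [e]
    exact this
  · have hpos : 0 < 1 / (2 * nu₁ m) * (ζ.2 0 ^ 2 + ζ.2 1 ^ 2) +
        1 / (2 * nu₂ m) * (ζ.2 2 ^ 2 + ζ.2 3 ^ 2) := by
      obtain ⟨i, hi⟩ := Function.ne_iff.1 hp
      have hi : ζ.2 i ≠ 0 := hi
      fin_cases i <;> simp at hi <;> positivity
    have hle2 : reducedHamiltonian m μ₁ (μ * μ₁) ζ₀ ≤ reducedHamiltonian m μ₁ (μ * μ₁) (ζ.1, 0) := by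
      by_cases hq : ζ.1 = ζ₀.1
      · rw [hq, hp0]
      · exact (z3 hq).le
    linarith

/-! ### Conserved quantities of the 3-body problem -/

/-- The total energy. -/
def energy (m : Fin 3 → ℝ) (z : State) : ℝ :=
  (m 0 * ‖z.2 0‖ ^ 2 + m 1 * ‖z.2 1‖ ^ 2 + m 2 * ‖z.2 2‖ ^ 2) / 2 -
    (m 1 * m 2 / ‖z.1 1 - z.1 2‖ + m 0 * m 2 / ‖z.1 0 - z.1 2‖ + m 0 * m 1 / ‖z.1 0 - z.1 1‖)

/-- Newton's vector field. -/
def newtonField (m : Fin 3 → ℝ) (z : State) : State := (z.2, accel m z.1)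

lemma accel_apply (m : Fin 3 → ℝ) (r : Fin 3 → E4) :
    accel m r 0 = -(m 1 / ‖r 0 - r 1‖ ^ 3) • (r 0 - r 1) - (m 2 / ‖r 0 - r 2‖ ^ 3) • (r 0 - r 2) ∧
    accel m r 1 = (m 0 / ‖r 0 - r 1‖ ^ 3) • (r 0 - r 1) - (m 2 / ‖r 1 - r 2‖ ^ 3) • (r 1 - r 2) ∧
    accel m r 2 = (m 0 / ‖r 0 - r 2‖ ^ 3) • (r 0 - r 2) + (m 1 / ‖r 1 - r 2‖ ^ 3) • (r 1 - r 2) := by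
  have e0 : (Finset.univ.erase 0 : Finset (Fin 3)) = {1, 2} := by decide
  have e1 : (Finset.univ.erase 1 : Finset (Fin 3)) = {0, 2} := by decide
  have e2 : (Finset.univ.erase 2 : Finset (Fin 3)) = {0, 1} := by decide
  refine ⟨?_, ?_, ?_⟩
  · rw [accel, e0, Finset.sum_pair (by decide), norm_sub_rev (r 1), norm_sub_rev (r 2)]
    module
  · rw [accel, e1, Finset.sum_pair (by decide), norm_sub_rev (r 2)]
    module
  · rw [accel, e2, Finset.sum_pair (by decide)]

lemma hasDerivAt_const_div_norm {x : ℝ → E4} {x' : E4} {t : ℝ} (h : HasDerivAt x x' t)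
    (h0 : x t ≠ 0) (c : ℝ) :
    HasDerivAt (fun s => c / ‖x s‖) (-(c / ‖x t‖ ^ 3) * inner ℝ (x t) x') t := by
  have hn : 0 < ‖x t‖ := norm_pos_iff.2 h0
  have h1 := h.norm_sq.sqrt (by positivity)
  simp only [Real.sqrt_sq (norm_nonneg _)] at h1
  refine ((hasDerivAt_const t c).div h1 hn.ne').congr_deriv ?_
  field_simp
  ring

lemma hasDerivAt_state {z : ℝ → State} {w : State} {t : ℝ} (h : HasDerivAt z w t) :
    (∀ i, HasDerivAt (fun s => (z s).1 i) (w.1 i) t) ∧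
      ∀ i, HasDerivAt (fun s => (z s).2 i) (w.2 i) t :=
  ⟨hasDerivAt_pi.1 h.fst, hasDerivAt_pi.1 h.snd⟩

/-- The speed φ is arbitrary because conservation depends only on the direction of the vector field.
Later φ is a cutoff function, and the conservation laws still confine the curve. -/
lemma hasDerivAt_energy {m : Fin 3 → ℝ} {z : ℝ → State} {t φ : ℝ}
    (h : HasDerivAt z (φ • newtonField m (z t)) t) (hi : Function.Injective (z t).1) :
    HasDerivAt (fun s => energy m (z s)) 0 t := by
  obtain ⟨hr, hv⟩ := hasDerivAt_state h
  have d12 : (z t).1 1 - (z t).1 2 ≠ 0 := sub_ne_zero.2 (hi.ne (by decide))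
  have d02 : (z t).1 0 - (z t).1 2 ≠ 0 := sub_ne_zero.2 (hi.ne (by decide))
  have d01 : (z t).1 0 - (z t).1 1 ≠ 0 := sub_ne_zero.2 (hi.ne (by decide))
  have hK := ((((hv 0).norm_sq.const_mul (m 0)).add ((hv 1).norm_sq.const_mul (m 1))).add
    ((hv 2).norm_sq.const_mul (m 2))).div_const 2
  have hV := ((hasDerivAt_const_div_norm ((hr 1).sub (hr 2)) d12 (m 1 * m 2)).add
    (hasDerivAt_const_div_norm ((hr 0).sub (hr 2)) d02 (m 0 * m 2))).add
    (hasDerivAt_const_div_norm ((hr 0).sub (hr 1)) d01 (m 0 * m 1))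
  refine (hK.sub hV).congr_deriv ?_
  obtain ⟨a0, a1, a2⟩ := accel_apply m (z t).1
  simp only [newtonField, Prod.smul_fst, Prod.smul_snd, Pi.smul_apply, a0, a1, a2, Pi.sub_apply,
    inner_smul_right, inner_sub_right, inner_sub_left, inner_add_right]
  simp only [real_inner_comm ((z t).1 _) ((z t).2 _), neg_mul]
  ring

lemma hasDerivAt_angularMomentum {m : Fin 3 → ℝ} {z : ℝ → State} {t φ : ℝ}
    (h : HasDerivAt z (φ • newtonField m (z t)) t) (a b : Fin 4) :
    HasDerivAt (fun s => angularMomentum m (z s) a b) 0 t := by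
  obtain ⟨hr, hv⟩ := hasDerivAt_state h
  have hr' : ∀ i a, HasDerivAt (fun s => (z s).1 i a) ((φ • newtonField m (z t)).1 i a) t :=
    fun i a =>
    (EuclideanSpace.proj a : E4 →L[ℝ] ℝ).hasFDerivAt.comp_hasDerivAt t (hr i)
  have hv' : ∀ i a, HasDerivAt (fun s => (z s).2 i a) ((φ • newtonField m (z t)).2 i a) t :=
    fun i a =>
    (EuclideanSpace.proj a : E4 →L[ℝ] ℝ).hasFDerivAt.comp_hasDerivAt t (hv i)
  have h1 : ∀ i, HasDerivAt (fun s => m i * ((z s).1 i a * (z s).2 i b - (z s).2 i a * (z s).1 i b))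
      _ t := fun i =>
    (((hr' i a).mul (hv' i b)).sub ((hv' i a).mul (hr' i b))).const_mul (m i)
  have h2 := HasDerivAt.fun_sum (u := Finset.univ) fun i _ => h1 i
  refine h2.congr_deriv ?_
  obtain ⟨a0, a1, a2⟩ := accel_apply m (z t).1
  simp only [Fin.sum_univ_three, newtonField, Prod.smul_fst, Prod.smul_snd, Pi.smul_apply, a0, a1, a2,
    PiLp.smul_apply, PiLp.sub_apply, PiLp.add_apply, smul_eq_mul]
  ring

lemma com_accel (m : Fin 3 → ℝ) (r : Fin 3 → E4) : com m (accel m r) = 0 := by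
  obtain ⟨a0, a1, a2⟩ := accel_apply m r
  rw [com, Fin.sum_univ_three (fun i => m i • accel m r i), a0, a1, a2]
  have : m 0 • (-(m 1 / ‖r 0 - r 1‖ ^ 3) • (r 0 - r 1) - (m 2 / ‖r 0 - r 2‖ ^ 3) • (r 0 - r 2)) +
      m 1 • ((m 0 / ‖r 0 - r 1‖ ^ 3) • (r 0 - r 1) - (m 2 / ‖r 1 - r 2‖ ^ 3) • (r 1 - r 2)) +
      m 2 • ((m 0 / ‖r 0 - r 2‖ ^ 3) • (r 0 - r 2) + (m 1 / ‖r 1 - r 2‖ ^ 3) • (r 1 - r 2)) = 0 := by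
    module
  rw [this, smul_zero]

/-- The centre of mass as a linear map. -/
def comCLM (m : Fin 3 → ℝ) : (Fin 3 → E4) →L[ℝ] E4 :=
  (∑ i, m i)⁻¹ • ∑ i, m i • ContinuousLinearMap.proj i

lemma comCLM_apply (m : Fin 3 → ℝ) (r : Fin 3 → E4) : comCLM m r = com m r := by
  simp [comCLM, com, sum_apply]

lemma hasDerivAt_com {m : Fin 3 → ℝ} {z : ℝ → State} {t φ : ℝ}
    (h : HasDerivAt z (φ • newtonField m (z t)) t) :
    HasDerivAt (fun s => com m (z s).1) (φ • com m (z t).2) t ∧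
      HasDerivAt (fun s => com m (z s).2) 0 t := by
  have h1 := (comCLM m).hasFDerivAt.comp_hasDerivAt t h.fst
  have h2 := (comCLM m).hasFDerivAt.comp_hasDerivAt t h.snd
  constructor
  · simpa [Function.comp_def, comCLM_apply, newtonField] using h1
  · simpa [Function.comp_def, comCLM_apply, newtonField, com_accel] using h2

/-! ### Rotations -/

lemma rotate_fst (g : Matrix (Fin 4) (Fin 4) ℝ) (z : State) (i : Fin 3) :
    (rotate g z).1 i = Matrix.toEuclideanLin g (z.1 i) := rfl

lemma rotate_snd (g : Matrix (Fin 4) (Fin 4) ℝ) (z : State) (i : Fin 3) :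
    (rotate g z).2 i = Matrix.toEuclideanLin g (z.2 i) := rfl

lemma toEuclideanLin_eq (g : Matrix (Fin 4) (Fin 4) ℝ) (x : E4) :
    Matrix.toEuclideanLin g x = WithLp.toLp 2 (g.mulVec x.ofLp) := rfl

lemma rotate_one (z : State) : rotate 1 z = z := by
  ext i : 2 <;> simp [rotate]

lemma rotate_mul (g h : Matrix (Fin 4) (Fin 4) ℝ) (z : State) :
    rotate (g * h) z = rotate g (rotate h z) := by
  ext i : 2 <;> simp [rotate, toEuclideanLin_eq]

lemma rotate_sub (g : Matrix (Fin 4) (Fin 4) ℝ) (z w : State) :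
    rotate g (z - w) = rotate g z - rotate g w := by
  ext i : 2 <;> simp [rotate]

lemma norm_toEuclideanLin {g : Matrix (Fin 4) (Fin 4) ℝ} (hg : g ∈ Matrix.orthogonalGroup (Fin 4) ℝ)
    (x : E4) : ‖Matrix.toEuclideanLin g x‖ = ‖x‖ := by
  have h : g.transpose * g = 1 := by simpa [Matrix.star_eq_conjTranspose] using
    (Matrix.mem_orthogonalGroup_iff' (Fin 4) ℝ).1 hg
  rw [EuclideanSpace.norm_eq, EuclideanSpace.norm_eq]
  congr 1
  have e : ∀ y : E4, ∑ i, ‖y i‖ ^ 2 = (y : Fin 4 → ℝ) ⬝ᵥ y := fun y => by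
    simp [dotProduct, sq]
  rw [e, e, toEuclideanLin_eq]
  simp only []
  rw [Matrix.dotProduct_mulVec, Matrix.vecMul_mulVec, ← Matrix.dotProduct_mulVec, h,
    Matrix.one_mulVec]

lemma norm_rotate {g : Matrix (Fin 4) (Fin 4) ℝ} (hg : g ∈ Matrix.orthogonalGroup (Fin 4) ℝ)
    (z : State) : ‖rotate g z‖ = ‖z‖ := by
  simp only [Prod.norm_def, Pi.norm_def, rotate_fst, rotate_snd, ← norm_toNNReal,
    norm_toEuclideanLin hg]

lemma dist_rotate {g : Matrix (Fin 4) (Fin 4) ℝ} (hg : g ∈ Matrix.orthogonalGroup (Fin 4) ℝ)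
    (z w : State) : dist (rotate g z) (rotate g w) = dist z w := by
  rw [dist_eq_norm, dist_eq_norm, ← rotate_sub, norm_rotate hg]

lemma energy_rotate {g : Matrix (Fin 4) (Fin 4) ℝ} (hg : g ∈ Matrix.orthogonalGroup (Fin 4) ℝ)
    (m : Fin 3 → ℝ) (z : State) : energy m (rotate g z) = energy m z := by
  simp only [energy, rotate_fst, rotate_snd, ← map_sub, norm_toEuclideanLin hg]

lemma accel_rotate {g : Matrix (Fin 4) (Fin 4) ℝ} (hg : g ∈ Matrix.orthogonalGroup (Fin 4) ℝ)
    (m : Fin 3 → ℝ) (z : State) (i : Fin 3) :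
    accel m (rotate g z).1 i = Matrix.toEuclideanLin g (accel m z.1 i) := by
  simp only [accel, rotate_fst, ← map_sub, norm_toEuclideanLin hg, ← map_smul, ← map_sum]

lemma com_rotate (g : Matrix (Fin 4) (Fin 4) ℝ) (m : Fin 3 → ℝ) (z : State) :
    com m (rotate g z).1 = Matrix.toEuclideanLin g (com m z.1) ∧
      com m (rotate g z).2 = Matrix.toEuclideanLin g (com m z.2) := by
  simp only [com, rotate_fst, rotate_snd, ← map_smul, ← map_sum, and_self]

lemma angularMomentum_rotate (g : Matrix (Fin 4) (Fin 4) ℝ) (m : Fin 3 → ℝ) (z : State) :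
    angularMomentum m (rotate g z) = g * angularMomentum m z * g.transpose := by
  have e : ∀ z : State, angularMomentum m z = ∑ i, m i •
      (Matrix.vecMulVec (z.1 i) (z.2 i) - Matrix.vecMulVec (z.2 i) (z.1 i)) := fun z => by
    ext a b
    simp [angularMomentum, Matrix.sum_apply, Matrix.vecMulVec_apply]
  rw [e, e, Finset.mul_sum, Finset.sum_mul]
  refine Finset.sum_congr rfl fun i _ => ?_
  simp only [rotate_fst, rotate_snd, toEuclideanLin_eq, Matrix.mul_smul, Matrix.smul_mul,
    mul_sub, sub_mul, Matrix.mul_vecMulVec, Matrix.vecMulVec_mul, Matrix.vecMul_transpose]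

lemma trace_conj {g J : Matrix (Fin 4) (Fin 4) ℝ} (hg : g ∈ Matrix.orthogonalGroup (Fin 4) ℝ) :
    ((g * J * g.transpose) * (g * J * g.transpose).transpose).trace = (J * J.transpose).trace := by
  have h : g.transpose * g = 1 := by simpa [Matrix.star_eq_conjTranspose] using
    (Matrix.mem_orthogonalGroup_iff' (Fin 4) ℝ).1 hg
  have : (g * J * g.transpose) * (g * J * g.transpose).transpose =
      g * (J * (g.transpose * g) * J.transpose) * g.transpose := by
    simp only [Matrix.transpose_mul, Matrix.transpose_transpose, mul_assoc]
  rw [this, h, mul_one, Matrix.trace_mul_comm, ← mul_assoc, h, one_mul]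

lemma det_conj {g J : Matrix (Fin 4) (Fin 4) ℝ} (hg : g ∈ Matrix.orthogonalGroup (Fin 4) ℝ) :
    (g * J * g.transpose).det = J.det := by
  have h : g.transpose * g = 1 := by simpa [Matrix.star_eq_conjTranspose] using
    (Matrix.mem_orthogonalGroup_iff' (Fin 4) ℝ).1 hg
  rw [Matrix.det_mul, Matrix.det_mul, mul_comm, ← mul_assoc, ← Matrix.det_mul, h, Matrix.det_one,
    one_mul]

/-! ### Global solutions of bounded Lipschitz vector fields -/

/-- With global bounds, Picard–Lindelöf applies on time intervals of any length; uniqueness glues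
the solutions. -/
theorem exists_global_solution {E : Type*} [NormedAddCommGroup E] [NormedSpace ℝ E]
    [CompleteSpace E] {V : E → E} {K L : NNReal} (hK : LipschitzWith K V) (hL : ∀ x, ‖V x‖ ≤ L)
    (w : E) : ∃ z : ℝ → E, z 0 = w ∧ ∀ t, HasDerivAt z (V (z t)) t := by
  have hloc : ∀ n : ℕ, ∃ z : ℝ → E, z 0 = w ∧
      ∀ t ∈ Set.Ioo (-(n + 1 : ℝ)) (n + 1), HasDerivAt z (V (z t)) t := fun n => by
    have h0 : (0 : ℝ) ∈ Set.Icc (-(n + 1 : ℝ)) (n + 1) := ⟨by linarith [n.cast_nonneg (α := ℝ)],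
      by positivity⟩
    -- The radius L (n + 1) is the distance covered in time n + 1 at speed at most L.
    have hp : IsPicardLindelof (fun _ => V) (⟨0, h0⟩ : Set.Icc (-(n + 1 : ℝ)) (n + 1)) w
        (L * (n + 1)) 0 L K :=
      IsPicardLindelof.of_time_independent (fun x _ => hL x) hK.lipschitzOnWith (by simp)
    obtain ⟨z, hz, hz'⟩ := hp.exists_eq_forall_mem_Icc_hasDerivWithinAt₀
    exact ⟨z, hz, fun t ht => (hz' t (Set.Ioo_subset_Icc_self ht)).hasDerivAt (Icc_mem_nhds ht.1 ht.2)⟩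
  choose z hz0 hz using hloc
  have heq : ∀ n k : ℕ, n ≤ k → Set.EqOn (z n) (z k) (Set.Ioo (-(n + 1 : ℝ)) (n + 1)) := by
    intro n k hnk
    have hnk : (n : ℝ) ≤ k := by exact_mod_cast hnk
    refine ODE_solution_unique_of_mem_Ioo (v := fun _ => V) (s := fun _ => Set.univ) (t₀ := 0)
      (K := K) (fun _ _ => hK.lipschitzOnWith) ⟨by linarith [n.cast_nonneg (α := ℝ)], by positivity⟩
      (fun t ht => ⟨hz n t ht, trivial⟩) (fun t ht => ⟨hz k t ⟨?_, ?_⟩, trivial⟩)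
      ((hz0 n).trans (hz0 k).symm)
    · linarith [ht.1]
    · linarith [ht.2]
  -- The solution with index n lives on times below n + 1 in absolute value, so the index ⌈|t|⌉₊
  -- leaves a neighbourhood of t inside its domain.
  refine ⟨fun t => z ⌈|t|⌉₊ t, hz0 _, fun t => ?_⟩
  set n := ⌈|t|⌉₊ + 1 with hn
  have key : ∀ s ∈ Set.Ioo (-(⌈|t|⌉₊ + 1 : ℝ)) (⌈|t|⌉₊ + 1), z ⌈|s|⌉₊ s = z n s := by
    intro s hs
    refine heq _ _ ?_ ?_
    · rw [hn, Nat.ceil_le]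
      push_cast
      exact (abs_lt.2 ⟨hs.1, hs.2⟩).le
    · have := Nat.le_ceil |s|
      have h2 := neg_abs_le s
      have h3 := le_abs_self s
      exact ⟨by linarith, by linarith⟩
  have ht : t ∈ Set.Ioo (-(⌈|t|⌉₊ + 1 : ℝ)) (⌈|t|⌉₊ + 1) := by
    have := Nat.le_ceil |t|
    have h2 := neg_abs_le t
    have h3 := le_abs_self t
    exact ⟨by linarith, by linarith⟩
  have hd := hz n t ⟨by rw [hn]; push_cast; linarith [ht.1], by rw [hn]; push_cast; linarith [ht.2]⟩
  rw [← key t ht] at hd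
  exact hd.congr_of_eventuallyEq (eventually_of_mem (Ioo_mem_nhds ht.1 ht.2) key)

/-- A vector field that is `C¹` on a bounded open set has, after multiplication with a cutoff
function, global solutions. -/
theorem exists_cutoff_global_solution {E : Type*} [NormedAddCommGroup E] [NormedSpace ℝ E]
    [FiniteDimensional ℝ E] {V : E → E} {K N : Set E} (hN : IsOpen N) (hNb : Bornology.IsBounded N)
    (hK : IsClosed K) (hKN : K ⊆ N) (hV : ∀ x ∈ N, ContDiffAt ℝ 1 V x) :
    ∃ f : E → ℝ, (∀ x ∈ K, f x = 1) ∧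
      ∀ w, ∃ z : ℝ → E, z 0 = w ∧ ∀ t, HasDerivAt z (f (z t) • V (z t)) t := by
  obtain ⟨f, h0, h1, -⟩ := exists_contMDiffMap_zero_one_nhds_of_isClosed (n := 1)
    (modelWithCornersSelf ℝ E) hN.isClosed_compl hK
    (Set.disjoint_left.2 fun x hx hx' => hx (hKN hx'))
  have hf : ContDiff ℝ 1 f := f.contMDiff.contDiff
  have : ProperSpace E := FiniteDimensional.proper ℝ E
  -- Outside N the cutoff vanishes in a whole neighbourhood, so nothing is required of V there.
  have hfV : ContDiff ℝ 1 fun x => f x • V x := by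
    refine contDiff_iff_contDiffAt.2 fun x => ?_
    by_cases hx : x ∈ N
    · exact hf.contDiffAt.smul (hV x hx)
    · have : ∀ᶠ y in 𝓝 x, f y • V y = 0 := by
        filter_upwards [(eventually_nhdsSet_iff_forall.1 h0) x hx] with y hy
        rw [hy, zero_smul]
      exact contDiffAt_const.congr_of_eventuallyEq this
  have hsupp : HasCompactSupport fun x => f x • V x := by
    refine HasCompactSupport.of_support_subset_isCompact
      (Metric.isCompact_of_isClosed_isBounded isClosed_closure hNb.closure) fun x hx => ?_
    refine subset_closure ?_
    by_contra hxN
    exact hx (by simp [(eventually_nhdsSet_iff_forall.1 h0 x hxN).self_of_nhds])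
  obtain ⟨C, hC⟩ := hfV.lipschitzWith_of_hasCompactSupport hsupp one_ne_zero
  obtain ⟨L, hL⟩ := hsupp.exists_bound_of_continuous hfV.continuous
  refine ⟨f, fun x hx => h1.self_of_nhdsSet x hx, fun w =>
    exists_global_solution (L := L.toNNReal) hC (fun x => (hL x).trans (Real.le_coe_toNNReal L)) w⟩

/-! ### Stability from conserved quantities -/

/-- The deviation of the conserved quantities from their values at `z₀`. -/
def deviation (m : Fin 3 → ℝ) (z₀ z : State) : ℝ :=
  |energy m z - energy m z₀| +
    (|(angularMomentum m z * (angularMomentum m z).transpose).trace -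
      (angularMomentum m z₀ * (angularMomentum m z₀).transpose).trace| +
    |(angularMomentum m z).det - (angularMomentum m z₀).det|)

/-- The orbit of `z₀` under rotations. -/
def rotationOrbit (z₀ : State) : Set State :=
  {z | ∃ g ∈ Matrix.specialOrthogonalGroup (Fin 4) ℝ, z = rotate g z₀}

lemma mem_orthogonal_of_special {g : Matrix (Fin 4) (Fin 4) ℝ}
    (hg : g ∈ Matrix.specialOrthogonalGroup (Fin 4) ℝ) : g ∈ Matrix.orthogonalGroup (Fin 4) ℝ :=
  (Matrix.mem_specialOrthogonalGroup_iff.1 hg).1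

lemma transpose_mem_special {g : Matrix (Fin 4) (Fin 4) ℝ}
    (hg : g ∈ Matrix.specialOrthogonalGroup (Fin 4) ℝ) :
    g.transpose ∈ Matrix.specialOrthogonalGroup (Fin 4) ℝ ∧ g.transpose * g = 1 ∧
      g * g.transpose = 1 := by
  obtain ⟨h1, h2⟩ := Matrix.mem_specialOrthogonalGroup_iff.1 hg
  have e1 : g.transpose * g = 1 := by simpa [Matrix.star_eq_conjTranspose] using
    (Matrix.mem_orthogonalGroup_iff' (Fin 4) ℝ).1 h1
  have e2 : g * g.transpose = 1 := by simpa [Matrix.star_eq_conjTranspose] using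
    (Matrix.mem_orthogonalGroup_iff (Fin 4) ℝ).1 h1
  refine ⟨Matrix.mem_specialOrthogonalGroup_iff.2
    ⟨(Matrix.mem_orthogonalGroup_iff (Fin 4) ℝ).2 ?_, by simpa using h2⟩, e1, e2⟩
  simpa [Matrix.star_eq_conjTranspose] using e1

lemma self_mem_rotationOrbit (z₀ : State) : z₀ ∈ rotationOrbit z₀ :=
  ⟨1, one_mem _, (rotate_one z₀).symm⟩

lemma continuous_angularMomentum (m : Fin 3 → ℝ) : Continuous (angularMomentum m) := by
  refine continuous_matrix fun a b => ?_
  simp only [angularMomentum, Matrix.of_apply]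
  refine continuous_finsetSum _ fun i _ => ?_
  fun_prop

lemma continuousAt_energy (m : Fin 3 → ℝ) {z : State} (hz : Function.Injective z.1) :
    ContinuousAt (energy m) z := by
  have h : ∀ (c : ℝ) (i j : Fin 3), i ≠ j →
      ContinuousAt (fun z : State => c / ‖z.1 i - z.1 j‖) z := fun c i j hij =>
    ContinuousAt.div continuousAt_const (by fun_prop)
      (norm_ne_zero_iff.2 (sub_ne_zero.2 (hz.ne hij)))
  unfold energy
  exact ContinuousAt.sub (by fun_prop) (((h _ 1 2 (by decide)).add (h _ 0 2 (by decide))).add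
    (h _ 0 1 (by decide)))

lemma continuousAt_deviation (m : Fin 3 → ℝ) (z₀ : State) {z : State}
    (hz : Function.Injective z.1) : ContinuousAt (deviation m z₀) z := by
  have h1 := continuousAt_energy m hz
  have h2 := continuous_angularMomentum m
  have h3 : Continuous fun z : State => (angularMomentum m z * (angularMomentum m z).transpose).trace :=
    (h2.matrix_mul h2.matrix_transpose).matrix_trace
  have h4 : Continuous fun z : State => (angularMomentum m z).det := h2.matrix_det
  exact ((h1.sub continuousAt_const).abs).add
    (((h3.sub continuous_const).abs.add (h4.sub continuous_const).abs).continuousAt)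

lemma eventually_injective {z : State} (hz : Function.Injective z.1) :
    ∀ᶠ w in 𝓝 z, Function.Injective w.1 := by
  have h : ∀ i j : Fin 3, i ≠ j → ∀ᶠ w in 𝓝 z, w.1 i ≠ w.1 j := fun i j hij =>
    (isOpen_ne_fun (by fun_prop : Continuous fun w : State => w.1 i)
      (by fun_prop : Continuous fun w : State => w.1 j)).eventually_mem (hz.ne hij)
  have h' : ∀ᶠ w in 𝓝 z, ∀ i j : Fin 3, i ≠ j → w.1 i ≠ w.1 j := by
    refine eventually_all.2 fun i => eventually_all.2 fun j => ?_
    by_cases hij : i = j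
    · simp [hij]
    · filter_upwards [h i j hij] with w hw _ using hw
  filter_upwards [h'] with w hw i j hij
  by_contra hne
  exact hw i j hne hij

lemma injective_rotate {g : Matrix (Fin 4) (Fin 4) ℝ}
    (hg : g ∈ Matrix.specialOrthogonalGroup (Fin 4) ℝ) {z : State} (hz : Function.Injective z.1) :
    Function.Injective (rotate g z).1 := by
  intro i j hij
  refine hz ?_
  have h := norm_toEuclideanLin (mem_orthogonal_of_special hg) (z.1 i - z.1 j)
  rw [map_sub] at h
  have : Matrix.toEuclideanLin g (z.1 i) - Matrix.toEuclideanLin g (z.1 j) = 0 := sub_eq_zero.2 hij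
  rw [this, norm_zero] at h
  exact sub_eq_zero.1 (norm_eq_zero.1 h.symm)

lemma deviation_rotate {g : Matrix (Fin 4) (Fin 4) ℝ}
    (hg : g ∈ Matrix.orthogonalGroup (Fin 4) ℝ) (m : Fin 3 → ℝ) (z₀ z : State) :
    deviation m z₀ (rotate g z) = deviation m z₀ z := by
  rw [deviation, energy_rotate hg, angularMomentum_rotate, trace_conj hg, det_conj hg, deviation]

lemma contDiffAt_newtonField (m : Fin 3 → ℝ) {z : State} (hz : Function.Injective z.1) :
    ContDiffAt ℝ 1 (newtonField m) z := by
  refine ContDiffAt.prodMk (by fun_prop) (contDiffAt_pi.2 fun i => ?_)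
  simp only [accel]
  refine ContDiffAt.sum fun j hj => ?_
  have hji : z.1 j - z.1 i ≠ 0 := sub_ne_zero.2 (hz.ne (Finset.ne_of_mem_erase hj))
  have h1 : ContDiffAt ℝ 1 (fun z : State => z.1 j - z.1 i) z := by fun_prop
  exact ContDiffAt.smul (contDiffAt_const.div ((h1.norm ℝ hji).pow 3)
    (pow_ne_zero 3 (norm_ne_zero_iff.2 hji))) h1

/-- Curves that follow Newton's vector field, with any speed, do not leave a neighbourhood of the
orbit, if the conserved quantities prevent it. -/
theorem infDist_lt_of_deviation_lt {m : Fin 3 → ℝ} {z₀ : State} {ε c : ℝ} {z : ℝ → State}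
    {φ : ℝ → ℝ} {s : Set ℝ} (hs : IsOpen s) (hsc : IsPreconnected s)
    (hinj : ∀ w, Metric.infDist w (rotationOrbit z₀) ≤ ε → Function.Injective w.1)
    (hgap : ∀ w : State, com m w.1 = 0 → com m w.2 = 0 →
      Metric.infDist w (rotationOrbit z₀) = ε → c ≤ deviation m z₀ w)
    (hz : ∀ t ∈ s, HasDerivAt z (φ t • newtonField m (z t)) t) {t₀ : ℝ} (ht₀ : t₀ ∈ s)
    (hcom : com m (z t₀).1 = 0) (hcom' : com m (z t₀).2 = 0)
    (h0 : Metric.infDist (z t₀) (rotationOrbit z₀) < ε) (hdev : deviation m z₀ (z t₀) < c) :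
    ∀ t ∈ s, Metric.infDist (z t) (rotationOrbit z₀) < ε := by
  have hzc : ∀ t ∈ s, ContinuousAt z t := fun t ht => (hz t ht).continuousAt
  -- Continuous induction: the times at which the curve is inside the tube and all conserved
  -- quantities have their initial values form an open and relatively closed subset of the connected
  -- set s.
  set S : Set ℝ := {t | t ∈ s ∧ Metric.infDist (z t) (rotationOrbit z₀) < ε ∧
    com m (z t).1 = 0 ∧ com m (z t).2 = 0 ∧ energy m (z t) = energy m (z t₀) ∧
    angularMomentum m (z t) = angularMomentum m (z t₀)} with hS
  have hdist : ∀ t ∈ s, ContinuousAt (fun t => Metric.infDist (z t) (rotationOrbit z₀)) t :=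
    fun t ht => (Metric.continuous_infDist_pt _).continuousAt.comp (hzc t ht)
  have hconst : ∀ {F : Type} [NormedAddCommGroup F] [NormedSpace ℝ F] (f : ℝ → F) (a r : ℝ),
      (∀ t ∈ Metric.ball a r, HasDerivAt f 0 t) → ∀ t ∈ Metric.ball a r, f t = f a := by
    intro F _ _ f a r h t ht
    have hr : a ∈ Metric.ball a r := Metric.mem_ball_self (dist_nonneg.trans_lt ht)
    exact (convex_ball a r).is_const_of_fderivWithin_eq_zero (𝕜 := ℝ)
      (fun x hx => (h x hx).hasFDerivAt.differentiableAt.differentiableWithinAt)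
      (fun x hx => by
        rw [fderivWithin_of_isOpen Metric.isOpen_ball hx, (h x hx).hasFDerivAt.fderiv]; simp) ht hr
  have hopen : IsOpen S := by
    refine isOpen_iff_mem_nhds.2 fun t ⟨ht, hd, h1, h2, h3, h4⟩ => ?_
    have hev : ∀ᶠ x in 𝓝 t, x ∈ s ∧ Metric.infDist (z x) (rotationOrbit z₀) < ε :=
      (hs.eventually_mem ht).and ((hdist t ht).eventually (gt_mem_nhds hd))
    obtain ⟨r, hr, hb⟩ := Metric.eventually_nhds_iff_ball.1 hev
    refine Filter.mem_of_superset (Metric.ball_mem_nhds t hr) fun x hx => ?_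
    have c2 : ∀ y ∈ Metric.ball t r, com m (z y).2 = 0 := fun y hy => by
      rw [hconst (fun y => com m (z y).2) t r
        (fun y hy => (hasDerivAt_com (hz y (hb y hy).1)).2) y hy, h2]
    have c1 : ∀ y ∈ Metric.ball t r, com m (z y).1 = 0 := fun y hy => by
      rw [hconst (fun y => com m (z y).1) t r
        (fun y hy => ((hasDerivAt_com (hz y (hb y hy).1)).1).congr_deriv (by rw [c2 y hy, smul_zero]))
        y hy, h1]
    refine ⟨(hb x hx).1, (hb x hx).2, c1 x hx, c2 x hx, ?_, ?_⟩
    · rw [hconst (fun y => energy m (z y)) t r (fun y hy => hasDerivAt_energy (hz y (hb y hy).1)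
        (hinj _ (hb y hy).2.le)) x hx, h3]
    · ext a b
      rw [hconst (fun y => angularMomentum m (z y) a b) t r
        (fun y hy => hasDerivAt_angularMomentum (hz y (hb y hy).1) a b) x hx, h4]
  have hcomc : Continuous (com m) := by
    have : com m = comCLM m := funext fun r => (comCLM_apply m r).symm
    rw [this]; exact (comCLM m).continuous
  have hclosed : closure S ∩ s ⊆ S := by
    rintro t ⟨ht, hts⟩
    have := mem_closure_iff_frequently.1 ht
    have lim : ∀ {F : Type} [TopologicalSpace F] [T2Space F] (f : ℝ → F) (b : F),
        ContinuousAt f t → (∀ x ∈ S, f x = b) → f t = b := by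
      intro F _ _ f b hf hb
      by_contra hne
      obtain ⟨x, hx, hx'⟩ := (this.and_eventually (hf.eventually_ne hne)).exists
      exact hx' (hb x hx)
    have hle : Metric.infDist (z t) (rotationOrbit z₀) ≤ ε := by
      by_contra! hlt
      obtain ⟨x, hx, hx'⟩ := (this.and_eventually ((hdist t hts).eventually (lt_mem_nhds hlt))).exists
      exact lt_asymm hx' hx.2.1
    have l1 : com m (z t).1 = 0 := lim (fun t => com m (z t).1) 0
      (hcomc.continuousAt.comp (hzc t hts).fst) fun x hx => hx.2.2.1
    have l2 : com m (z t).2 = 0 := lim (fun t => com m (z t).2) 0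
      (hcomc.continuousAt.comp (hzc t hts).snd) fun x hx => hx.2.2.2.1
    have l3 : energy m (z t) = energy m (z t₀) := lim (fun t => energy m (z t)) _
      (ContinuousAt.comp (g := energy m) (continuousAt_energy m (hinj _ hle)) (hzc t hts))
      fun x hx => hx.2.2.2.2.1
    have l4 : angularMomentum m (z t) = angularMomentum m (z t₀) :=
      lim (fun t => angularMomentum m (z t)) _
        ((continuous_angularMomentum m).continuousAt.comp (hzc t hts)) fun x hx => hx.2.2.2.2.2
    -- A limit time could only lie on the boundary of the tube, where the deviation is at least c;
    -- but it is conserved and was less than c.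
    refine ⟨hts, lt_of_le_of_ne hle fun heq => ?_, l1, l2, l3, l4⟩
    have := hgap _ l1 l2 heq
    rw [deviation, l3, l4] at this
    exact absurd hdev (not_lt.2 this)
  have hsub := hsc.subset_of_closure_inter_subset hopen
    ⟨t₀, ht₀, ht₀, h0, hcom, hcom', rfl, rfl⟩ hclosed
  exact fun t ht => (hsub ht).2.1

/-! ### Stability of rigid states -/

/-- Near `z₀`, the conserved quantities determine a centred state up to rotation. -/
def IsRigid (m : Fin 3 → ℝ) (z₀ : State) : Prop :=
  ∀ᶠ z in 𝓝 z₀, com m z.1 = 0 → com m z.2 = 0 → deviation m z₀ z = 0 →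
    ∃ g ∈ Matrix.specialOrthogonalGroup (Fin 4) ℝ, rotate g z = z₀

lemma exists_rotate_dist_lt {z₀ w : State} {r : ℝ} (h : Metric.infDist w (rotationOrbit z₀) < r) :
    ∃ g ∈ Matrix.specialOrthogonalGroup (Fin 4) ℝ, dist w (rotate g z₀) < r ∧
      dist (rotate g.transpose w) z₀ < r := by
  obtain ⟨y, ⟨g, hg, rfl⟩, hy⟩ := (Metric.infDist_lt_iff ⟨z₀, self_mem_rotationOrbit z₀⟩).1 h
  obtain ⟨h1, h2, h3⟩ := transpose_mem_special hg
  refine ⟨g, hg, hy, ?_⟩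
  rwa [← dist_rotate (mem_orthogonal_of_special h1), ← rotate_mul, h2, rotate_one] at hy

/-- Rigidity concerns only a neighbourhood of z₀; the invariance of distances, centre of mass and
deviation under rotations spreads it over a tube around the whole orbit. Half of the radius is taken
to allow closed tubes. -/
lemma IsRigid.exists_radius {m : Fin 3 → ℝ} {z₀ : State} (hinj : Function.Injective z₀.1)
    (h : IsRigid m z₀) : ∃ r > 0,
      (∀ w, Metric.infDist w (rotationOrbit z₀) ≤ r → Function.Injective w.1) ∧
      ∀ w : State, Metric.infDist w (rotationOrbit z₀) ≤ r → com m w.1 = 0 → com m w.2 = 0 →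
        deviation m z₀ w = 0 → Metric.infDist w (rotationOrbit z₀) = 0 := by
  obtain ⟨r, hr, hb⟩ := Metric.eventually_nhds_iff.1 ((eventually_injective hinj).and h)
  refine ⟨r / 2, half_pos hr, fun w hw => ?_, fun w hw h1 h2 h3 => ?_⟩
  · obtain ⟨g, hg, -, hd⟩ := exists_rotate_dist_lt (hw.trans_lt (half_lt_self hr))
    have := injective_rotate hg (hb hd).1
    rwa [← rotate_mul, (transpose_mem_special hg).2.2, rotate_one] at this
  · obtain ⟨g, hg, -, hd⟩ := exists_rotate_dist_lt (hw.trans_lt (half_lt_self hr))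
    have hg' := (transpose_mem_special hg).1
    obtain ⟨k, hk, he⟩ := (hb hd).2 (by rw [(com_rotate _ _ _).1, h1, map_zero])
      (by rw [(com_rotate _ _ _).2, h2, map_zero])
      (by rw [deviation_rotate (mem_orthogonal_of_special hg'), h3])
    refine Metric.infDist_zero_of_mem ⟨(k * g.transpose).transpose,
      (transpose_mem_special (mul_mem hk hg')).1, ?_⟩
    rw [← he, ← rotate_mul k, ← rotate_mul, (transpose_mem_special (mul_mem hk hg')).2.1, rotate_one]

lemma continuous_com (m : Fin 3 → ℝ) : Continuous (com m) := by
  have : com m = comCLM m := funext fun r => (comCLM_apply m r).symm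
  rw [this]; exact (comCLM m).continuous

lemma isBounded_infDist_le (z₀ : State) (r : ℝ) :
    Bornology.IsBounded {w | Metric.infDist w (rotationOrbit z₀) ≤ r} := by
  refine (Metric.isBounded_iff_subset_closedBall 0).2 ⟨r + 1 + ‖z₀‖, fun w hw => ?_⟩
  obtain ⟨g, hg, hd, -⟩ := exists_rotate_dist_lt (lt_of_le_of_lt hw (lt_add_one r))
  rw [mem_closedBall_zero_iff]
  have h1 := norm_sub_norm_le w (rotate g z₀)
  rw [norm_rotate (mem_orthogonal_of_special hg), ← dist_eq_norm] at h1
  linarith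

lemma deviation_nonneg (m : Fin 3 → ℝ) (z₀ z : State) : 0 ≤ deviation m z₀ z := by
  unfold deviation; positivity

/-- The centred states on the boundary of the tube form a compact set, bounded because rotations
preserve norms. The deviation is continuous there, and by rigidity it does not vanish, so it has a
positive minimum. -/
lemma exists_gap {m : Fin 3 → ℝ} {z₀ : State} {ε : ℝ} (hε : 0 < ε)
    (h1 : ∀ w, Metric.infDist w (rotationOrbit z₀) ≤ ε → Function.Injective w.1)
    (h2 : ∀ w : State, Metric.infDist w (rotationOrbit z₀) ≤ ε → com m w.1 = 0 → com m w.2 = 0 →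
      deviation m z₀ w = 0 → Metric.infDist w (rotationOrbit z₀) = 0) :
    ∃ c > 0, ∀ w : State, com m w.1 = 0 → com m w.2 = 0 →
      Metric.infDist w (rotationOrbit z₀) = ε → c ≤ deviation m z₀ w := by
  set K : Set State := {w | com m w.1 = 0 ∧ com m w.2 = 0 ∧
    Metric.infDist w (rotationOrbit z₀) = ε} with hK
  have hcl : IsClosed K :=
    ((isClosed_eq ((continuous_com m).comp continuous_fst) continuous_const).inter
      ((isClosed_eq ((continuous_com m).comp continuous_snd) continuous_const).inter
        (isClosed_eq (Metric.continuous_infDist_pt _) continuous_const)))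
  have hcomp : IsCompact K := Metric.isCompact_of_isClosed_isBounded hcl
    ((isBounded_infDist_le z₀ ε).subset fun w hw => hw.2.2.le)
  rcases K.eq_empty_or_nonempty with he | hne
  · exact ⟨1, one_pos, fun w a b c => absurd (show w ∈ K from ⟨a, b, c⟩) (by simp [he])⟩
  · obtain ⟨w₀, hw₀, hmin⟩ := hcomp.exists_isMinOn hne (f := deviation m z₀) fun w hw =>
      (continuousAt_deviation m z₀ (h1 w hw.2.2.le)).continuousWithinAt
    refine ⟨deviation m z₀ w₀, lt_of_le_of_ne (deviation_nonneg _ _ _) fun h0 => ?_,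
      fun w a b c => hmin ⟨a, b, c⟩⟩
    have := h2 w₀ hw₀.2.2.le hw₀.1 hw₀.2.1 h0.symm
    rw [hw₀.2.2] at this
    exact hε.ne' this

lemma continuous_centred (m : Fin 3 → ℝ) : Continuous (centred m) := by
  have := continuous_com m
  unfold centred
  fun_prop

lemma centred_eq_self {m : Fin 3 → ℝ} {z : State} (h1 : com m z.1 = 0) (h2 : com m z.2 = 0) :
    centred m z = z := by
  ext i : 2 <;> simp [centred, h1, h2]

lemma com_sub_const {m : Fin 3 → ℝ} (hm : ∀ i, 0 < m i) (r : Fin 3 → E4) (c : E4) :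
    com m (fun i => r i - c) = com m r - c := by
  have hs : ∑ i, m i ≠ 0 := (Finset.sum_pos (fun i _ => hm i) Finset.univ_nonempty).ne'
  simp only [com, smul_sub, Finset.sum_sub_distrib, ← Finset.sum_smul]
  rw [smul_smul, inv_mul_cancel₀ hs, one_smul]

lemma com_centred {m : Fin 3 → ℝ} (hm : ∀ i, 0 < m i) (z : State) :
    com m (centred m z).1 = 0 ∧ com m (centred m z).2 = 0 := by
  simp [centred, com_sub_const hm]

lemma accel_add_const (m : Fin 3 → ℝ) (r : Fin 3 → E4) (c : E4) :
    accel m (fun i => r i + c) = accel m r := by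
  funext i
  simp [accel]

lemma IsSolutionOn.hasDerivAt_centred {m : Fin 3 → ℝ} {z : ℝ → State}
    {s : Set ℝ} (h : IsSolutionOn m z s) {t : ℝ} (ht : t ∈ s) :
    HasDerivAt (fun t => centred m (z t)) ((1 : ℝ) • newtonField m (centred m (z t))) t := by
  have h1 : HasDerivAt z ((1 : ℝ) • newtonField m (z t)) t := by
    rw [one_smul]; exact (h t ht).2
  obtain ⟨hr, hv⟩ := hasDerivAt_state h1
  obtain ⟨c1, c2⟩ := hasDerivAt_com h1
  have e : accel m (centred m (z t)).1 = accel m (z t).1 := by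
    simpa [sub_eq_add_neg, centred] using accel_add_const m (z t).1 (-com m (z t).1)
  rw [one_smul, newtonField, e]
  refine (hasDerivAt_pi.2 fun i => ((hr i).sub c1).congr_deriv ?_).prodMk
    (hasDerivAt_pi.2 fun i => ((hv i).sub c2).congr_deriv ?_)
  · simp [newtonField, centred]
  · simp [newtonField]

/-- Galilean invariance; it restores the motion of the centre of mass to a solution constructed in
the centred frame. -/
lemma IsSolutionOn.add_drift {m : Fin 3 → ℝ} {z : ℝ → State} {s : Set ℝ}
    (h : IsSolutionOn m z s) (c d : E4) :
    IsSolutionOn m (fun t => (fun i => (z t).1 i + (c + t • d), fun i => (z t).2 i + d)) s := by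
  intro t ht
  obtain ⟨hi, hd⟩ := h t ht
  obtain ⟨hr, hv⟩ := hasDerivAt_state hd
  refine ⟨fun i j hij => hi (by simpa using hij), ?_⟩
  rw [accel_add_const]
  have hl : HasDerivAt (fun t : ℝ => c + t • d) d t := by
    simpa using ((hasDerivAt_id t).smul_const d).const_add c
  exact (hasDerivAt_pi.2 fun i => (hr i).add hl).prodMk (hasDerivAt_pi.2 fun i => (hv i).add_const d)

/-- Centred rigid states are Lyapunov stable. -/
theorem IsRigid.isLyapunovStable {m : Fin 3 → ℝ} (hm : ∀ i, 0 < m i) {z₀ : State}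
    (hinj : Function.Injective z₀.1) (hcom : com m z₀.1 = 0) (hcom' : com m z₀.2 = 0)
    (h : IsRigid m z₀) : IsLyapunovStable m z₀ := by
  obtain ⟨r, hr, hr1, hr2⟩ := h.exists_radius hinj
  intro ε₀ hε₀
  -- A radius strictly below r leaves room for the cutoff function between the closed ε-tube and the
  -- open r-tube.
  set ε := min ε₀ (r / 2) with hεdef
  have hε : 0 < ε := lt_min hε₀ (half_pos hr)
  have hεr : ε < r := (min_le_right _ _).trans_lt (half_lt_self hr)
  have h1 : ∀ w, Metric.infDist w (rotationOrbit z₀) ≤ ε → Function.Injective w.1 :=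
    fun w hw => hr1 w (hw.trans hεr.le)
  obtain ⟨c, hc, hgap⟩ := exists_gap hε h1 fun w hw => hr2 w (hw.trans hεr.le)
  have hz₀ : centred m z₀ = z₀ := centred_eq_self hcom hcom'
  have hev : ∀ᶠ w in 𝓝 z₀, Metric.infDist (centred m w) (rotationOrbit z₀) < ε ∧
      deviation m z₀ (centred m w) < c := by
    have hcc := (continuous_centred m).tendsto z₀
    rw [hz₀] at hcc
    refine hcc.eventually (p := fun w => Metric.infDist w (rotationOrbit z₀) < ε ∧
      deviation m z₀ w < c) ((((Metric.continuous_infDist_pt _).continuousAt.eventually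
        (gt_mem_nhds ?_))).and ((continuousAt_deviation m z₀ hinj).eventually (gt_mem_nhds ?_)))
    · change Metric.infDist z₀ _ < ε
      rwa [Metric.infDist_zero_of_mem (self_mem_rotationOrbit z₀)]
    · simpa [deviation] using hc
  obtain ⟨δ, hδ, hb⟩ := Metric.eventually_nhds_iff.1 hev
  refine ⟨δ, hδ, fun w hw => ⟨?_, fun z a b ha hb' hz0 hz t ht => ?_⟩⟩
  · obtain ⟨hw1, hw2⟩ := hb hw
    -- A global solution of the cut-off field never leaves the ε-tube, where the cutoff is 1;
    -- therefore it solves Newton's equations for all times.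
    obtain ⟨f, hf1, hf⟩ := exists_cutoff_global_solution (V := newtonField m)
      (K := {w | Metric.infDist w (rotationOrbit z₀) ≤ ε})
      (N := {w | Metric.infDist w (rotationOrbit z₀) < r})
      (isOpen_lt (Metric.continuous_infDist_pt _) continuous_const)
      ((isBounded_infDist_le z₀ r).subset fun w (hw : _ < r) => hw.le)
      (isClosed_le (Metric.continuous_infDist_pt _) continuous_const)
      (fun w hw => lt_of_le_of_lt hw hεr)
      (fun w hw => contDiffAt_newtonField m (hr1 w (le_of_lt hw)))
    obtain ⟨z, hz0, hz⟩ := hf (centred m w)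
    have hstay := infDist_lt_of_deviation_lt isOpen_univ isPreconnected_univ h1 hgap
      (z := z) (φ := fun t => f (z t)) (fun t _ => hz t) (t₀ := 0) trivial
      (by rw [hz0]; exact (com_centred hm w).1) (by rw [hz0]; exact (com_centred hm w).2)
      (by rw [hz0]; exact hw1) (by rw [hz0]; exact hw2)
    have hsol : IsSolutionOn m z Set.univ := fun t _ => by
      have ht := (hstay t trivial).le
      refine ⟨h1 _ ht, ?_⟩
      have := hz t
      rwa [hf1 _ ht, one_smul] at this
    refine ⟨_, ?_, hsol.add_drift (com m w.1) (com m w.2)⟩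
    simp only [hz0, zero_smul, add_zero]
    ext i : 2 <;> simp [centred]
  · obtain ⟨hw1, hw2⟩ := hb hw
    have hstay := infDist_lt_of_deviation_lt isOpen_Ioo isPreconnected_Ioo h1 hgap
      (z := fun t => centred m (z t)) (φ := fun _ => 1)
      (fun t ht => hz.hasDerivAt_centred ht) (t₀ := 0) ⟨ha, hb'⟩
      (by rw [hz0]; exact (com_centred hm w).1) (by rw [hz0]; exact (com_centred hm w).2)
      (by rw [hz0]; exact hw1) (by rw [hz0]; exact hw2) t ht
    obtain ⟨g, hg, hd, -⟩ := exists_rotate_dist_lt hstay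
    exact ⟨g, hg, by rw [hz₀]; exact hd.trans_le (min_le_left _ _)⟩

lemma IsLyapunovStable.hasBallOfBoundedOrbits {m : Fin 3 → ℝ} {z₀ : State}
    (h : IsLyapunovStable m z₀) : HasBallOfBoundedOrbits m z₀ := by
  obtain ⟨δ, hδ, hb⟩ := h 1 one_pos
  refine ⟨δ, hδ, 1 + ‖centred m z₀‖, fun z a b ha hb' hd hz t ht => ?_⟩
  obtain ⟨g, hg, hlt⟩ := (hb (z 0) hd).2 z a b ha hb' rfl hz t ht
  have := norm_sub_norm_le (centred m (z t)) (rotate g (centred m z₀))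
  rw [norm_rotate (mem_orthogonal_of_special hg), ← dist_eq_norm] at this
  linarith

/-! ### Jacobi vectors -/

/-- The Jacobi vector of the pair. -/
def jacobi₁ (r : Fin 3 → E4) : E4 := r 1 - r 2

/-- The Jacobi vector of body `0`. -/
def jacobi₂ (m : Fin 3 → ℝ) (r : Fin 3 → E4) : E4 :=
  r 0 - ((m 1 / (m 1 + m 2)) • r 1 + (m 2 / (m 1 + m 2)) • r 2)

lemma fromJacobi_sub {m : Fin 3 → ℝ} (hm : ∀ i, 0 < m i) (x₁ x₂ : E4) :
    fromJacobi m x₁ x₂ 1 - fromJacobi m x₁ x₂ 2 = x₁ ∧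
    fromJacobi m x₁ x₂ 0 - fromJacobi m x₁ x₂ 2 = x₂ + (m 1 / (m 1 + m 2)) • x₁ ∧
    fromJacobi m x₁ x₂ 0 - fromJacobi m x₁ x₂ 1 = x₂ - (m 2 / (m 1 + m 2)) • x₁ := by
  have := hm 0
  have := hm 1
  have := hm 2
  have h1 : m 1 + m 2 ≠ 0 := by positivity
  have h2 : m 0 + m 1 + m 2 ≠ 0 := by positivity
  simp only [fromJacobi, Matrix.cons_val]
  refine ⟨?_, ?_, ?_⟩ <;> match_scalars <;> field_simp <;> ring

lemma com_fromJacobi {m : Fin 3 → ℝ} (hm : ∀ i, 0 < m i) (x₁ x₂ : E4) :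
    com m (fromJacobi m x₁ x₂) = 0 := by
  have := hm 0
  have := hm 1
  have := hm 2
  have h1 : m 1 + m 2 ≠ 0 := by positivity
  have h2 : m 0 + m 1 + m 2 ≠ 0 := by positivity
  rw [com, Fin.sum_univ_three (fun i => m i • fromJacobi m x₁ x₂ i)]
  refine smul_eq_zero_of_right _ ?_
  simp only [fromJacobi, Matrix.cons_val]
  match_scalars <;> field_simp <;> ring

lemma fromJacobi_jacobi {m : Fin 3 → ℝ} (hm : ∀ i, 0 < m i) {r : Fin 3 → E4}
    (hr : com m r = 0) : fromJacobi m (jacobi₁ r) (jacobi₂ m r) = r := by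
  have := hm 0
  have := hm 1
  have := hm 2
  have h1 : m 1 + m 2 ≠ 0 := by positivity
  have h2 : m 0 + m 1 + m 2 ≠ 0 := by positivity
  have h0 : m 0 • r 0 + m 1 • r 1 + m 2 • r 2 = 0 := by
    rw [com, Fin.sum_univ_three (fun i => m i • r i)] at hr
    refine (smul_eq_zero.1 hr).resolve_left (inv_ne_zero ?_)
    rwa [Fin.sum_univ_three]
  have e : r 0 = -((m 1 / m 0) • r 1 + (m 2 / m 0) • r 2) := by
    have : m 0 • r 0 = -(m 1 • r 1 + m 2 • r 2) := by
      rw [eq_neg_iff_add_eq_zero, ← add_assoc]; exact h0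
    rw [← inv_smul_smul₀ (hm 0).ne' (r 0), this]
    module
  funext i
  fin_cases i <;> simp only [fromJacobi, jacobi₁, jacobi₂, Matrix.cons_val, Fin.zero_eta, Fin.mk_one,
    Fin.reduceFinMk] <;> rw [e] <;> match_scalars <;> field_simp <;> ring

lemma jacobi_fromJacobi {m : Fin 3 → ℝ} (hm : ∀ i, 0 < m i) (x₁ x₂ : E4) :
    jacobi₁ (fromJacobi m x₁ x₂) = x₁ ∧ jacobi₂ m (fromJacobi m x₁ x₂) = x₂ := by
  have := hm 0
  have := hm 1
  have := hm 2
  have h1 : m 1 + m 2 ≠ 0 := by positivity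
  have h2 : m 0 + m 1 + m 2 ≠ 0 := by positivity
  refine ⟨(fromJacobi_sub hm x₁ x₂).1, ?_⟩
  simp only [jacobi₂, fromJacobi, Matrix.cons_val]
  match_scalars <;> field_simp <;> ring

lemma norm_sq_fromJacobi {m : Fin 3 → ℝ} (hm : ∀ i, 0 < m i) (x₁ x₂ : E4) :
    m 0 * ‖fromJacobi m x₁ x₂ 0‖ ^ 2 + m 1 * ‖fromJacobi m x₁ x₂ 1‖ ^ 2 +
      m 2 * ‖fromJacobi m x₁ x₂ 2‖ ^ 2 = nu₁ m * ‖x₁‖ ^ 2 + nu₂ m * ‖x₂‖ ^ 2 := by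
  have := hm 0
  have := hm 1
  have := hm 2
  have h1 : m 1 + m 2 ≠ 0 := by positivity
  have h2 : m 0 + m 1 + m 2 ≠ 0 := by positivity
  simp only [fromJacobi, Matrix.cons_val, norm_add_sq_real, norm_sub_sq_real, norm_smul, norm_neg,
    inner_smul_left, inner_smul_right, inner_neg_left, mul_pow, Real.norm_eq_abs, sq_abs, neg_smul,
    conj_trivial, nu₁, nu₂]
  field_simp
  ring

lemma angularMomentum_fromJacobi {m : Fin 3 → ℝ} (hm : ∀ i, 0 < m i) (x₁ x₂ w₁ w₂ : E4)
    (a b : Fin 4) : angularMomentum m (fromJacobi m x₁ x₂, fromJacobi m w₁ w₂) a b =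
      nu₁ m * (x₁ a * w₁ b - w₁ a * x₁ b) + nu₂ m * (x₂ a * w₂ b - w₂ a * x₂ b) := by
  have := hm 0
  have := hm 1
  have := hm 2
  have h1 : m 1 + m 2 ≠ 0 := by positivity
  have h2 : m 0 + m 1 + m 2 ≠ 0 := by positivity
  simp only [angularMomentum, Matrix.of_apply, Fin.sum_univ_three (fun i => m i * _), fromJacobi,
    Matrix.cons_val, PiLp.smul_apply, PiLp.sub_apply, PiLp.add_apply, smul_eq_mul, nu₁, nu₂]
  field_simp
  ring

/-- Newton's equations decouple in Jacobi vectors into νᵢ ẍᵢ = -∂V/∂xᵢ, where by the chain rule the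
gradients are combinations of x₁ and x₂ with the coefficients `force₁`, `force₂`, `force₃`. -/
lemma accel_fromJacobi {m : Fin 3 → ℝ} (hm : ∀ i, 0 < m i) {x₁ x₂ : E4} {i₁ i₂ i₃ : ℝ}
    (h₁ : 1 / ‖x₁‖ ^ 3 = i₁) (h₂ : 1 / ‖x₂ + (m 1 / (m 1 + m 2)) • x₁‖ ^ 3 = i₂)
    (h₃ : 1 / ‖x₂ - (m 2 / (m 1 + m 2)) • x₁‖ ^ 3 = i₃) :
    accel m (fromJacobi m x₁ x₂) =
      let f₁ := m 1 * m 2 * i₁ + (m 0 * m 2 * (m 1 / (m 1 + m 2)) ^ 2 * i₂ +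
        m 0 * m 1 * (m 2 / (m 1 + m 2)) ^ 2 * i₃)
      let f₂ := m 0 * m 2 * i₂ + m 0 * m 1 * i₃
      let f₃ := m 0 * m 1 * m 2 / (m 1 + m 2) * (i₂ - i₃)
      fromJacobi m (-(nu₁ m)⁻¹ • (f₁ • x₁ + f₃ • x₂)) (-(nu₂ m)⁻¹ • (f₂ • x₂ + f₃ • x₁)) := by
  have p0 := hm 0
  have p1 := hm 1
  have p2 := hm 2
  have e1 : m 1 + m 2 ≠ 0 := by positivity
  have e2 : m 0 + m 1 + m 2 ≠ 0 := by positivity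
  obtain ⟨s1, s2, s3⟩ := fromJacobi_sub hm x₁ x₂
  obtain ⟨a0, a1, a2⟩ := accel_apply m (fromJacobi m x₁ x₂)
  have d1 : ∀ c : ℝ, c / ‖x₁‖ ^ 3 = c * i₁ := fun c => by rw [← h₁]; ring
  have d2 : ∀ c : ℝ, c / ‖x₂ + (m 1 / (m 1 + m 2)) • x₁‖ ^ 3 = c * i₂ := fun c => by
    rw [← h₂]; ring
  have d3 : ∀ c : ℝ, c / ‖x₂ - (m 2 / (m 1 + m 2)) • x₁‖ ^ 3 = c * i₃ := fun c => by
    rw [← h₃]; ring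
  simp only [s1, s2, s3, d1, d2, d3] at a0 a1 a2
  funext i
  have n1 : (nu₁ m)⁻¹ = (m 1 + m 2) / (m 1 * m 2) := by rw [nu₁, inv_div]
  have n2 : (nu₂ m)⁻¹ = (m 0 + m 1 + m 2) / (m 0 * (m 1 + m 2)) := by rw [nu₂, inv_div]
  fin_cases i <;> simp only [Fin.zero_eta, Fin.mk_one, Fin.reduceFinMk, a0, a1, a2] <;>
    simp only [fromJacobi, Matrix.cons_val, n1, n2] <;> match_scalars <;> field_simp <;> ring

/-! ### The states described by the reduced phase space -/

lemma norm_vec (a b c d : ℝ) : ‖(!₂[a, b, c, d] : E4)‖ ^ 2 = a ^ 2 + b ^ 2 + c ^ 2 + d ^ 2 := by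
  rw [EuclideanSpace.norm_sq_eq, Fin.sum_univ_four]
  simp

lemma norm_config (m : Fin 3 → ℝ) (q : Fin 4 → ℝ) :
    ‖(!₂[q 0, q 1, 0, 0] : E4)‖ = √(inv₁ q) ∧
    ‖(!₂[q 2, q 3, 0, 0] : E4) + (m 1 / (m 1 + m 2)) • (!₂[q 0, q 1, 0, 0] : E4)‖ =
      √(distSq₂ m (inv₁ q) (inv₂ q) (inv₃ q)) ∧
    ‖(!₂[q 2, q 3, 0, 0] : E4) - (m 2 / (m 1 + m 2)) • (!₂[q 0, q 1, 0, 0] : E4)‖ =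
      √(distSq₃ m (inv₁ q) (inv₂ q) (inv₃ q)) := by
  refine ⟨?_, ?_, ?_⟩ <;> rw [EuclideanSpace.norm_eq, Fin.sum_univ_four] <;> congr 1 <;>
    simp [inv₁, inv₂, inv₃, distSq₂, distSq₃] <;> ring

/-- The out-of-plane components of the momenta have squared norms q₃²B² + q₄²C² and q₁²B² + q₂²C²,
which are the two values of `fRed`. -/
lemma energy_liftState {m : Fin 3 → ℝ} (hm : ∀ i, 0 < m i) (μ₁ μ₂ : ℝ)
    (ζ : (Fin 4 → ℝ) × (Fin 4 → ℝ)) :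
    energy m (liftState m μ₁ μ₂ ζ) = reducedHamiltonian m μ₁ μ₂ ζ := by
  have n1 := nu₁_pos hm
  have n2 := nu₂_pos hm
  obtain ⟨q, p⟩ := ζ
  obtain ⟨h1, h2, h3⟩ := norm_config m q
  simp only [energy, liftState, fromJacobi_sub hm, norm_sq_fromJacobi hm, norm_smul, mul_pow,
    norm_vec, h1, h2, h3, reducedHamiltonian, potential, fRed, Real.norm_eq_abs, sq_abs]
  have e2 : distSq₂ m (inv₁ q) (inv₂ q) (inv₃ q) = (m 1 / (m 1 + m 2)) ^ 2 * (q 0 ^ 2 + q 1 ^ 2) +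
      2 * (m 1 / (m 1 + m 2)) * (q 0 * q 2 + q 1 * q 3) + (q 2 ^ 2 + q 3 ^ 2) := rfl
  have e3 : distSq₃ m (inv₁ q) (inv₂ q) (inv₃ q) = (m 2 / (m 1 + m 2)) ^ 2 * (q 0 ^ 2 + q 1 ^ 2) -
      2 * (m 2 / (m 1 + m 2)) * (q 0 * q 2 + q 1 * q 3) + (q 2 ^ 2 + q 3 ^ 2) := rfl
  rw [← e2, ← e3, show q 0 ^ 2 + q 1 ^ 2 = inv₁ q from rfl]
  have k1 : nu₁ m * (nu₁ m)⁻¹ ^ 2 = 1 / nu₁ m := by field_simp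
  have k2 : nu₂ m * (nu₂ m)⁻¹ ^ 2 = 1 / nu₂ m := by field_simp
  rw [← mul_assoc, ← mul_assoc, k1, k2]
  ring

/-- The out-of-plane momenta are made such that the mixed block is antidiagonal. Its entries satisfy
bc = (Ls² - Ld²)/4 = μ₁μ₂ and, when |l| ≤ μ₁ - μ₂, b² + c² + l² = μ₁² + μ₂², as the prescribed
eigenvalues require. -/
lemma angularMomentum_liftState {m : Fin 3 → ℝ} (hm : ∀ i, 0 < m i) (μ₁ μ₂ : ℝ) {q p : Fin 4 → ℝ}
    (hq : jac q ≠ 0) : angularMomentum m (liftState m μ₁ μ₂ (q, p)) =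
      let l := L₃ q p
      let b := (Ls μ₁ μ₂ l - Ld μ₁ μ₂ l) / 2
      let c := (Ls μ₁ μ₂ l + Ld μ₁ μ₂ l) / 2
      !![0, l, 0, b; -l, 0, c, 0; 0, -c, 0, 0; -b, 0, 0, 0] := by
  have n1 := nu₁_pos hm
  have n2 := nu₂_pos hm
  have hD : area q = jac q / 2 := rfl
  set l := L₃ q p with hl'
  set b : ℝ := (Ls μ₁ μ₂ l - Ld μ₁ μ₂ l) / 2 with hb
  set c : ℝ := (Ls μ₁ μ₂ l + Ld μ₁ μ₂ l) / 2 with hc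
  change _ = !![0, l, 0, b; -l, 0, c, 0; 0, -c, 0, 0; -b, 0, 0, 0]
  simp only [liftState, ← hl']
  have hB : -(Ls μ₁ μ₂ l + Ld μ₁ μ₂ l) / (4 * area q) * (q 0 * q 3 - q 1 * q 2) = -c := by
    change _ * jac q = _
    rw [hD, hc]; field_simp; norm_num
  have hC : -(Ls μ₁ μ₂ l - Ld μ₁ μ₂ l) / (4 * area q) * (q 0 * q 3 - q 1 * q 2) = -b := by
    change _ * jac q = _
    rw [hD, hb]; field_simp; norm_num
  have hl : l = q 0 * p 1 - q 1 * p 0 + q 2 * p 3 - q 3 * p 2 := rfl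
  generalize -(Ls μ₁ μ₂ l + Ld μ₁ μ₂ l) / (4 * area q) = B at *
  generalize -(Ls μ₁ μ₂ l - Ld μ₁ μ₂ l) / (4 * area q) = C at *
  clear_value b c l
  clear hl'
  ext i j
  rw [angularMomentum_fromJacobi hm]
  fin_cases i <;> fin_cases j <;> simp <;> field_simp <;>
    first | done | ring1 | linear_combination hl | linear_combination -hl | linear_combination hB |
      linear_combination -hB | linear_combination hC | linear_combination -hC

lemma com_liftState {m : Fin 3 → ℝ} (hm : ∀ i, 0 < m i) (μ₁ μ₂ : ℝ)
    (ζ : (Fin 4 → ℝ) × (Fin 4 → ℝ)) :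
    com m (liftState m μ₁ μ₂ ζ).1 = 0 ∧ com m (liftState m μ₁ μ₂ ζ).2 = 0 :=
  ⟨com_fromJacobi hm _ _, com_fromJacobi hm _ _⟩

lemma injective_liftState {m : Fin 3 → ℝ} (hm : ∀ i, 0 < m i) (μ₁ μ₂ : ℝ) {q p : Fin 4 → ℝ}
    (hq : jac q ≠ 0) : Function.Injective (liftState m μ₁ μ₂ (q, p)).1 := by
  obtain ⟨h1, h2, h3⟩ := norm_config m q
  obtain ⟨s1, s2, s3⟩ := fromJacobi_sub hm !₂[q 0, q 1, 0, 0] !₂[q 2, q 3, 0, 0]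
  rw [← s1] at h1
  rw [← s2] at h2
  rw [← s3] at h3
  have d1 : fromJacobi m !₂[q 0, q 1, 0, 0] !₂[q 2, q 3, 0, 0] 1 ≠
      fromJacobi m !₂[q 0, q 1, 0, 0] !₂[q 2, q 3, 0, 0] 2 := by
    rw [← sub_ne_zero, ← norm_ne_zero_iff, h1]; exact (Real.sqrt_pos.2 (inv₁_pos hq)).ne'
  have d2 : fromJacobi m !₂[q 0, q 1, 0, 0] !₂[q 2, q 3, 0, 0] 0 ≠
      fromJacobi m !₂[q 0, q 1, 0, 0] !₂[q 2, q 3, 0, 0] 2 := by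
    rw [← sub_ne_zero, ← norm_ne_zero_iff, h2]; exact (Real.sqrt_pos.2 (distSq₂_pos m hq)).ne'
  have d3 : fromJacobi m !₂[q 0, q 1, 0, 0] !₂[q 2, q 3, 0, 0] 0 ≠
      fromJacobi m !₂[q 0, q 1, 0, 0] !₂[q 2, q 3, 0, 0] 1 := by
    rw [← sub_ne_zero, ← norm_ne_zero_iff, h3]; exact (Real.sqrt_pos.2 (distSq₃_pos m hq)).ne'
  intro i j hij
  simp only [liftState] at hij
  fin_cases i <;> fin_cases j <;> first
    | rfl
    | exact absurd hij d1
    | exact absurd hij d2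
    | exact absurd hij d3
    | exact absurd hij d1.symm
    | exact absurd hij d2.symm
    | exact absurd hij d3.symm

/-! ### Relative equilibria -/

section Exponential

attribute [local instance] Matrix.linftyOpNormedRing Matrix.linftyOpNormedAlgebra

lemma hasDerivAt_exp_toEuclideanLin (ξ : Matrix (Fin 4) (Fin 4) ℝ) (x : E4) (t : ℝ) :
    HasDerivAt (fun t : ℝ => Matrix.toEuclideanLin (NormedSpace.exp (t • ξ)) x)
      (Matrix.toEuclideanLin (NormedSpace.exp (t • ξ)) (Matrix.toEuclideanLin ξ x)) t := by
  have h := hasDerivAt_exp_smul_const ξ t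
  let L : Matrix (Fin 4) (Fin 4) ℝ →ₗ[ℝ] E4 :=
    { toFun := fun g => Matrix.toEuclideanLin g x
      map_add' := fun g h => by simp
      map_smul' := fun c g => by simp }
  have h2 := (LinearMap.toContinuousLinearMap L).hasFDerivAt.comp_hasDerivAt t h
  refine h2.congr_deriv ?_
  change Matrix.toEuclideanLin (NormedSpace.exp (t • ξ) * ξ) x = _
  simp [toEuclideanLin_eq]

end Exponential

lemma exp_smul_mem_orthogonal {ξ : Matrix (Fin 4) (Fin 4) ℝ} (hξ : ξ.transpose = -ξ) (t : ℝ) :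
    NormedSpace.exp (t • ξ) ∈ Matrix.orthogonalGroup (Fin 4) ℝ := by
  rw [Matrix.mem_orthogonalGroup_iff, ← Matrix.exp_transpose, Matrix.transpose_smul, hξ,
    smul_neg, Matrix.exp_neg]
  exact Matrix.mul_nonsing_inv _ ((Matrix.isUnit_iff_isUnit_det _).1 (Matrix.isUnit_exp _))

/-- A state whose velocities and accelerations are those of a rotation is a relative
equilibrium. -/
theorem isRelativeEquilibrium_of_rotation {m : Fin 3 → ℝ} {z₀ : State}
    {ξ : Matrix (Fin 4) (Fin 4) ℝ} (hξ : ξ.transpose = -ξ) (hinj : Function.Injective z₀.1)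
    (hv : ∀ i, z₀.2 i = Matrix.toEuclideanLin ξ (z₀.1 i))
    (ha : ∀ i, accel m z₀.1 i = Matrix.toEuclideanLin ξ (z₀.2 i)) : IsRelativeEquilibrium m z₀ := by
  refine ⟨ξ, hξ, fun t _ => ⟨fun i j hij => hinj ?_, ?_⟩⟩
  · have h := norm_toEuclideanLin (exp_smul_mem_orthogonal hξ t) (z₀.1 i - z₀.1 j)
    have h0 : Matrix.toEuclideanLin (NormedSpace.exp (t • ξ)) (z₀.1 i) =
      Matrix.toEuclideanLin (NormedSpace.exp (t • ξ)) (z₀.1 j) := hij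
    rw [map_sub, h0, sub_self, norm_zero] at h
    exact sub_eq_zero.1 (norm_eq_zero.1 h.symm)
  · refine HasDerivAt.prodMk (hasDerivAt_pi.2 fun i => ?_) (hasDerivAt_pi.2 fun i => ?_)
    · rw [rotate_snd, hv]
      exact hasDerivAt_exp_toEuclideanLin ξ _ t
    · rw [accel_rotate (exp_smul_mem_orthogonal hξ t), ha]
      exact hasDerivAt_exp_toEuclideanLin ξ _ t

lemma map_fromJacobi (m : Fin 3 → ℝ) (f : E4 →ₗ[ℝ] E4) (x₁ x₂ : E4) (i : Fin 3) :
    f (fromJacobi m x₁ x₂ i) = fromJacobi m (f x₁) (f x₂) i := by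
  fin_cases i <;> simp [fromJacobi]

/-- Critical points of the reduced Hamiltonian with vanishing momenta describe relative
equilibria. -/
theorem isRelativeEquilibrium_liftState {m : Fin 3 → ℝ} (hm : ∀ i, 0 < m i) {μ₁ μ₂ : ℝ}
    (h2 : 0 < μ₂) (h12 : μ₂ < μ₁) {q : Fin 4 → ℝ} (hq : jac q ≠ 0)
    (hcrit : effGrad m μ₁ μ₂ q = 0) : IsRelativeEquilibrium m (liftState m μ₁ μ₂ (q, 0)) := by
  have n1 := nu₁_pos hm
  have n2 := nu₂_pos hm
  have h1 : 0 < μ₁ := h2.trans h12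
  have hrot := effGrad_rotation hm μ₁ μ₂ hq
  simp only [hcrit, Pi.zero_apply, mul_zero, sub_zero, add_zero] at hrot
  have hΔ : μ₁ ^ 2 - μ₂ ^ 2 ≠ 0 := by
    have : 0 < μ₁ ^ 2 - μ₂ ^ 2 := by nlinarith
    exact this.ne'
  -- The rotation identity at a critical point; this is where μ₁ ≠ μ₂ enters.
  have horth : q 2 * q 3 / nu₁ m + q 0 * q 1 / nu₂ m = 0 := by
    have h := hrot.symm
    rw [neg_eq_zero, div_eq_zero_iff, mul_eq_zero] at h
    simpa [hΔ, hq] using h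
  obtain ⟨c0, c1, c2, c3⟩ : effGrad m μ₁ μ₂ q 0 = 0 ∧ effGrad m μ₁ μ₂ q 1 = 0 ∧
      effGrad m μ₁ μ₂ q 2 = 0 ∧ effGrad m μ₁ μ₂ q 3 = 0 := by simp [hcrit]
  set a := q 2 ^ 2 / nu₁ m + q 0 ^ 2 / nu₂ m with ha
  set b := q 3 ^ 2 / nu₁ m + q 1 ^ 2 / nu₂ m with hb
  set D := jac q with hD
  have hDq : D = q 0 * q 3 - q 1 * q 2 := rfl
  -- The orthogonality relation turns each mass-weighted coordinate into a multiple of the partner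
  -- coordinate of the other Jacobi vector; this is what makes the velocities those of a rigid
  -- rotation.
  have r3 : D * q 3 / nu₁ m = q 0 * b := by
    rw [hb, hDq]; linear_combination (-q 1) * horth
  have r2 : D * q 2 / nu₁ m = -(q 1 * a) := by
    rw [ha, hDq]; linear_combination q 0 * horth
  have r1 : D * q 1 / nu₂ m = -(q 2 * b) := by
    rw [hb, hDq]; linear_combination q 3 * horth
  have r0 : D * q 0 / nu₂ m = q 3 * a := by
    rw [ha, hDq]; linear_combination (-q 2) * horth
  -- The rotation takes place in two orthogonal planes, each spanned by one axis of the triangle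
  -- plane and one normal axis. The angular velocities are the eigenvalues μᵢ divided by the
  -- matching moments of inertia D²/a and D²/b.
  set ξ : Matrix (Fin 4) (Fin 4) ℝ :=
    !![0, 0, 0, -(μ₂ * b / D ^ 2); 0, 0, -(μ₁ * a / D ^ 2), 0; 0, μ₁ * a / D ^ 2, 0, 0;
      μ₂ * b / D ^ 2, 0, 0, 0] with hξ
  have s3 : q 3 / nu₁ m = q 0 * b / D := by rw [eq_div_iff hq]; linear_combination r3
  have s2 : q 2 / nu₁ m = -(q 1 * a) / D := by rw [eq_div_iff hq]; linear_combination r2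
  have s1 : q 1 / nu₂ m = -(q 2 * b) / D := by rw [eq_div_iff hq]; linear_combination r1
  have s0 : q 0 / nu₂ m = q 3 * a / D := by rw [eq_div_iff hq]; linear_combination r0
  have hN : kinNum m μ₁ μ₂ q = μ₁ ^ 2 * a + μ₂ ^ 2 * b := rfl
  simp only [effGrad, Matrix.cons_val, hN, ← hD] at c0 c1 c2 c3
  -- With the relations above, one part of the kinetic term cancels in each gradient equation and
  -- the other part is the centripetal acceleration.
  have g0 : force₁ m q * q 0 + force₃ m q * q 2 = μ₂ ^ 2 * b * q 3 / D ^ 3 := by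
    have : μ₁ ^ 2 * q 0 / (nu₂ m * D ^ 2) = μ₁ ^ 2 * (D * q 0 / nu₂ m) / D ^ 3 := by field_simp
    rw [this, r0] at c0
    linear_combination c0
  have g1 : force₁ m q * q 1 + force₃ m q * q 3 = -(μ₁ ^ 2 * a * q 2 / D ^ 3) := by
    have : μ₂ ^ 2 * q 1 / (nu₂ m * D ^ 2) = μ₂ ^ 2 * (D * q 1 / nu₂ m) / D ^ 3 := by field_simp
    rw [this, r1] at c1
    linear_combination c1
  have g2 : force₂ m q * q 2 + force₃ m q * q 0 = -(μ₂ ^ 2 * b * q 1 / D ^ 3) := by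
    have : μ₁ ^ 2 * q 2 / (nu₁ m * D ^ 2) = μ₁ ^ 2 * (D * q 2 / nu₁ m) / D ^ 3 := by field_simp
    rw [this, r2] at c2
    linear_combination c2
  have g3 : force₂ m q * q 3 + force₃ m q * q 1 = μ₁ ^ 2 * a * q 0 / D ^ 3 := by
    have : μ₂ ^ 2 * q 3 / (nu₁ m * D ^ 2) = μ₂ ^ 2 * (D * q 3 / nu₁ m) / D ^ 3 := by field_simp
    rw [this, r3] at c3
    linear_combination c3
  have hB : -(Ls μ₁ μ₂ (L₃ q 0) + Ld μ₁ μ₂ (L₃ q 0)) / (4 * area q) = -(μ₁ / D) := by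
    rw [L₃_zero, Ld_zero h12, Ls_zero h2 h12, show area q = D / 2 from rfl]
    field_simp; ring
  have hC : -(Ls μ₁ μ₂ (L₃ q 0) - Ld μ₁ μ₂ (L₃ q 0)) / (4 * area q) = -(μ₂ / D) := by
    rw [L₃_zero, Ld_zero h12, Ls_zero h2 h12, show area q = D / 2 from rfl]
    field_simp; ring
  have hv1 : (nu₁ m)⁻¹ • (!₂[(0 : Fin 4 → ℝ) 0, (0 : Fin 4 → ℝ) 1,
      q 2 * (-(Ls μ₁ μ₂ (L₃ q 0) + Ld μ₁ μ₂ (L₃ q 0)) / (4 * area q)),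
      -(q 3 * (-(Ls μ₁ μ₂ (L₃ q 0) - Ld μ₁ μ₂ (L₃ q 0)) / (4 * area q)))] : E4) =
      Matrix.toEuclideanLin ξ !₂[q 0, q 1, 0, 0] := by
    rw [hB, hC]
    ext k
    fin_cases k <;> simp [hξ]
    · linear_combination (-μ₁ / D) * s2
    · linear_combination (μ₂ / D) * s3
  have hv2 : (nu₂ m)⁻¹ • (!₂[(0 : Fin 4 → ℝ) 2, (0 : Fin 4 → ℝ) 3,
      -(q 0 * (-(Ls μ₁ μ₂ (L₃ q 0) + Ld μ₁ μ₂ (L₃ q 0)) / (4 * area q))),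
      q 1 * (-(Ls μ₁ μ₂ (L₃ q 0) - Ld μ₁ μ₂ (L₃ q 0)) / (4 * area q))] : E4) =
      Matrix.toEuclideanLin ξ !₂[q 2, q 3, 0, 0] := by
    rw [hB, hC]
    ext k
    fin_cases k <;> simp [hξ]
    · linear_combination (μ₁ / D) * s0
    · linear_combination (-μ₂ / D) * s1
  refine isRelativeEquilibrium_of_rotation (ξ := ξ) ?_ (injective_liftState hm μ₁ μ₂ hq) ?_ ?_
  · ext i j; fin_cases i <;> fin_cases j <;> simp [hξ]
  · intro i
    change fromJacobi m _ _ i = Matrix.toEuclideanLin ξ (fromJacobi m _ _ i)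
    rw [map_fromJacobi]
    exact congrArg₂ (fun x y => fromJacobi m x y i) hv1 hv2
  · intro i
    change accel m (fromJacobi m _ _) i = Matrix.toEuclideanLin ξ (fromJacobi m _ _ i)
    obtain ⟨k1, k2, k3⟩ := norm_config m q
    rw [map_fromJacobi, accel_fromJacobi hm (i₁ := invCube (inv₁ q))
      (i₂ := invCube (distSq₂ m (inv₁ q) (inv₂ q) (inv₃ q)))
      (i₃ := invCube (distSq₃ m (inv₁ q) (inv₂ q) (inv₃ q))) (by rw [k1, invCube])
      (by rw [k2, invCube]) (by rw [k3, invCube])]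
    refine congrArg₂ (fun x y => fromJacobi m x y i) ?_ ?_
    · rw [hv1]
      change -(nu₁ m)⁻¹ • (force₁ m q • (!₂[q 0, q 1, 0, 0] : E4) +
        force₃ m q • (!₂[q 2, q 3, 0, 0] : E4)) = _
      ext k
      fin_cases k <;> simp [toEuclideanLin_eq, dotProduct, Fin.sum_univ_four, hξ]
      · linear_combination (-(nu₁ m)⁻¹) * g0 - μ₂ ^ 2 * b / D ^ 3 * s3
      · linear_combination (-(nu₁ m)⁻¹) * g1 + μ₁ ^ 2 * a / D ^ 3 * s2
    · rw [hv2]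
      change -(nu₂ m)⁻¹ • (force₂ m q • (!₂[q 2, q 3, 0, 0] : E4) +
        force₃ m q • (!₂[q 0, q 1, 0, 0] : E4)) = _
      ext k
      fin_cases k <;> simp [toEuclideanLin_eq, dotProduct, Fin.sum_univ_four, hξ]
      · linear_combination (-(nu₂ m)⁻¹) * g2 + μ₂ ^ 2 * b / D ^ 3 * s1
      · linear_combination (-(nu₂ m)⁻¹) * g3 - μ₁ ^ 2 * a / D ^ 3 * s0

lemma charpoly_antidiagonal (b c : ℝ) :
    (!![0, 0, 0, b; 0, 0, c, 0; 0, -c, 0, 0; -b, 0, 0, 0] : Matrix (Fin 4) (Fin 4) ℝ).charpoly =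
      (Polynomial.X ^ 2 + Polynomial.C (c ^ 2)) * (Polynomial.X ^ 2 + Polynomial.C (b ^ 2)) := by
  rw [Matrix.charpoly, Matrix.det_succ_row_zero]
  simp [Fin.sum_univ_succ, Matrix.det_fin_three, Matrix.charmatrix_apply, Fin.succAbove]
  ring

/-! ### Householder transformations -/

/-- The reflection in the hyperplane orthogonal to `w`. -/
def householder (w : Fin 4 → ℝ) : Matrix (Fin 4) (Fin 4) ℝ :=
  1 - (2 / (w ⬝ᵥ w)) • Matrix.vecMulVec w w

lemma householder_mulVec (w x : Fin 4 → ℝ) :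
    (householder w).mulVec x = x - (2 * (w ⬝ᵥ x) / (w ⬝ᵥ w)) • w := by
  rw [householder, Matrix.sub_mulVec, Matrix.one_mulVec, Matrix.smul_mulVec, Matrix.vecMulVec_mulVec]
  ext i
  simp
  ring

lemma householder_mul_self {w : Fin 4 → ℝ} (hw : w ⬝ᵥ w ≠ 0) :
    householder w * householder w = 1 := by
  have e : Matrix.vecMulVec w w * Matrix.vecMulVec w w = (w ⬝ᵥ w) • Matrix.vecMulVec w w := by
    ext i j
    simp [Matrix.mul_apply, Matrix.vecMulVec_apply, dotProduct, Finset.sum_mul]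
    exact Finset.sum_congr rfl fun k _ => by ring
  simp only [householder, sub_mul, mul_sub, one_mul, mul_one, Matrix.smul_mul, Matrix.mul_smul, e,
    smul_smul]
  ext i j
  simp
  field_simp
  ring

lemma householder_mem {w : Fin 4 → ℝ} (hw : w ⬝ᵥ w ≠ 0) :
    householder w ∈ Matrix.orthogonalGroup (Fin 4) ℝ := by
  have : (householder w).transpose = householder w := by
    ext i j
    simp [householder, Matrix.vecMulVec_apply, Matrix.one_apply, eq_comm, mul_comm (w i)]
  rw [Matrix.mem_orthogonalGroup_iff, this, householder_mul_self hw]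

lemma dotProduct_self_nonneg_real (v : Fin 4 → ℝ) : 0 ≤ v ⬝ᵥ v :=
  Finset.sum_nonneg fun i _ => mul_self_nonneg (v i)

/-- The orthogonal transformation that takes `v` to a multiple of the basis vector `e i`. -/
def alignment (i : Fin 4) (v : Fin 4 → ℝ) : Matrix (Fin 4) (Fin 4) ℝ :=
  householder (Pi.single i 1) * householder (v + √(v ⬝ᵥ v) • Pi.single i 1)

/-- The plus sign matters: v - |v| e would vanish at the basis vector e, whereas this sum stays
nonzero for all v with positive component along e. -/
lemma dotProduct_add_smul_single (i : Fin 4) (v : Fin 4 → ℝ) :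
    (v + √(v ⬝ᵥ v) • Pi.single i 1) ⬝ᵥ (v + √(v ⬝ᵥ v) • Pi.single i 1) =
      2 * √(v ⬝ᵥ v) * (√(v ⬝ᵥ v) + v i) := by
  have h : √(v ⬝ᵥ v) ^ 2 = v ⬝ᵥ v := Real.sq_sqrt (dotProduct_self_nonneg_real v)
  simp only [add_dotProduct, dotProduct_add, smul_dotProduct, dotProduct_smul, smul_eq_mul,
    single_dotProduct, dotProduct_single, Pi.add_apply, Pi.smul_apply, Pi.single_eq_same]
  linear_combination -h

lemma sqrt_dotProduct_pos {i : Fin 4} {v : Fin 4 → ℝ} (hv : 0 < v i) : 0 < √(v ⬝ᵥ v) := by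
  refine Real.sqrt_pos.2 ?_
  have : v i * v i ≤ v ⬝ᵥ v :=
    Finset.single_le_sum (f := fun i => v i * v i) (fun j _ => mul_self_nonneg (v j))
      (Finset.mem_univ i)
  nlinarith

lemma alignment_mem {i : Fin 4} {v : Fin 4 → ℝ} (hv : 0 < v i) :
    alignment i v ∈ Matrix.orthogonalGroup (Fin 4) ℝ := by
  have := sqrt_dotProduct_pos hv
  refine mul_mem (householder_mem (by simp)) (householder_mem ?_)
  rw [dotProduct_add_smul_single]
  positivity

lemma alignment_mulVec_self {i : Fin 4} {v : Fin 4 → ℝ} (hv : 0 < v i) :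
    (alignment i v).mulVec v = √(v ⬝ᵥ v) • Pi.single i 1 := by
  have h0 := sqrt_dotProduct_pos hv
  have h : √(v ⬝ᵥ v) ^ 2 = v ⬝ᵥ v := Real.sq_sqrt (dotProduct_self_nonneg_real v)
  have e : (v + √(v ⬝ᵥ v) • Pi.single i 1) ⬝ᵥ v = √(v ⬝ᵥ v) * (√(v ⬝ᵥ v) + v i) := by
    simp only [add_dotProduct, smul_dotProduct, smul_eq_mul, single_dotProduct]
    linear_combination -h
  have e2 : 2 * (√(v ⬝ᵥ v) * (√(v ⬝ᵥ v) + v i)) / (2 * √(v ⬝ᵥ v) * (√(v ⬝ᵥ v) + v i)) = 1 := by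
    field_simp
  rw [alignment, ← Matrix.mulVec_mulVec, householder_mulVec _ v, dotProduct_add_smul_single, e, e2,
    one_smul, householder_mulVec]
  ext j
  simp
  ring

/-- So the alignment of a second vector does not destroy that of a first one. -/
lemma alignment_mulVec_of_orthogonal {i : Fin 4} {v x : Fin 4 → ℝ} (hx : x i = 0)
    (hvx : v ⬝ᵥ x = 0) : (alignment i v).mulVec x = x := by
  rw [alignment, ← Matrix.mulVec_mulVec, householder_mulVec _ x, householder_mulVec]
  simp [hx, hvx]

/-- The second reflection cancels the first one at the basis vector, so that the alignment is a
rotation close to the identity for v close to it. -/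
lemma alignment_single (i : Fin 4) : alignment i (Pi.single i 1) = 1 := by
  have : householder (Pi.single i 1 + √((Pi.single i 1 : Fin 4 → ℝ) ⬝ᵥ Pi.single i 1) • Pi.single i 1) =
      householder (Pi.single i 1) := by
    have e : (Pi.single i 1 + √((Pi.single i 1 : Fin 4 → ℝ) ⬝ᵥ Pi.single i 1) • Pi.single i 1 :
        Fin 4 → ℝ) = (2 : ℝ) • Pi.single i 1 := by
      rw [two_smul]; simp
    rw [e, householder, householder]
    congr 1
    ext a b
    simp [Matrix.vecMulVec_apply]
  rw [alignment, this, householder_mul_self (by simp)]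

lemma continuousAt_alignment {i : Fin 4} {v : Fin 4 → ℝ} (hv : 0 < v i) :
    ContinuousAt (alignment i) v := by
  have h0 := sqrt_dotProduct_pos hv
  have hc : Continuous fun v : Fin 4 → ℝ => v + √(v ⬝ᵥ v) • (Pi.single i 1 : Fin 4 → ℝ) := by
    have : Continuous fun v : Fin 4 → ℝ => v ⬝ᵥ v := continuous_id.dotProduct continuous_id
    fun_prop
  have hne : (v + √(v ⬝ᵥ v) • (Pi.single i 1 : Fin 4 → ℝ)) ⬝ᵥ (v + √(v ⬝ᵥ v) • Pi.single i 1) ≠ 0 := by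
    rw [dotProduct_add_smul_single]; positivity
  have hh : ∀ w : Fin 4 → ℝ, w ⬝ᵥ w ≠ 0 → ContinuousAt householder w := fun w hw => by
    have h1 : Continuous fun w : Fin 4 → ℝ => w ⬝ᵥ w := continuous_id.dotProduct continuous_id
    have h2 : Continuous fun w : Fin 4 → ℝ => Matrix.vecMulVec w w :=
      continuous_matrix fun i j => by simp only [Matrix.vecMulVec_apply]; fun_prop
    exact continuousAt_const.sub ((continuousAt_const.div h1.continuousAt hw).smul h2.continuousAt)
  have h3 := ContinuousAt.comp (g := householder) (x := v)
    (f := fun v : Fin 4 → ℝ => v + √(v ⬝ᵥ v) • (Pi.single i 1 : Fin 4 → ℝ)) (hh _ hne)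
    hc.continuousAt
  exact continuousAt_const.mul h3

/-! ### Normal forms under rotations -/

/-- Near `z₀`, states that satisfy `P` can be rotated by rotations close to the identity into
states that satisfy `Q`. -/
def CanRotate (z₀ : State) (P Q : State → Prop) : Prop :=
  ∀ U ∈ 𝓝 z₀, ∀ᶠ z in 𝓝 z₀, P z →
    ∃ g ∈ Matrix.specialOrthogonalGroup (Fin 4) ℝ, rotate g z ∈ U ∧ Q (rotate g z)

/-- The freedom in the target neighbourhood U makes the composition possible: the first rotation
lands where the second one applies. -/
lemma CanRotate.trans {z₀ : State} {P Q R : State → Prop} (h₁ : CanRotate z₀ P Q)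
    (h₂ : CanRotate z₀ Q R) : CanRotate z₀ P R := by
  intro U hU
  filter_upwards [h₁ _ (h₂ U hU)] with z hz hP
  obtain ⟨g, hg, hg1, hg2⟩ := hz hP
  obtain ⟨k, hk, hk1, hk2⟩ := hg1 hg2
  refine ⟨k * g, mul_mem hk hg, ?_, ?_⟩
  · rwa [rotate_mul]
  · rwa [rotate_mul]

lemma continuous_rotate : Continuous fun x : Matrix (Fin 4) (Fin 4) ℝ × State => rotate x.1 x.2 := by
  have h : ∀ f : State → E4, Continuous f →
      Continuous fun x : Matrix (Fin 4) (Fin 4) ℝ × State => Matrix.toEuclideanLin x.1 (f x.2) := by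
    intro f hf
    refine (PiLp.continuous_toLp 2 _).comp ?_
    exact continuous_fst.matrix_mulVec ((PiLp.continuous_ofLp 2 _).comp (hf.comp continuous_snd))
  exact (continuous_pi fun i => h (fun z => z.1 i) (by fun_prop)).prodMk
    (continuous_pi fun i => h (fun z => z.2 i) (by fun_prop))

/-- The determinant of an orthogonal matrix is ±1, and by continuity it is positive near z₀. -/
lemma canRotate_of_continuousAt {z₀ : State} {P Q : State → Prop}
    {g : State → Matrix (Fin 4) (Fin 4) ℝ} (hg : ContinuousAt g z₀) (h1 : g z₀ = 1)
    (ho : ∀ᶠ z in 𝓝 z₀, g z ∈ Matrix.orthogonalGroup (Fin 4) ℝ)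
    (hQ : ∀ᶠ z in 𝓝 z₀, P z → Q (rotate (g z) z)) : CanRotate z₀ P Q := by
  intro U hU
  have hdet : ∀ᶠ z in 𝓝 z₀, 0 < (g z).det := by
    have hd : Continuous fun M : Matrix (Fin 4) (Fin 4) ℝ => M.det := continuous_id.matrix_det
    have h0 : 0 < (g z₀).det := by rw [h1, Matrix.det_one]; exact one_pos
    exact ((hd.tendsto (g z₀)).comp hg).eventually (lt_mem_nhds h0)
  have hU' : ∀ᶠ z in 𝓝 z₀, rotate (g z) z ∈ U := by
    have h2 : Tendsto (fun z => (g z, z)) (𝓝 z₀) (𝓝 (g z₀, z₀)) :=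
      Tendsto.prodMk_nhds hg tendsto_id
    have h3 : rotate (g z₀) z₀ = z₀ := by rw [h1, rotate_one]
    have h4 : Tendsto (fun x : Matrix (Fin 4) (Fin 4) ℝ × State => rotate x.1 x.2) (𝓝 (g z₀, z₀))
        (𝓝 z₀) := by
      conv_rhs => rw [← h3]
      exact continuous_rotate.tendsto (g z₀, z₀)
    exact (h4.comp h2).eventually_mem hU
  filter_upwards [hdet, hU', ho, hQ] with z z1 z2 z3 z4 hP
  refine ⟨g z, Matrix.mem_specialOrthogonalGroup_iff.2 ⟨z3, ?_⟩, z2, z4 hP⟩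
  have h := congrArg Matrix.det ((Matrix.mem_orthogonalGroup_iff (Fin 4) ℝ).1 z3)
  rw [Matrix.det_mul, Matrix.det_transpose, Matrix.det_one] at h
  nlinarith

lemma jacobi_rotate (m : Fin 3 → ℝ) (g : Matrix (Fin 4) (Fin 4) ℝ) (z : State) :
    jacobi₁ (rotate g z).1 = Matrix.toEuclideanLin g (jacobi₁ z.1) ∧
      jacobi₂ m (rotate g z).1 = Matrix.toEuclideanLin g (jacobi₂ m z.1) := by
  simp [jacobi₁, jacobi₂, rotate_fst]

lemma continuous_jacobi (m : Fin 3 → ℝ) :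
    Continuous jacobi₁ ∧ Continuous (jacobi₂ m) := by
  unfold jacobi₁ jacobi₂
  constructor <;> fun_prop

/-- The configuration lies in the plane of the first two axes. -/
def IsPlanar (m : Fin 3 → ℝ) (z : State) : Prop :=
  (jacobi₁ z.1 2 = 0 ∧ jacobi₁ z.1 3 = 0) ∧ jacobi₂ m z.1 2 = 0 ∧ jacobi₂ m z.1 3 = 0

lemma canRotate_of_vector {z₀ : State} {v : State → Fin 4 → ℝ} (hv : ContinuousAt v z₀) (i : Fin 4)
    (h1 : v z₀ = Pi.single i 1) {P Q : State → Prop}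
    (hQ : ∀ z, P z → 0 < v z i → Q (rotate (alignment i (v z)) z)) : CanRotate z₀ P Q := by
  have hpos : ∀ᶠ z in 𝓝 z₀, 0 < v z i :=
    ((continuous_apply i).continuousAt.comp hv).eventually (lt_mem_nhds (by simp [h1]))
  refine canRotate_of_continuousAt (g := fun z => alignment i (v z)) ?_ ?_ ?_ ?_
  · exact ContinuousAt.comp (g := alignment i) (continuousAt_alignment (by simp [h1])) hv
  · simp only [h1, alignment_single]
  · filter_upwards [hpos] with z hz using alignment_mem hz
  · filter_upwards [hpos] with z hz hP using hQ z hP hz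

/-- The vectors v₁, v₂ are the combinations of the Jacobi vectors, with coefficients from the
inverse matrix of q, that equal the first two basis vectors at z₀. They span the same plane as the
Jacobi vectors and rotate along with them, so it suffices to align them one after the other. -/
theorem canRotate_isPlanar (m : Fin 3 → ℝ) {q : Fin 4 → ℝ} (hq : jac q ≠ 0) {z₀ : State}
    (h₁ : jacobi₁ z₀.1 = !₂[q 0, q 1, 0, 0]) (h₂ : jacobi₂ m z₀.1 = !₂[q 2, q 3, 0, 0]) :
    CanRotate z₀ (fun _ => True) (IsPlanar m) := by
  obtain ⟨c1, c2⟩ := continuous_jacobi m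
  have c1' : Continuous fun z : State => jacobi₁ z.1 := c1.comp continuous_fst
  have c2' : Continuous fun z : State => jacobi₂ m z.1 := c2.comp continuous_fst
  set D := jac q with hD
  have hDq : q 0 * q 3 - q 1 * q 2 = D := rfl
  set v₁ : State → Fin 4 → ℝ := fun z => (D⁻¹ • (q 3 • jacobi₁ z.1 - q 1 • jacobi₂ m z.1) : E4).ofLp
    with hv₁
  set v₂ : State → Fin 4 → ℝ := fun z => (D⁻¹ • (q 0 • jacobi₂ m z.1 - q 2 • jacobi₁ z.1) : E4).ofLp
    with hv₂
  have cv₁ : Continuous v₁ := (PiLp.continuous_ofLp 2 _).comp (by fun_prop)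
  have cv₂ : Continuous v₂ := (PiLp.continuous_ofLp 2 _).comp (by fun_prop)
  have r₁ : ∀ g z, v₁ (rotate g z) = g.mulVec (v₁ z) := fun g z => by
    simp only [hv₁]
    rw [(jacobi_rotate m g z).1, (jacobi_rotate m g z).2, ← map_smul, ← map_smul, ← map_sub,
      ← map_smul]
    rfl
  have r₂ : ∀ g z, v₂ (rotate g z) = g.mulVec (v₂ z) := fun g z => by
    simp only [hv₂]
    rw [(jacobi_rotate m g z).1, (jacobi_rotate m g z).2, ← map_smul, ← map_smul, ← map_sub,
      ← map_smul]
    rfl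
  have b₁ : v₁ z₀ = Pi.single 0 1 := by
    funext k
    fin_cases k <;> simp [hv₁, h₁, h₂]
    · field_simp
      linear_combination hDq
    · exact Or.inr (by ring)
  have b₂ : v₂ z₀ = Pi.single 1 1 := by
    funext k
    fin_cases k <;> simp [hv₂, h₁, h₂]
    · exact Or.inr (by ring)
    · field_simp
      linear_combination hDq
  have step1 : CanRotate z₀ (fun _ => True) (fun z => ∀ j, j ≠ 0 → v₁ z j = 0) := by
    refine canRotate_of_vector cv₁.continuousAt 0 b₁ fun z _ hz j hj => ?_
    rw [r₁, alignment_mulVec_self hz]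
    simp [hj]
  -- As in Gram–Schmidt, only the part of v₂ orthogonal to the first axis is aligned, which leaves
  -- v₁ in place.
  set w : State → Fin 4 → ℝ := fun z => v₂ z - v₂ z 0 • Pi.single 0 1 with hw
  have cw : Continuous w := by fun_prop
  have step2 : CanRotate z₀ (fun z => ∀ j, j ≠ 0 → v₁ z j = 0) (IsPlanar m) := by
    refine canRotate_of_vector (v := w) cw.continuousAt 1 ?_ fun z hP hz => ?_
    · simp [hw, b₂]
    have e1 : v₁ z = v₁ z 0 • Pi.single 0 1 := by
      funext j
      by_cases hj : j = 0
      · subst hj; simp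
      · simp [hj, hP j hj]
    have e2 : v₂ z = v₂ z 0 • Pi.single 0 1 + w z := by simp [hw]
    have e0 : (alignment 1 (w z)).mulVec (Pi.single 0 1) = Pi.single 0 1 :=
      alignment_mulVec_of_orthogonal (by simp) (by simp [hw])
    have k1 := r₁ (alignment 1 (w z)) z
    rw [e1, Matrix.mulVec_smul, e0] at k1
    have k2 := r₂ (alignment 1 (w z)) z
    rw [e2, Matrix.mulVec_add, Matrix.mulVec_smul, e0, alignment_mulVec_self hz] at k2
    set z' := rotate (alignment 1 (w z)) z
    have hx : ∀ k, jacobi₁ z'.1 k = q 0 * v₁ z' k + q 1 * v₂ z' k := fun k => by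
      simp [hv₁, hv₂]
      field_simp
      rw [← hDq]
      ring
    have hy : ∀ k, jacobi₂ m z'.1 k = q 2 * v₁ z' k + q 3 * v₂ z' k := fun k => by
      simp [hv₁, hv₂]
      field_simp
      rw [← hDq]
      ring
    refine ⟨⟨?_, ?_⟩, ?_, ?_⟩
    · rw [hx, k1, k2]; simp
    · rw [hx, k1, k2]; simp
    · rw [hy, k1, k2]; simp
    · rw [hy, k1, k2]; simp
  exact step1.trans step2

/-! ### Rigidity at strict minima of the reduced Hamiltonian -/

/-- Rotation by `α` in the plane of the first two axes and by `β` in that of the last two. -/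
def blockRotation (α β : ℝ) : Matrix (Fin 4) (Fin 4) ℝ :=
  !![Real.cos α, -Real.sin α, 0, 0; Real.sin α, Real.cos α, 0, 0;
    0, 0, Real.cos β, -Real.sin β; 0, 0, Real.sin β, Real.cos β]

lemma blockRotation_mem (α β : ℝ) : blockRotation α β ∈ Matrix.orthogonalGroup (Fin 4) ℝ := by
  rw [Matrix.mem_orthogonalGroup_iff]
  have h1 := Real.cos_sq_add_sin_sq α
  have h2 := Real.cos_sq_add_sin_sq β
  ext i j
  fin_cases i <;> fin_cases j <;>
    simp [blockRotation, Matrix.mul_apply, Fin.sum_univ_four] <;>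
    first | done | ring1 | linear_combination h1 | linear_combination h2

lemma continuous_blockRotation : Continuous fun x : ℝ × ℝ => blockRotation x.1 x.2 := by
  refine continuous_matrix fun i j => ?_
  fin_cases i <;> fin_cases j <;> simp [blockRotation] <;> fun_prop

lemma blockRotation_conj_apply (α β : ℝ) (J : Matrix (Fin 4) (Fin 4) ℝ) :
    (blockRotation α β * J * (blockRotation α β).transpose) 0 2 =
      Real.cos α * Real.cos β * J 0 2 - Real.cos α * Real.sin β * J 0 3 -
        Real.sin α * Real.cos β * J 1 2 + Real.sin α * Real.sin β * J 1 3 ∧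
    (blockRotation α β * J * (blockRotation α β).transpose) 1 3 =
      Real.sin α * Real.sin β * J 0 2 + Real.sin α * Real.cos β * J 0 3 +
        Real.cos α * Real.sin β * J 1 2 + Real.cos α * Real.cos β * J 1 3 := by
  simp only [Matrix.mul_apply, Fin.sum_univ_four]
  constructor <;> simp [blockRotation] <;> ring

/-- A real 2×2 block splits into two complex numbers x and y, its parts commuting and anticommuting
with the quarter turn. The pair of rotations multiplies them by the phases α + β and α - β, and a =
d = 0 means that both are real. So the angles are read off from the arguments. -/
lemma blockRotation_diagonalizes {a b c d : ℝ} {x y : ℂ} (hx : x = ⟨b + c, d - a⟩)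
    (hy : y = ⟨c - b, -(a + d)⟩) {α β : ℝ} (hα : α = -((x.arg + y.arg) / 2))
    (hβ : β = -((x.arg - y.arg) / 2)) :
    Real.cos α * Real.cos β * a - Real.cos α * Real.sin β * b - Real.sin α * Real.cos β * c +
      Real.sin α * Real.sin β * d = 0 ∧
    Real.sin α * Real.sin β * a + Real.sin α * Real.cos β * b + Real.cos α * Real.sin β * c +
      Real.cos α * Real.cos β * d = 0 := by
  have hA : x.arg = -(α + β) := by rw [hα, hβ]; ring
  have hB : y.arg = -(α - β) := by rw [hα, hβ]; ring
  have x1 : ‖x‖ * Real.cos x.arg = b + c := by rw [Complex.norm_mul_cos_arg, hx]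
  have x2 : ‖x‖ * Real.sin x.arg = d - a := by rw [Complex.norm_mul_sin_arg, hx]
  have y1 : ‖y‖ * Real.cos y.arg = c - b := by rw [Complex.norm_mul_cos_arg, hy]
  have y2 : ‖y‖ * Real.sin y.arg = -(a + d) := by rw [Complex.norm_mul_sin_arg, hy]
  rw [hA, Real.cos_neg, Real.cos_add] at x1
  rw [hA, Real.sin_neg, Real.sin_add] at x2
  rw [hB, Real.cos_neg, Real.cos_sub] at y1
  rw [hB, Real.sin_neg, Real.sin_sub] at y2
  have eb : b = ((b + c) - (c - b)) / 2 := by ring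
  have ec : c = ((b + c) + (c - b)) / 2 := by ring
  have ea : a = -((d - a) + -(a + d)) / 2 := by ring
  have ed : d = ((d - a) - -(a + d)) / 2 := by ring
  rw [← x1, ← y1] at eb ec
  rw [← x2, ← y2] at ea ed
  rw [ea, eb, ec, ed]
  constructor <;> ring

/-- The hypotheses say that x and y are positive at z₀. There the argument is continuous and zero,
so the angles depend continuously on the state and vanish at z₀. -/
theorem canRotate_diagonal (m : Fin 3 → ℝ) {z₀ : State} (h02 : angularMomentum m z₀ 0 2 = 0)
    (h13 : angularMomentum m z₀ 1 3 = 0)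
    (hp : 0 < angularMomentum m z₀ 0 3 + angularMomentum m z₀ 1 2)
    (hn : 0 < angularMomentum m z₀ 1 2 - angularMomentum m z₀ 0 3) :
    CanRotate z₀ (IsPlanar m) (fun z => IsPlanar m z ∧ angularMomentum m z 0 2 = 0 ∧
      angularMomentum m z 1 3 = 0) := by
  set x : State → ℂ := fun z => ⟨angularMomentum m z 0 3 + angularMomentum m z 1 2,
    angularMomentum m z 1 3 - angularMomentum m z 0 2⟩ with hx
  set y : State → ℂ := fun z => ⟨angularMomentum m z 1 2 - angularMomentum m z 0 3,
    -(angularMomentum m z 0 2 + angularMomentum m z 1 3)⟩ with hy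
  have hJ : ∀ a b, Continuous fun z => angularMomentum m z a b := fun a b =>
    (continuous_angularMomentum m).matrix_elem a b
  have hmk : ∀ f g : State → ℝ, Continuous f → Continuous g →
      Continuous fun z => (⟨f z, g z⟩ : ℂ) := fun f g hf hg => by
    have : (fun z => (⟨f z, g z⟩ : ℂ)) = fun z => (f z : ℂ) + (g z : ℂ) * Complex.I := by
      funext z; exact Complex.mk_eq_add_mul_I _ _
    rw [this]; fun_prop
  have cx : Continuous x := hmk _ _ ((hJ _ _).add (hJ _ _)) ((hJ _ _).sub (hJ _ _))
  have cy : Continuous y := hmk _ _ ((hJ _ _).sub (hJ _ _)) ((hJ _ _).add (hJ _ _)).neg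
  have x0 : (x z₀).arg = 0 := by
    rw [Complex.arg_eq_zero_iff]; simp [hx, h02, h13, hp.le]
  have y0 : (y z₀).arg = 0 := by
    rw [Complex.arg_eq_zero_iff]; simp [hy, h02, h13]; linarith
  have ax : ContinuousAt (fun z => (x z).arg) z₀ :=
    ContinuousAt.comp (g := Complex.arg) (Complex.continuousAt_arg (Or.inl hp)) cx.continuousAt
  have ay : ContinuousAt (fun z => (y z).arg) z₀ :=
    ContinuousAt.comp (g := Complex.arg) (Complex.continuousAt_arg (Or.inl hn)) cy.continuousAt
  set α : State → ℝ := fun z => -(((x z).arg + (y z).arg) / 2) with hα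
  set β : State → ℝ := fun z => -(((x z).arg - (y z).arg) / 2) with hβ
  have cα : ContinuousAt α z₀ := ((ax.add ay).div_const 2).neg
  have cβ : ContinuousAt β z₀ := ((ax.sub ay).div_const 2).neg
  refine canRotate_of_continuousAt (g := fun z => blockRotation (α z) (β z)) ?_ ?_ ?_ ?_
  · exact ContinuousAt.comp (g := fun x : ℝ × ℝ => blockRotation x.1 x.2)
      (f := fun z => (α z, β z)) continuous_blockRotation.continuousAt (cα.prodMk cβ)
  · have e1 : α z₀ = 0 := by simp [hα, x0, y0]
    have e2 : β z₀ = 0 := by simp [hβ, x0, y0]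
    rw [e1, e2]
    ext i j
    fin_cases i <;> fin_cases j <;> simp [blockRotation]
  · exact Eventually.of_forall fun z => blockRotation_mem _ _
  · refine Eventually.of_forall fun z hP => ⟨?_, ?_⟩
    · obtain ⟨⟨p1, p2⟩, p3, p4⟩ := hP
      obtain ⟨j1, j2⟩ := jacobi_rotate m (blockRotation (α z) (β z)) z
      simp only [IsPlanar, j1, j2, toEuclideanLin_eq, Matrix.mulVec, dotProduct, Fin.sum_univ_four]
      simp [blockRotation, p1, p2, p3, p4]
    · rw [angularMomentum_rotate]
      obtain ⟨k1, k2⟩ := blockRotation_conj_apply (α z) (β z) (angularMomentum m z)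
      rw [k1, k2]
      exact blockRotation_diagonalizes (x := x z) (y := y z) rfl rfl rfl rfl

/-- The reduced coordinates of a state. -/
def reducedCoord (m : Fin 3 → ℝ) (z : State) : (Fin 4 → ℝ) × (Fin 4 → ℝ) :=
  (![jacobi₁ z.1 0, jacobi₁ z.1 1, jacobi₂ m z.1 0, jacobi₂ m z.1 1],
    ![nu₁ m * jacobi₁ z.2 0, nu₁ m * jacobi₁ z.2 1, nu₂ m * jacobi₂ m z.2 0,
      nu₂ m * jacobi₂ m z.2 1])

lemma continuous_reducedCoord (m : Fin 3 → ℝ) : Continuous (reducedCoord m) := by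
  obtain ⟨c1, c2⟩ := continuous_jacobi m
  have c1' : Continuous fun z : State => jacobi₁ z.1 := c1.comp continuous_fst
  have c2' : Continuous fun z : State => jacobi₂ m z.1 := c2.comp continuous_fst
  have c3' : Continuous fun z : State => jacobi₁ z.2 := c1.comp continuous_snd
  have c4' : Continuous fun z : State => jacobi₂ m z.2 := c2.comp continuous_snd
  refine (continuous_pi fun i => ?_).prodMk (continuous_pi fun i => ?_) <;> fin_cases i <;>
    simp <;> fun_prop

lemma reducedCoord_liftState {m : Fin 3 → ℝ} (hm : ∀ i, 0 < m i) (μ₁ μ₂ : ℝ)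
    (ζ : (Fin 4 → ℝ) × (Fin 4 → ℝ)) : reducedCoord m (liftState m μ₁ μ₂ ζ) = ζ := by
  have n1 := (nu₁_pos hm).ne'
  have n2 := (nu₂_pos hm).ne'
  refine Prod.ext ?_ ?_ <;> funext i <;> fin_cases i <;>
    simp [reducedCoord, liftState, jacobi_fromJacobi hm, n1, n2]

lemma angularMomentum_eq_jacobi {m : Fin 3 → ℝ} (hm : ∀ i, 0 < m i) {z : State}
    (h1 : com m z.1 = 0) (h2 : com m z.2 = 0) (a b : Fin 4) :
    angularMomentum m z a b =
      nu₁ m * (jacobi₁ z.1 a * jacobi₁ z.2 b - jacobi₁ z.2 a * jacobi₁ z.1 b) +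
        nu₂ m * (jacobi₂ m z.1 a * jacobi₂ m z.2 b - jacobi₂ m z.2 a * jacobi₂ m z.1 b) := by
  rw [← angularMomentum_fromJacobi hm, fromJacobi_jacobi hm h1, fromJacobi_jacobi hm h2]

lemma angularMomentum_of_isPlanar {m : Fin 3 → ℝ} (hm : ∀ i, 0 < m i) {z : State}
    (h1 : com m z.1 = 0) (h2 : com m z.2 = 0) (hpl : IsPlanar m z)
    (h02 : angularMomentum m z 0 2 = 0) (h13 : angularMomentum m z 1 3 = 0) :
    angularMomentum m z =
      let l := angularMomentum m z 0 1
      let b := angularMomentum m z 0 3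
      let c := angularMomentum m z 1 2
      !![0, l, 0, b; -l, 0, c, 0; 0, -c, 0, 0; -b, 0, 0, 0] := by
  have hskew : ∀ i j, angularMomentum m z i j = -angularMomentum m z j i := fun i j => by
    rw [angularMomentum_eq_jacobi hm h1 h2, angularMomentum_eq_jacobi hm h1 h2]; ring
  have hdiag : ∀ i, angularMomentum m z i i = 0 := fun i => by
    rw [angularMomentum_eq_jacobi hm h1 h2]; ring
  have h23 : angularMomentum m z 2 3 = 0 := by
    rw [angularMomentum_eq_jacobi hm h1 h2, hpl.1.1, hpl.1.2, hpl.2.1, hpl.2.2]; ring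
  ext i j
  fin_cases i <;> fin_cases j
  all_goals first
    | exact hdiag _
    | exact h02
    | exact h13
    | exact h23
    | rfl
    | exact hskew _ _
    | exact (hskew _ _).trans (neg_eq_zero.2 h02)
    | exact (hskew _ _).trans (neg_eq_zero.2 h13)
    | exact (hskew _ _).trans (neg_eq_zero.2 h23)

lemma trace_det_skew (l b c : ℝ) :
    (!![0, l, 0, b; -l, 0, c, 0; 0, -c, 0, 0; -b, 0, 0, 0] *
      (!![0, l, 0, b; -l, 0, c, 0; 0, -c, 0, 0; -b, 0, 0, 0] :
        Matrix (Fin 4) (Fin 4) ℝ).transpose).trace = 2 * (l ^ 2 + b ^ 2 + c ^ 2) ∧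
    (!![0, l, 0, b; -l, 0, c, 0; 0, -c, 0, 0; -b, 0, 0, 0] : Matrix (Fin 4) (Fin 4) ℝ).det =
      (b * c) ^ 2 := by
  constructor
  · simp only [Matrix.trace, Matrix.diag_apply, Matrix.mul_apply, Fin.sum_univ_four]
    simp
    ring
  · rw [Matrix.det_succ_row_zero]
    simp [Fin.sum_univ_succ, Matrix.det_fin_three, Fin.succAbove]
    ring

/-- A centred state in normal form is described by its reduced coordinates. -/
theorem eq_liftState {m : Fin 3 → ℝ} (hm : ∀ i, 0 < m i) {μ₁ μ₂ : ℝ} (hμ : 0 < μ₁ * μ₂)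
    {z : State} (h1 : com m z.1 = 0) (h2 : com m z.2 = 0) (hpl : IsPlanar m z)
    (h02 : angularMomentum m z 0 2 = 0) (h13 : angularMomentum m z 1 3 = 0)
    (hb : 0 < angularMomentum m z 0 3) (hbc : angularMomentum m z 0 3 < angularMomentum m z 1 2)
    (hj : jac (reducedCoord m z).1 ≠ 0)
    (htr : (angularMomentum m z * (angularMomentum m z).transpose).trace = 2 * (μ₁ ^ 2 + μ₂ ^ 2))
    (hdet : (angularMomentum m z).det = (μ₁ * μ₂) ^ 2) :
    z = liftState m μ₁ μ₂ (reducedCoord m z) := by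
  have n1 := nu₁_pos hm
  have n2 := nu₂_pos hm
  have hJ := angularMomentum_of_isPlanar hm h1 h2 hpl h02 h13
  have hl : L₃ (reducedCoord m z).1 (reducedCoord m z).2 = angularMomentum m z 0 1 := by
    rw [angularMomentum_eq_jacobi hm h1 h2]
    simp [L₃, reducedCoord]
    ring
  have e02 := angularMomentum_eq_jacobi hm h1 h2 0 2
  have e03 := angularMomentum_eq_jacobi hm h1 h2 0 3
  have e12 := angularMomentum_eq_jacobi hm h1 h2 1 2
  have e13 := angularMomentum_eq_jacobi hm h1 h2 1 3
  obtain ⟨⟨p1, p2⟩, p3, p4⟩ := hpl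
  rw [h02, p1, p3] at e02
  rw [p2, p4] at e03
  rw [p1, p3] at e12
  rw [h13, p2, p4] at e13
  set l := angularMomentum m z 0 1
  set b := angularMomentum m z 0 3
  set c := angularMomentum m z 1 2
  simp only at hJ
  rw [hJ, (trace_det_skew l b c).1] at htr
  rw [hJ, (trace_det_skew l b c).2] at hdet
  -- The determinant fixes bc only up to sign, and b, c > 0 decides it. With the trace this gives (c
  -- ± b)², and b < c selects the roots.
  have hbc' : b * c = μ₁ * μ₂ := by
    have : 0 < b * c := mul_pos hb (hb.trans hbc)
    exact (pow_left_inj₀ this.le hμ.le two_ne_zero).1 hdet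
  have hLs : Ls μ₁ μ₂ l = c + b := by
    rw [Ls, show (μ₁ + μ₂) ^ 2 - l ^ 2 = (c + b) ^ 2 by linear_combination -htr / 2 - 2 * hbc',
      Real.sqrt_sq (by linarith)]
  have hLd : Ld μ₁ μ₂ l = c - b := by
    rw [Ld, show (μ₁ - μ₂) ^ 2 - l ^ 2 = (c - b) ^ 2 by linear_combination -htr / 2 + 2 * hbc',
      Real.sqrt_sq (by linarith)]
  set D := jac (reducedCoord m z).1 with hD
  have hDq : D = jacobi₁ z.1 0 * jacobi₂ m z.1 1 - jacobi₁ z.1 1 * jacobi₂ m z.1 0 := rfl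
  have hA : area (reducedCoord m z).1 = D / 2 := rfl
  have hB : -(Ls μ₁ μ₂ l + Ld μ₁ μ₂ l) / (4 * (D / 2)) = -(c / D) := by
    rw [hLs, hLd]; field_simp; ring
  have hC : -(Ls μ₁ μ₂ l - Ld μ₁ μ₂ l) / (4 * (D / 2)) = -(b / D) := by
    rw [hLs, hLd]; field_simp; ring
  -- The four mixed entries of the angular momentum are linear in the four out-of-plane velocities;
  -- these are two systems with determinant D, solved by Cramer's rule.
  have y12 : jacobi₁ z.2 2 = (nu₁ m)⁻¹ * (jacobi₂ m z.1 0 * -(c / D)) := by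
    field_simp
    rw [hDq]
    linear_combination (-jacobi₂ m z.1 1) * e02 + jacobi₂ m z.1 0 * e12
  have y13 : jacobi₁ z.2 3 = (nu₁ m)⁻¹ * -(jacobi₂ m z.1 1 * -(b / D)) := by
    field_simp
    rw [hDq]
    linear_combination (-jacobi₂ m z.1 1) * e03 + jacobi₂ m z.1 0 * e13
  have y22 : jacobi₂ m z.2 2 = (nu₂ m)⁻¹ * -(jacobi₁ z.1 0 * -(c / D)) := by
    field_simp
    rw [hDq]
    linear_combination (jacobi₁ z.1 1) * e02 - jacobi₁ z.1 0 * e12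
  have y23 : jacobi₂ m z.2 3 = (nu₂ m)⁻¹ * (jacobi₁ z.1 1 * -(b / D)) := by
    field_simp
    rw [hDq]
    linear_combination (jacobi₁ z.1 1) * e03 - jacobi₁ z.1 0 * e13
  have g1 : jacobi₁ z.1 = !₂[jacobi₁ z.1 0, jacobi₁ z.1 1, 0, 0] := by
    ext k; fin_cases k <;> simp [p1, p2]
  have g2 : jacobi₂ m z.1 = !₂[jacobi₂ m z.1 0, jacobi₂ m z.1 1, 0, 0] := by
    ext k; fin_cases k <;> simp [p3, p4]
  refine Prod.ext ?_ ?_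
  · rw [← fromJacobi_jacobi hm h1]
    exact congrArg₂ (fromJacobi m) g1 g2
  · rw [← fromJacobi_jacobi hm h2]
    simp only [liftState, hl, hA, hB, hC]
    refine congrArg₂ (fromJacobi m) ?_ ?_
    · ext k
      fin_cases k
      · simp [reducedCoord]; field_simp
      · simp [reducedCoord]; field_simp
      · simpa [reducedCoord] using y12
      · simpa [reducedCoord] using y13
    · ext k
      fin_cases k
      · simp [reducedCoord]; field_simp
      · simp [reducedCoord]; field_simp
      · simpa [reducedCoord] using y22
      · simpa [reducedCoord] using y23

/-- The state described by a strict local minimum of the reduced Hamiltonian, with vanishing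
momenta, is rigid. -/
theorem isRigid_liftState {m : Fin 3 → ℝ} (hm : ∀ i, 0 < m i) {μ₁ μ₂ : ℝ}
    (h2 : 0 < μ₂) (h12 : μ₂ < μ₁) {q : Fin 4 → ℝ} (hq : jac q ≠ 0)
    (hmin : ∀ᶠ ζ in 𝓝[≠] (q, 0), reducedHamiltonian m μ₁ μ₂ (q, 0) < reducedHamiltonian m μ₁ μ₂ ζ) :
    IsRigid m (liftState m μ₁ μ₂ (q, 0)) := by
  set z₀ := liftState m μ₁ μ₂ (q, 0) with hz₀
  have hJ : angularMomentum m z₀ = !![0, 0, 0, μ₂; -0, 0, μ₁, 0; 0, -μ₁, 0, 0; -μ₂, 0, 0, 0] := by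
    rw [hz₀, angularMomentum_liftState hm μ₁ μ₂ hq]
    simp only [L₃_zero, Ld_zero h12, Ls_zero h2 h12]
    rw [show (μ₁ + μ₂ - (μ₁ - μ₂)) / 2 = μ₂ by ring, show (μ₁ + μ₂ + (μ₁ - μ₂)) / 2 = μ₁ by ring]
  have j03 : angularMomentum m z₀ 0 3 = μ₂ := by rw [hJ]; rfl
  have j12 : angularMomentum m z₀ 1 2 = μ₁ := by rw [hJ]; rfl
  have hcan : CanRotate z₀ (fun _ => True) (fun z => IsPlanar m z ∧
      angularMomentum m z 0 2 = 0 ∧ angularMomentum m z 1 3 = 0) := by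
    refine (canRotate_isPlanar m hq ?_ ?_).trans (canRotate_diagonal m ?_ ?_ ?_ ?_)
    · exact (jacobi_fromJacobi hm _ _).1
    · exact (jacobi_fromJacobi hm _ _).2
    · rw [hJ]; rfl
    · rw [hJ]; rfl
    · rw [j03, j12]; linarith
    · rw [j03, j12]; linarith
  have hJc : ∀ a b, Continuous fun z => angularMomentum m z a b := fun a b =>
    (continuous_angularMomentum m).matrix_elem a b
  have hζ₀ : reducedCoord m z₀ = (q, 0) := reducedCoord_liftState hm _ _ _
  have hcc : Tendsto (reducedCoord m) (𝓝 z₀) (𝓝 (q, 0)) := by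
    rw [← hζ₀]; exact (continuous_reducedCoord m).tendsto z₀
  have hjac : Continuous fun ζ : (Fin 4 → ℝ) × (Fin 4 → ℝ) => jac ζ.1 := by unfold jac; fun_prop
  have hU : ∀ᶠ z in 𝓝 z₀, 0 < angularMomentum m z 0 3 ∧
      angularMomentum m z 0 3 < angularMomentum m z 1 2 ∧ jac (reducedCoord m z).1 ≠ 0 ∧
      (reducedCoord m z ≠ (q, 0) → reducedHamiltonian m μ₁ μ₂ (q, 0) <
        reducedHamiltonian m μ₁ μ₂ (reducedCoord m z)) := by
    refine (((hJc 0 3).tendsto z₀).eventually (lt_mem_nhds (by rwa [j03]))).and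
      (((hJc 0 3).continuousAt.eventually_lt (hJc 1 2).continuousAt (by rwa [j03, j12])).and
      ((hcc.eventually (hjac.continuousAt.eventually_ne hq)).and
        (hcc.eventually (eventually_nhdsWithin_iff.1 hmin))))
  filter_upwards [hcan _ hU] with z hz hc1 hc2 hdev
  obtain ⟨g, hg, ⟨u1, u2, u3, u4⟩, hpl, k02, k13⟩ := hz trivial
  have hgo := mem_orthogonal_of_special hg
  refine ⟨g, hg, ?_⟩
  set z' := rotate g z with hz'
  have c1 : com m z'.1 = 0 := by rw [hz', (com_rotate _ _ _).1, hc1, map_zero]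
  have c2 : com m z'.2 = 0 := by rw [hz', (com_rotate _ _ _).2, hc2, map_zero]
  have hdev' : deviation m z₀ z' = 0 := by rw [hz', deviation_rotate hgo, hdev]
  have hE : energy m z' = energy m z₀ ∧
      (angularMomentum m z' * (angularMomentum m z').transpose).trace =
        (angularMomentum m z₀ * (angularMomentum m z₀).transpose).trace ∧
      (angularMomentum m z').det = (angularMomentum m z₀).det := by
    unfold deviation at hdev'
    have a1 := abs_nonneg (energy m z' - energy m z₀)
    have a2 := abs_nonneg ((angularMomentum m z' * (angularMomentum m z').transpose).trace -
        (angularMomentum m z₀ * (angularMomentum m z₀).transpose).trace)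
    have a3 := abs_nonneg ((angularMomentum m z').det - (angularMomentum m z₀).det)
    refine ⟨?_, ?_, ?_⟩ <;> refine sub_eq_zero.1 (abs_eq_zero.1 ?_) <;> linarith
  rw [hJ, (trace_det_skew _ _ _).1, (trace_det_skew _ _ _).2] at hE
  have hlift := eq_liftState hm (mul_pos (h2.trans h12) h2) c1 c2 hpl k02 k13 u1 u2 u3
    (by rw [hE.2.1]; ring) (by rw [hE.2.2]; ring)
  -- The energy of z' equals that of z₀ and is the value of H at its reduced coordinates; a strict
  -- minimum leaves only the point itself.
  have hfin : reducedCoord m z' = (q, 0) := by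
    by_contra hne
    have := u4 hne
    rw [← energy_liftState hm, ← energy_liftState hm, ← hlift, hE.1] at this
    exact lt_irrefl _ this
  rw [hlift, hfin]

/-! ### Relabelling the bodies -/

lemma accel_relabel (m : Fin 3 → ℝ) (σ : Equiv.Perm (Fin 3)) (r : Fin 3 → E4) :
    accel m (r ∘ σ.symm) = accel (m ∘ σ) r ∘ σ.symm := by
  funext i
  simp only [accel, Function.comp_apply]
  refine Finset.sum_equiv σ.symm (fun j => ?_) (fun j _ => by simp)
  simp

lemma com_relabel (m : Fin 3 → ℝ) (σ : Equiv.Perm (Fin 3)) (r : Fin 3 → E4) :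
    com m (r ∘ σ.symm) = com (m ∘ σ) r := by
  simp only [com, Function.comp_apply]
  rw [← Equiv.sum_comp σ m, ← Equiv.sum_comp σ fun i => m i • r (σ.symm i)]
  simp

lemma angularMomentum_relabel (m : Fin 3 → ℝ) (σ : Equiv.Perm (Fin 3)) (z : State) :
    angularMomentum m (relabel σ z) = angularMomentum (m ∘ σ) z := by
  ext a b
  simp only [angularMomentum, Matrix.of_apply, relabel, Function.comp_apply]
  rw [← Equiv.sum_comp σ]
  simp

lemma centred_relabel (m : Fin 3 → ℝ) (σ : Equiv.Perm (Fin 3)) (z : State) :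
    centred m (relabel σ z) = relabel σ (centred (m ∘ σ) z) := by
  simp only [centred, relabel, com_relabel]
  rfl

lemma rotate_relabel (g : Matrix (Fin 4) (Fin 4) ℝ) (σ : Equiv.Perm (Fin 3)) (z : State) :
    rotate g (relabel σ z) = relabel σ (rotate g z) := rfl

lemma relabel_symm_relabel (σ : Equiv.Perm (Fin 3)) (z : State) :
    relabel σ.symm (relabel σ z) = z := by
  refine Prod.ext ?_ ?_ <;> funext i <;> simp [relabel]

lemma norm_relabel (σ : Equiv.Perm (Fin 3)) (z : State) : ‖relabel σ z‖ = ‖z‖ := by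
  have h : ∀ r : Fin 3 → E4, ‖r ∘ σ.symm‖ = ‖r‖ := fun r => by
    refine le_antisymm ?_ ?_
    · exact (pi_norm_le_iff_of_nonneg (norm_nonneg _)).2 fun i => norm_le_pi_norm r (σ.symm i)
    · refine (pi_norm_le_iff_of_nonneg (norm_nonneg _)).2 fun i => ?_
      simpa using norm_le_pi_norm (r ∘ σ.symm) (σ i)
  rw [Prod.norm_def, Prod.norm_def, relabel, h, h]

lemma dist_relabel (σ : Equiv.Perm (Fin 3)) (z w : State) :
    dist (relabel σ z) (relabel σ w) = dist z w := by
  rw [dist_eq_norm, dist_eq_norm, ← norm_relabel σ (z - w)]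
  rfl

lemma IsSolutionOn.relabel {m : Fin 3 → ℝ} {σ : Equiv.Perm (Fin 3)} {z : ℝ → State} {s : Set ℝ}
    (h : IsSolutionOn (m ∘ σ) z s) : IsSolutionOn m (fun t => relabel σ (z t)) s := by
  intro t ht
  obtain ⟨hi, hd⟩ := h t ht
  refine ⟨hi.comp σ.symm.injective, ?_⟩
  obtain ⟨hr, hv⟩ := hasDerivAt_state hd
  have e : accel m (ThreeBody.relabel σ (z t)).1 = accel (m ∘ σ) (z t).1 ∘ σ.symm :=
    accel_relabel m σ (z t).1
  rw [e]
  exact (hasDerivAt_pi.2 fun i => hr (σ.symm i)).prodMk (hasDerivAt_pi.2 fun i => hv (σ.symm i))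

lemma IsSolutionOn.relabel_symm {m : Fin 3 → ℝ} {σ : Equiv.Perm (Fin 3)} {z : ℝ → State}
    {s : Set ℝ} (h : IsSolutionOn m z s) :
    IsSolutionOn (m ∘ σ) (fun t => ThreeBody.relabel σ.symm (z t)) s := by
  refine IsSolutionOn.relabel ?_
  have : (m ∘ σ) ∘ σ.symm = m := by funext i; simp
  rwa [this]

lemma IsRelativeEquilibrium.relabel {m : Fin 3 → ℝ} {σ : Equiv.Perm (Fin 3)} {z₀ : State}
    (h : IsRelativeEquilibrium (m ∘ σ) z₀) : IsRelativeEquilibrium m (relabel σ z₀) := by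
  obtain ⟨ξ, hξ, hs⟩ := h
  exact ⟨ξ, hξ, hs.relabel⟩

/-- Relabelling is an isometry of the phase space that commutes with rotations and centring and maps
solutions to solutions. -/
lemma IsLyapunovStable.relabel {m : Fin 3 → ℝ} {σ : Equiv.Perm (Fin 3)} {z₀ : State}
    (h : IsLyapunovStable (m ∘ σ) z₀) : IsLyapunovStable m (relabel σ z₀) := by
  intro ε hε
  obtain ⟨δ, hδ, hb⟩ := h ε hε
  have hsymm : ∀ z, ThreeBody.relabel σ (ThreeBody.relabel σ.symm z) = z := fun z =>
    relabel_symm_relabel σ.symm z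
  refine ⟨δ, hδ, fun w hw => ?_⟩
  have hw' : dist (ThreeBody.relabel σ.symm w) z₀ < δ := by
    rwa [← dist_relabel σ, hsymm]
  obtain ⟨⟨z, hz0, hz⟩, hstay⟩ := hb _ hw'
  refine ⟨⟨_, ?_, hz.relabel⟩, fun z a b ha hb' hz0 hz t ht => ?_⟩
  · simp only [hz0, hsymm]
  · obtain ⟨g, hg, hlt⟩ := hstay _ a b ha hb' (by simp only [hz0]) hz.relabel_symm t ht
    refine ⟨g, hg, ?_⟩
    rw [centred_relabel, rotate_relabel]
    rw [← dist_relabel σ, ← centred_relabel, hsymm] at hlt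
    exact hlt

/-! ### The family of relative equilibria -/

/-- As `μ → 0⁺`, the configurations of a critical family converge to a collision of the pair. -/
theorem IsCriticalFamily.tendsto_collision {m : Fin 3 → ℝ} (hm : ∀ i, 0 < m i)
    {Q : Fin 4 → ℝ → ℝ} (hQ : IsCriticalFamily m Q) {μ₁ : ℝ} (hμ₁ : 0 < μ₁) :
    ∃ c : Fin 3 → E4, c 1 = c 2 ∧ c 0 ≠ c 1 ∧
      Tendsto (fun μ => (liftState m μ₁ (μ * μ₁) (familyPoint m Q μ₁ μ)).1) (𝓝[>] 0) (𝓝 c) := by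
  have pk := kappa_pos hm
  set L := kappa m * μ₁ ^ 2 with hL
  have hL0 : 0 < L := by positivity
  set conf : (Fin 4 → ℝ) → Fin 3 → E4 := fun q =>
    fromJacobi m !₂[q 0, q 1, 0, 0] !₂[q 2, q 3, 0, 0] with hconf
  have hcont : Continuous conf := by
    have h : ∀ f g : (Fin 4 → ℝ) → ℝ, Continuous f → Continuous g →
        Continuous fun q => (!₂[f q, g q, 0, 0] : E4) := fun f g hf hg => by
      refine (PiLp.continuous_toLp 2 _).comp (continuous_pi fun i => ?_)
      fin_cases i <;> simp <;> first | exact hf | exact hg | exact continuous_const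
    have h1 := h (fun q => q 0) (fun q => q 1) (continuous_apply _) (continuous_apply _)
    have h2 := h (fun q => q 2) (fun q => q 3) (continuous_apply _) (continuous_apply _)
    refine continuous_pi fun i => ?_
    fin_cases i <;> simp only [hconf, fromJacobi, Fin.zero_eta, Fin.mk_one, Fin.reduceFinMk,
      Matrix.cons_val] <;> fun_prop
  have hu := tendsto_uParam hm
  have e1 := (hQ.tendsto_scaled hm).comp hu
  have hsp : Continuous fun x : ((ℝ × ℝ × ℝ) × ℝ) × ℝ => scaledPoint (uScale m) L x.2 x.1 := by
    refine continuous_pi fun i => ?_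
    fin_cases i <;> simp [scaledPoint] <;> fun_prop
  -- Unlike its inverse, `scaledPoint` is continuous up to u = 0; the limit configuration is q = (0,
  -- 0, 0, L).
  have hlim := ((hcont.comp hsp).tendsto (((1, 0, 0), 1), 0)).comp
    (e1.prodMk_nhds (hu.mono_right nhdsWithin_le_nhds))
  have hY := e1.eventually ((continuous_snd.tendsto ((((1 : ℝ), (0 : ℝ), (0 : ℝ))), (1 : ℝ))).eventually
    (lt_mem_nhds one_pos))
  refine ⟨_, ?_, ?_, hlim.congr' ?_⟩
  · refine sub_eq_zero.1 ?_
    change fromJacobi m _ _ 1 - fromJacobi m _ _ 2 = _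
    rw [(fromJacobi_sub hm _ _).1]
    ext k
    fin_cases k <;> simp [scaledPoint]
  · refine sub_ne_zero.1 ?_
    change fromJacobi m _ _ 0 - fromJacobi m _ _ 1 ≠ _
    rw [(fromJacobi_sub hm _ _).2.2]
    intro h
    have := congrArg (fun x : E4 => x 1) h
    simp [scaledPoint, hL0.ne'] at this
  · filter_upwards [hY, hu self_mem_nhdsWithin] with μ h3 h0
    have h3 : Q 3 (uParam m μ) ≠ 0 := ne_of_gt h3
    have := IsCriticalFamily.familyPoint_eq (Q := Q) hm (μ₁ := μ₁) h0 h3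
    have key := (congrArg (fun x => (familyPoint m Q μ₁ x).1)
      (uScale_mul_uParam hm μ).symm).trans (congrArg Prod.fst this)
    exact (congrArg conf key).symm

end ThreeBody

end

theorem theorem4 (m : Fin 3 → ℝ) (hm : ∀ i, 0 < m i) (σ : Equiv.Perm (Fin 3)) :
    (∃ Q : Fin 4 → ℝ → ℝ, ThreeBody.IsCriticalFamily (m ∘ σ) Q) ∧
    ∀ Q : Fin 4 → ℝ → ℝ, ThreeBody.IsCriticalFamily (m ∘ σ) Q →
      (∀ᶠ μ : ℝ in 𝓝[>] 0, ∀ μ₁ : ℝ, 0 < μ₁ →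
        (∀ᶠ ζ in 𝓝[≠] (ThreeBody.familyPoint (m ∘ σ) Q μ₁ μ),
          ThreeBody.reducedHamiltonian (m ∘ σ) μ₁ (μ * μ₁)
              (ThreeBody.familyPoint (m ∘ σ) Q μ₁ μ) <
            ThreeBody.reducedHamiltonian (m ∘ σ) μ₁ (μ * μ₁) ζ) ∧
        (ThreeBody.angularMomentum m (ThreeBody.familyState m σ Q μ₁ μ)).charpoly =
          (Polynomial.X ^ 2 + Polynomial.C (μ₁ ^ 2)) *
            (Polynomial.X ^ 2 + Polynomial.C ((μ * μ₁) ^ 2)) ∧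
        ThreeBody.IsRelativeEquilibrium m (ThreeBody.familyState m σ Q μ₁ μ) ∧
        ThreeBody.IsLyapunovStable m (ThreeBody.familyState m σ Q μ₁ μ) ∧
        ThreeBody.HasBallOfBoundedOrbits m (ThreeBody.familyState m σ Q μ₁ μ)) ∧
      ∀ μ₁ : ℝ, 0 < μ₁ → ∃ c : Fin 3 → ThreeBody.E4,
        c (σ 1) = c (σ 2) ∧ c (σ 0) ≠ c (σ 1) ∧
        Tendsto (fun μ : ℝ => (ThreeBody.familyState m σ Q μ₁ μ).1) (𝓝[>] 0) (𝓝 c) := by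
  have hm' : ∀ i, 0 < (m ∘ σ) i := fun i => hm (σ i)
  refine ⟨ThreeBody.exists_isCriticalFamily hm', fun Q hQ => ⟨?_, fun μ₁ hμ₁ => ?_⟩⟩
  · filter_upwards [hQ.eventually_strict_min hm', hQ.eventually_nondegenerate hm', hQ.critical] with
      μ hmin ⟨⟨h0, h1⟩, hnd⟩ hcrit μ₁ hμ₁
    have h2 : 0 < μ * μ₁ := by positivity
    have h12 : μ * μ₁ < μ₁ := by nlinarith
    have hj := (hnd μ₁ hμ₁).1.ne'
    have hgrad := (ThreeBody.hasFDerivAt_zero_iff hm' h2 h12 hj).1 (hcrit μ₁ hμ₁)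
    -- Stability is proved for the masses m ∘ σ, with the close pair in the last two places, and
    -- then transported to the original labels.
    have hstable : ThreeBody.IsLyapunovStable m (ThreeBody.familyState m σ Q μ₁ μ) :=
      ((ThreeBody.isRigid_liftState hm' h2 h12 hj (hmin μ₁ hμ₁)).isLyapunovStable hm'
        (ThreeBody.injective_liftState hm' _ _ hj) (ThreeBody.com_liftState hm' _ _ _).1
        (ThreeBody.com_liftState hm' _ _ _).2).relabel
    refine ⟨hmin μ₁ hμ₁, ?_,
      (ThreeBody.isRelativeEquilibrium_liftState hm' h2 h12 hj hgrad).relabel, hstable,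
      hstable.hasBallOfBoundedOrbits⟩
    have hJ := ThreeBody.angularMomentum_liftState hm' μ₁ (μ * μ₁) (p := 0) hj
    simp only [ThreeBody.L₃_zero, ThreeBody.Ld_zero h12, ThreeBody.Ls_zero h2 h12, neg_zero] at hJ
    rw [show (μ₁ + μ * μ₁ - (μ₁ - μ * μ₁)) / 2 = μ * μ₁ by ring,
      show (μ₁ + μ * μ₁ + (μ₁ - μ * μ₁)) / 2 = μ₁ by ring] at hJ
    rw [ThreeBody.familyState, ThreeBody.angularMomentum_relabel]
    exact (congrArg Matrix.charpoly hJ).trans (ThreeBody.charpoly_antidiagonal _ _)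
  · obtain ⟨c, h12, h01, hc⟩ := hQ.tendsto_collision hm' hμ₁
    refine ⟨c ∘ σ.symm, by simpa using h12, by simpa using h01, ?_⟩
    have hcont : Continuous fun r : Fin 3 → ThreeBody.E4 => r ∘ σ.symm :=
      continuous_pi fun i => continuous_apply (σ.symm i)
    exact (hcont.tendsto c).comp hc
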